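/- **Setting.** Let $p\ge 2$ be an integer and $\mathcal S^{p-1}=\{x\in\mathbb R^p:\|x\|=1\}$. For $\theta\in\mathcal S^{p-1}$, $\kappa>0$ and $f:\mathbb R\to[0,\infty)$, let $\mathrm{Rot}_p(\theta,\kappa,f)$ be the distribution on $\mathcal S^{p-1}$ with density $$x\mapsto \frac{c_{p,\kappa,f}\,\Gamma(\frac{p-1}{2})}{2\pi^{(p-1)/2}}\,f(\kappa x'\theta),\qquad c_{p,\kappa,f}=1\Big/\int_{-1}^1(1-s^2)^{(p-3)/2}f(\kappa s)\,ds,$$ with respect to the surface area measure, and let $\mathrm P^{(n)}_{\theta,\kappa,f}$ be the joint law of $n$ independent observations $X_{n1},\dots,X_{nn}$ from it; $\bar X_n=\frac1n\sum_{i=1}^nX_{ni}$. Write $\varphi_f=f'/f$, and use the convention $\log 0=-\infty$ (so that $e^{\log 0}=0$). $\mathcal F$ is the class of functions $f:\mathbb R\to[0,\infty)$ that (i) are non-decreasing on $(-\infty,0]$ and strictly increasing on $[0,\infty)$; (ii) are differentiable on some $(M,\infty)$; (iii) are such that $\kappa\mapsto\kappa\varphi_f(\kappa)$ is non-decreasing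 on some $(M,\infty)$ and diverges to $\infty$ as $\kappa\to\infty$; (iv) satisfy, for all $\xi,\zeta>-1$, as $\kappa\to\infty$, $$\int_{-1}^1(1-s)^\xi(1+s)^\zeta\big|e^{\log f(\kappa s)-\log f(\kappa)}-e^{(s-1)\kappa\varphi_f(\kappa)}\big|\,ds=o\big((\kappa\varphi_f(\kappa))^{-(\xi+1)}\big).$$ Given a positive sequence $(\kappa_n)$ with $\kappa_n\to\infty$ and a bounded nonnegative sequence $(t_n)$, put $\nu_n=1/\sqrt{n\kappa_n\varphi_f(\kappa_n)}$. The class $\mathcal F_{\rm LAN}(p,\kappa_n,t_n)$ consists of the $f\in\mathcal F$ such that, as $\kappa\to\infty$, $$\frac1{f(\kappa)}\int_{-1}^1(\varphi_f(\kappa s)-\varphi_f(\kappa))^2(1-s^2)^{(p-3)/2}f(\kappa s)\,ds=o\Big(\frac1{\kappa^{(p+1)/2}(\varphi_f(\kappa))^{(p-3)/2}}\Big)$$ and such that, with $h_n^\pm(s,w)=-\frac12t_n^2\kappa_n\nu_n^2s\pm(1-\frac14\nu_n^2t_n^2)^{1/2}t_n\kappa_n\nu_n(1-s^2)^{1/2}w^{1/2}$,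 for both signs, as $n\to\infty$, $$\frac1{f(\kappa_n)}\int_{-1}^1\int_0^1\big|\log f(\kappa_ns+h_n^\pm(s,w))-\log f(\kappa_ns)-h_n^\pm(s,w)\varphi_f(\kappa_ns)\big|\,f(\kappa_ns)(1-s^2)^{(p-3)/2}\,dG_p(w)\,ds=o\Big(\frac1{n(\kappa_n\varphi_f(\kappa_n))^{(p-1)/2}}\Big),$$ where $G_p$ is the $\mathrm{Beta}(\frac12,\frac{p-2}2)$ distribution if $p\ge3$ and the Dirac mass at $1$ if $p=2$. (Integrands are taken to be $0$ where the factor $f(\kappa s)$, respectively $f(\kappa_ns)$, vanishes.) **Theorem 7.** Fix $p\ge2$ and $\theta\in\mathcal S^{p-1}$. Let $(\kappa_n)$ be a positive real sequence that diverges to infinity, and let $(\tau_n)$ be a bounded sequence in $\mathbb R^p$ such that $\theta_n=\theta+\nu_n\tau_n\in\mathcal S^{p-1}$ for all $n$, with $\nu_n=1/\sqrt{n\kappa_n\varphi_f(\kappa_n)}$. Assume that $f\in\mathcal F_{\rm LAN}(p,\kappa_n,\|\tau_n\|)$. Then, as $n\to\infty$ under $\mathrm P^{(n)}_{\theta,\kappa_n,f}$,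 $$\log\frac{d\mathrm P^{(n)}_{\theta+\nu_n\tau_n,\kappa_n,f}}{d\mathrm P^{(n)}_{\theta,\kappa_n,f}}=\tau_n'\Delta^{(n)}_{\theta,f}-\frac12\tau_n'\Gamma_\theta\tau_n+o_{\rm P}(1),$$ where the central sequence $\Delta^{(n)}_{\theta,f}=\nu_n^{-1}(I_p-\theta\theta')\bar X_n$ converges in distribution, still under $\mathrm P^{(n)}_{\theta,\kappa_n,f}$, to the normal distribution with mean zero and covariance matrix $\Gamma_\theta=I_p-\theta\theta'$. -/

import Mathlib

open Real Set Filter Topology MeasureTheory ProbabilityTheory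
open scoped ENNReal RealInnerProductSpace

namespace HighConc

noncomputable section

/-- Euclidean space `ℝ^p`. -/
abbrev E (p : ℕ) : Type := EuclideanSpace ℝ (Fin p)

/-- The unit sphere `S^{p-1}` of `ℝ^p`. -/
abbrev Sph (p : ℕ) : Type := Metric.sphere (0 : E p) 1

/-! ### The rotationally symmetric model -/

/-- The constant `c_{p,κ,f} = 1 / ∫_{-1}^1 (1-s²)^{(p-3)/2} f(κs) ds`. -/
def normConst (p : ℕ) (κ : ℝ) (f : ℝ → ℝ) : ℝ :=
  1 / ∫ s in (-1 : ℝ)..1, (1 - s ^ 2) ^ (((p : ℝ) - 3) / 2) * f (κ * s)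

/-- The density `x ↦ c_{p,κ,f} Γ((p-1)/2) / (2 π^{(p-1)/2}) f(κ x'θ)` on the sphere. -/
def rotDensity (p : ℕ) (θ : E p) (κ : ℝ) (f : ℝ → ℝ) (x : Sph p) : ℝ :=
  normConst p κ f * Real.Gamma (((p : ℝ) - 1) / 2) / (2 * π ^ (((p : ℝ) - 1) / 2))
    * f (κ * ⟪(x : E p), θ⟫)

/-- The distribution `Rot_p(θ, κ, f)`: it has the above density with respect to the surface
area measure of the sphere. -/
def rot (p : ℕ) (θ : E p) (κ : ℝ) (f : ℝ → ℝ) : Measure (Sph p) :=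
  (volume : Measure (E p)).toSphere.withDensity
    (fun x => ENNReal.ofReal (rotDensity p θ κ f x))

/-- The joint law `P^{(n)}_{θ,κ,f}` of `n` independent observations from `Rot_p(θ, κ, f)`. -/
def sampleLaw (p n : ℕ) (θ : E p) (κ : ℝ) (f : ℝ → ℝ) : Measure (Fin n → Sph p) :=
  Measure.pi (fun _ => rot p θ κ f)

/-! ### Angular functions -/

/-- `φ_f = f' / f`. -/
def phi (f : ℝ → ℝ) (z : ℝ) : ℝ := deriv f z / f z

/-- `I = o(r)` along `l`, for an extended nonnegative quantity `I` (typically the integral of a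
nonnegative function) and a real quantity `r` that is eventually positive. -/
def IsSmallO {α : Type*} (l : Filter α) (I : α → ℝ≥0∞) (r : α → ℝ) : Prop :=
  ∀ ε : ℝ, 0 < ε → ∀ᶠ x in l, I x ≤ ENNReal.ofReal (ε * r x)

/-- The class `𝓕` of angular functions. -/
structure InF (f : ℝ → ℝ) : Prop where
  nonneg : ∀ z, 0 ≤ f z
  monotoneOn_neg : MonotoneOn f (Iic 0)
  strictMonoOn_pos : StrictMonoOn f (Ici 0)
  differentiable_near_top : ∃ M : ℝ, ∀ z, M < z → DifferentiableAt ℝ f z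
  tendsto_mul_phi : Tendsto (fun κ : ℝ => κ * phi f κ) atTop atTop
  monotone_mul_phi : ∃ M : ℝ, MonotoneOn (fun κ : ℝ => κ * phi f κ) (Ioi M)
  /-- `exp(log f(κs) - log f(κ))` is written `f(κs) / f(κ)`. -/
  exp_approx : ∀ ξ ζ : ℝ, -1 < ξ → -1 < ζ →
    IsSmallO (atTop : Filter ℝ)
      (fun κ => ∫⁻ s in Icc (-1 : ℝ) 1, ENNReal.ofReal
        ((1 - s) ^ ξ * (1 + s) ^ ζ * |f (κ * s) / f κ - Real.exp ((s - 1) * (κ * phi f κ))|))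
      (fun κ => 1 / (κ * phi f κ) ^ (ξ + 1))

/-- The rate `ν_n = 1 / √(n κ_n φ_f(κ_n))`. -/
def rate (f : ℝ → ℝ) (κ : ℕ → ℝ) (n : ℕ) : ℝ :=
  1 / Real.sqrt ((n : ℝ) * κ n * phi f (κ n))

/-- The law `G_p` on `[0, 1]`: `Beta(1/2, (p-2)/2)` for `p ≥ 3`, the Dirac mass at `1` for
`p = 2`. -/
def lawG (p : ℕ) : Measure ℝ :=
  if p = 2 then Measure.dirac 1 else betaMeasure (1 / 2) (((p : ℝ) - 2) / 2)

/-- `h_n^σ(s, w) = -½ t² κ ν² s + σ c t κ ν (1-s²)^{1/2} w^{1/2}` with `c = (1 - ¼ν²t²)^{1/2}`;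
the sign is `σ = ±1`. -/
def hFun (σ t κ ν s w : ℝ) : ℝ :=
  -(1 / 2) * t ^ 2 * κ * ν ^ 2 * s
    + σ * (Real.sqrt (1 - 1 / 4 * ν ^ 2 * t ^ 2) * t * κ * ν * Real.sqrt (1 - s ^ 2) * Real.sqrt w)

/-- `|log f(a+h) - log f(a) - h φ_f(a)| f(a)`, where `log 0 = -∞`: the value is `0` if
`f(a) = 0`, and it is `∞` if `f(a) ≠ 0` and `f(a+h) = 0`. -/
def logRemainder (f : ℝ → ℝ) (a h : ℝ) : ℝ≥0∞ :=
  open Classical in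
  if f a = 0 then 0
  else if f (a + h) = 0 then ∞
  else ENNReal.ofReal (|Real.log (f (a + h)) - Real.log (f a) - h * phi f a| * f a)

/-- The class `𝓕_LAN(p, κ_n, t_n)` of angular functions. -/
structure InFLAN (p : ℕ) (κ t : ℕ → ℝ) (f : ℝ → ℝ) : Prop where
  inF : InF f
  score_approx :
    IsSmallO (atTop : Filter ℝ)
      (fun k => ENNReal.ofReal (1 / f k) * ∫⁻ s in Icc (-1 : ℝ) 1, ENNReal.ofReal
        ((phi f (k * s) - phi f k) ^ 2 * (1 - s ^ 2) ^ (((p : ℝ) - 3) / 2) * f (k * s)))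
      (fun k => 1 / (k ^ (((p : ℝ) + 1) / 2) * (phi f k) ^ (((p : ℝ) - 3) / 2)))
  log_approx : ∀ σ : ℝ, σ = 1 ∨ σ = -1 →
    IsSmallO (atTop : Filter ℕ)
      (fun n => ENNReal.ofReal (1 / f (κ n)) *
        ∫⁻ s in Icc (-1 : ℝ) 1, ∫⁻ w,
          logRemainder f (κ n * s) (hFun σ (t n) (κ n) (rate f κ n) s w)
            * ENNReal.ofReal ((1 - s ^ 2) ^ (((p : ℝ) - 3) / 2)) ∂(lawG p))
      (fun n => 1 / ((n : ℝ) * (κ n * phi f (κ n)) ^ (((p : ℝ) - 1) / 2)))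

/-! ### Local asymptotic normality -/

/-- The log-likelihood ratio `log dP/dQ`, with values in `[-∞, ∞]`. -/
def logLR {Ω : Type*} [MeasurableSpace Ω] (P Q : Measure Ω) (x : Ω) : EReal :=
  ENNReal.log (P.rnDeriv Q x)

/-- `R_n = o_P(1)` under the sequence of laws `P_n`. -/
def IsLittleOP {Ω : ℕ → Type*} [∀ n, MeasurableSpace (Ω n)] (P : ∀ n, Measure (Ω n))
    (R : ∀ n, Ω n → EReal) : Prop :=
  ∀ ε : ℝ, 0 < ε →
    Tendsto (fun n => P n {x | ENNReal.ofReal ε ≤ (R n x).abs}) atTop (𝓝 0)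

/-- The sample mean of `n` points of the sphere. -/
def sampleMean {p n : ℕ} (x : Fin n → Sph p) : E p :=
  (n : ℝ)⁻¹ • ∑ i, (x i : E p)

/-- The matrix `Γ_θ = I_p - θθ'`. -/
def infoMatrix {p : ℕ} (θ : E p) : Matrix (Fin p) (Fin p) ℝ :=
  1 - Matrix.vecMulVec θ.ofLp θ.ofLp

/-- The central sequence `Δ_n = ν⁻¹ (I_p - θθ') X̄_n`. -/
def centralSeq {p n : ℕ} (θ : E p) (ν : ℝ) (x : Fin n → Sph p) : E p :=
  ν⁻¹ • Matrix.toEuclideanCLM (𝕜 := ℝ) (infoMatrix θ) (sampleMean x)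

end

end HighConc

/-! Write `u = x'θ`, `φ = φ_f(κ_n)`, `ν = ν_n`, so that `n κ φ ν² = 1`. Up to an error controlled by
the second condition of `InFLAN`, the log-likelihood ratio is linear in the shifts `κ ν X_i'τ`, with
slopes `φ_f(κ u_i)`. Replacing every slope by `φ` leaves `κ φ ν Σ X_i'τ = ν⁻¹ X̄'τ`. Since `θ + ντ`
is a unit vector, `τ'θ = -½ν‖τ‖²`. Hence `τ` is tangent up to order `ν`, its tangential part yields
`τ'Δ`, and its component along `θ` yields `-½‖τ‖²` times the mean of the `u_i`, which tends to `1`.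
This is the quadratic term, up to `⅛ν²‖τ‖⁴`. The identity is exact, and
`abs_logLikelihood_expansion_le` lists what is left over: (A) the linearisation errors, small in
`L¹` (`InFLAN.tendsto_logError`); (B) the slope differences against the tangential part of `τ`; this
sum is centred by symmetry about `θ`, so its second moment is `n` times that of one term
(`InFLAN.tendsto_tangential`); (C) the slope differences against the component along `θ`, not
centred but carrying an extra factor `ν` (`InFLAN.tendsto_radial`); (D) the deviation of the mean of
the `u_i` from `1`, and the term `⅛ν²‖τ‖⁴` (`InFLAN.tendsto_deterministic`). All are bounded in
expectation, and Markov's inequality concludes. The bound is allowed to be `∞`, which absorbs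
samples where the ratio is `-∞`.

Two computations feed these bounds. Slicing the sphere orthogonally to `θ` turns expectations into
the integrals over `[-1,1]` and against `G_p` that appear in the hypotheses. Laplace's method at `s
= 1`, transferred to `f` by condition (iv), gives the order of the normalising constant and of the
moments of `1 - u` (`InF.tendsto_integral`, `InF.tendsto_moment`).

For the central limit theorem, rotational symmetry gives mean zero and a covariance proportional to
`I - θθ'` in the tangent directions. With the moment asymptotics, a third-order expansion of the
characteristic function has error `O(n^{-1/2})` after multiplication by `n`; Lévy's theorem
concludes. -/

namespace HighConc

/-! ### Integration over the sphere: polar coordinates and slices -/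

/-- Polar coordinates in `ℝ^{m+1}`. -/
theorem lintegral_eq_lintegral_toSphere {m : ℕ} {F : E (m + 1) → ℝ≥0∞} (hF : Measurable F) :
    ∫⁻ y, F y = ∫⁻ x : Sph (m + 1), (∫⁻ r in Ioi (0 : ℝ),
      ENNReal.ofReal (r ^ m) * F (r • (x : E (m + 1))))
        ∂(volume : Measure (E (m + 1))).toSphere := by
  have hmp := (volume : Measure (E (m + 1))).measurePreserving_homeomorphUnitSphereProd
  have h1 : ∫⁻ y, F y = ∫⁻ y : ({0}ᶜ : Set (E (m + 1))), F y ∂(volume.comap Subtype.val) := by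
    rw [lintegral_subtype_comap (measurableSet_singleton _).compl, restrict_compl_singleton]
  have hmeas : Measurable fun z : Sph (m + 1) × Ioi (0 : ℝ) =>
      F ((z.2 : ℝ) • (z.1 : E (m + 1))) := by
    apply hF.comp
    fun_prop
  rw [h1]
  have h2 := hmp.lintegral_comp hmeas
  have h3 : ∀ y : ({0}ᶜ : Set (E (m + 1))),
      ((homeomorphUnitSphereProd (E (m + 1)) y).2 : ℝ)
        • ((homeomorphUnitSphereProd (E (m + 1)) y).1 : E (m + 1)) = y := by
    intro y
    have hy : ‖(y : E (m + 1))‖ ≠ 0 := norm_ne_zero_iff.2 y.2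
    simp [smul_smul, hy]
  simp only [h3] at h2
  rw [h2, lintegral_prod _ hmeas.aemeasurable]
  refine lintegral_congr fun x => ?_
  have hm1 : Measurable fun r : Ioi (0 : ℝ) => ENNReal.ofReal ((r : ℝ) ^ m) := by fun_prop
  have hm2 : Measurable fun r : Ioi (0 : ℝ) => F ((r : ℝ) • (x : E (m + 1))) :=
    hF.comp (by fun_prop)
  simp only [Measure.volumeIoiPow, finrank_euclideanSpace, Fintype.card_fin, Nat.add_sub_cancel]
  rw [lintegral_withDensity_eq_lintegral_mul _ hm1 hm2]
  exact lintegral_subtype_comap measurableSet_Ioi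
    (fun r : ℝ => ENNReal.ofReal (r ^ m) * F (r • (x : E (m + 1))))

theorem lintegral_pow_Ioo (m : ℕ) :
    ∫⁻ r in Ioo (0 : ℝ) 1, ENNReal.ofReal (r ^ m) = ENNReal.ofReal (1 / (m + 1)) := by
  rw [← ofReal_integral_eq_lintegral_ofReal]
  · rw [← integral_Ioc_eq_integral_Ioo, ← intervalIntegral.integral_of_le zero_le_one,
      integral_pow]
    simp
  · exact ((continuous_pow m).integrableOn_Icc (a := 0) (b := 1)).mono_set Ioo_subset_Icc_self
  · filter_upwards [ae_restrict_mem measurableSet_Ioo] with r hr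
    exact pow_nonneg hr.1.le _

/-- Integral over the unit ball of a function that is homogeneous of degree `0`. -/
theorem lintegral_ball_homogeneous {m : ℕ} {F : E (m + 1) → ℝ≥0∞} (hF : Measurable F) :
    ∫⁻ y in Metric.ball 0 1, F (‖y‖⁻¹ • y) = ENNReal.ofReal (1 / (m + 1)) *
      ∫⁻ x : Sph (m + 1), F x ∂(volume : Measure (E (m + 1))).toSphere := by
  have hG : Measurable fun y : E (m + 1) => F (‖y‖⁻¹ • y) := hF.comp (by fun_prop)
  have hF' : Measurable fun x : Sph (m + 1) => F x := hF.comp measurable_subtype_coe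
  rw [← lintegral_indicator measurableSet_ball,
    lintegral_eq_lintegral_toSphere (hG.indicator measurableSet_ball),
    ← lintegral_const_mul _ hF']
  refine lintegral_congr fun x => ?_
  have hx : ‖(x : E (m + 1))‖ = 1 := by simp
  rw [← lintegral_pow_Ioo, ← lintegral_mul_const _ (by fun_prop),
    ← lintegral_indicator measurableSet_Ioi, ← lintegral_indicator measurableSet_Ioo]
  refine lintegral_congr fun r => ?_
  by_cases hr : 0 < r
  · by_cases hr1 : r < 1
    · simp [hr, hr1, indicator, norm_smul, hx, abs_of_pos hr, smul_smul, hr.ne']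
    · simp [hr, hr1, indicator, norm_smul, hx, abs_of_pos hr]
  · simp [hr]

/-- Sphere integrals are ball integrals of degree-zero extensions, and an isometry preserves
Lebesgue measure, the ball and `y ↦ ‖y‖`. -/
theorem lintegral_toSphere_isometry {m : ℕ} {F : E (m + 1) → ℝ≥0∞} (hF : Measurable F)
    (R : E (m + 1) ≃ₗᵢ[ℝ] E (m + 1)) :
    ∫⁻ x : Sph (m + 1), F (R x) ∂(volume : Measure (E (m + 1))).toSphere
      = ∫⁻ x : Sph (m + 1), F x ∂(volume : Measure (E (m + 1))).toSphere := by
  have hc : ENNReal.ofReal (1 / ((m : ℝ) + 1)) ≠ 0 := by simp; positivity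
  refine (ENNReal.mul_right_inj hc ENNReal.ofReal_ne_top).1 ?_
  rw [← lintegral_ball_homogeneous hF,
    ← lintegral_ball_homogeneous (F := fun y => F (R y)) (hF.comp (by fun_prop))]
  rw [← lintegral_indicator measurableSet_ball, ← lintegral_indicator measurableSet_ball]
  have hmp := R.measurePreserving
  have hG : Measurable fun y : E (m + 1) => F (‖y‖⁻¹ • y) := hF.comp (by fun_prop)
  rw [← hmp.lintegral_comp (hG.indicator measurableSet_ball)]
  refine lintegral_congr fun y => ?_
  simp [indicator]

/-- The vector `(a, b)` of `ℝ × ℝ^m`. -/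
noncomputable def consE {m : ℕ} (a : ℝ) (b : E m) : E (m + 1) :=
  WithLp.toLp 2 (Fin.cons a b.ofLp : Fin (m + 1) → ℝ)

@[simp] theorem consE_zero {m : ℕ} (a : ℝ) (b : E m) : consE a b 0 = a := rfl

@[simp] theorem consE_succ {m : ℕ} (a : ℝ) (b : E m) (i : Fin m) : consE a b i.succ = b i := rfl

theorem norm_consE_sq {m : ℕ} (a : ℝ) (b : E m) : ‖consE a b‖ ^ 2 = a ^ 2 + ‖b‖ ^ 2 := by
  simp [EuclideanSpace.norm_sq_eq, Fin.sum_univ_succ]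

theorem smul_consE {m : ℕ} (c a : ℝ) (b : E m) : c • consE a b = consE (c * a) (c • b) := by
  ext i
  refine Fin.cases ?_ (fun j => ?_) i <;> simp

theorem measurable_consE {m : ℕ} : Measurable fun z : ℝ × E m => consE z.1 z.2 := by
  refine (WithLp.measurable_toLp 2 _).comp (measurable_pi_lambda _ fun i => ?_)
  refine Fin.cases ?_ (fun j => ?_) i
  · exact measurable_fst
  · simp only [Fin.cons_succ]
    fun_prop

theorem lintegral_consE {m : ℕ} {F : E (m + 1) → ℝ≥0∞} (hF : Measurable F) :
    ∫⁻ y, F y = ∫⁻ a : ℝ, ∫⁻ b : E m, F (consE a b) := by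
  rw [← (PiLp.volume_preserving_toLp (Fin (m + 1))).lintegral_comp hF]
  have hF' : Measurable fun y : Fin (m + 1) → ℝ => F (WithLp.toLp 2 y) :=
    hF.comp (WithLp.measurable_toLp 2 _)
  have hmp := (volume_preserving_piFinSuccAbove (fun _ : Fin (m + 1) => ℝ) 0).symm
  rw [← hmp.lintegral_comp hF', Measure.volume_eq_prod, lintegral_prod]
  · refine lintegral_congr fun a => ?_
    rw [← (PiLp.volume_preserving_ofLp (Fin m)).lintegral_comp]
    · refine lintegral_congr fun b => ?_
      simp [consE, MeasurableEquiv.piFinSuccAbove, Fin.insertNthEquiv]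
    · exact hF'.comp ((MeasurableEquiv.measurable _).comp (by fun_prop))
  · exact (hF'.comp (MeasurableEquiv.measurable _)).aemeasurable


theorem measurable_consE_comp {α : Type*} [MeasurableSpace α] {m : ℕ} {g : α → ℝ} {h : α → E m}
    (hg : Measurable g) (hh : Measurable h) : Measurable fun z => consE (g z) (h z) :=
  measurable_consE.comp (hg.prodMk hh)

/-- Polar coordinates in the plane, applied to `H` times the indicator of the upper half-plane:
angles in `(-π, 0]` have nonpositive sine and drop out. -/
theorem lintegral_half_plane {H : ℝ × ℝ → ℝ≥0∞} (hH : Measurable H) :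
    ∫⁻ a : ℝ, ∫⁻ ϱ in Ioi (0 : ℝ), H (a, ϱ) =
      ∫⁻ φ in Ioo 0 π, ∫⁻ r in Ioi (0 : ℝ),
        ENNReal.ofReal r * H (r * cos φ, r * sin φ) := by
  have hS : MeasurableSet (univ ×ˢ Ioi (0 : ℝ) : Set (ℝ × ℝ)) :=
    MeasurableSet.univ.prod measurableSet_Ioi
  have h1 : ∫⁻ a : ℝ, ∫⁻ ϱ in Ioi (0 : ℝ), H (a, ϱ)
      = ∫⁻ z : ℝ × ℝ, (univ ×ˢ Ioi (0 : ℝ) : Set (ℝ × ℝ)).indicator H z := by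
    rw [Measure.volume_eq_prod, lintegral_prod _ (hH.indicator hS).aemeasurable]
    refine lintegral_congr fun a => ?_
    rw [← lintegral_indicator measurableSet_Ioi]
    refine lintegral_congr fun ϱ => ?_
    simp [indicator]
  rw [h1, ← lintegral_comp_polarCoord_symm, polarCoord_target, Measure.volume_eq_prod,
    ← Measure.prod_restrict, lintegral_prod_symm]
  · have h2 : Ioo (-π) π ∩ Ioo 0 π = Ioo 0 π :=
      inter_eq_right.2 (Ioo_subset_Ioo_left (by linarith [pi_pos]))
    rw [← h2, inter_comm, ← Measure.restrict_restrict measurableSet_Ioo,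
      ← lintegral_indicator (μ := volume.restrict (Ioo (-π) π)) measurableSet_Ioo]
    refine setLIntegral_congr_fun measurableSet_Ioo fun φ hφ => ?_
    by_cases h0 : φ ∈ Ioo 0 π
    · rw [indicator_of_mem h0]
      refine setLIntegral_congr_fun measurableSet_Ioi fun r hr => ?_
      have hs : 0 < r * sin φ := mul_pos hr (sin_pos_of_mem_Ioo h0)
      simp [indicator, hs]
    · rw [indicator_of_notMem h0]
      have h3 : φ ≤ 0 := by
        by_contra hc
        exact h0 ⟨not_le.1 hc, hφ.2⟩
      have h4 : sin φ ≤ 0 := sin_nonpos_of_nonpos_of_neg_pi_le h3 hφ.1.le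
      rw [setLIntegral_congr_fun (g := fun _ => 0) measurableSet_Ioi, lintegral_zero]
      intro r hr
      have hs : ¬ 0 < r * sin φ := not_lt.2 (mul_nonpos_of_nonneg_of_nonpos (le_of_lt hr) h4)
      simp [indicator, hs]
  · refine Measurable.aemeasurable ?_
    exact (by fun_prop : Measurable fun z : ℝ × ℝ => ENNReal.ofReal z.1).smul
      ((hH.indicator hS).comp continuous_polarCoord_symm.measurable)

/-- In polar coordinates the weight is `r (r sin φ)^m = r^{m+1} sin^m φ`, while the homogeneous
function does not depend on `r`. The integral over `0 < r < 1` gives the constant `1/(m+2)`. -/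
theorem lintegral_half_plane_homogeneous {m : ℕ} {F : E (m + 2) → ℝ≥0∞} (hF : Measurable F)
    (v : Sph (m + 1)) :
    ∫⁻ a : ℝ, ∫⁻ ϱ in Ioi (0 : ℝ), ENNReal.ofReal (ϱ ^ m) *
        (Metric.ball (0 : E (m + 2)) 1).indicator (fun y => F (‖y‖⁻¹ • y))
          (consE a (ϱ • (v : E (m + 1)))) =
      ∫⁻ φ in Ioo 0 π, ENNReal.ofReal (1 / (((m + 1 : ℕ) : ℝ) + 1)) *
        (ENNReal.ofReal (sin φ ^ m) * F (consE (cos φ) (sin φ • (v : E (m + 1))))) := by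
  have hG : Measurable fun y : E (m + 2) => F (‖y‖⁻¹ • y) := hF.comp (by fun_prop)
  set G : E (m + 2) → ℝ≥0∞ := (Metric.ball 0 1).indicator fun y => F (‖y‖⁻¹ • y) with hGdef
  have hGm : Measurable G := hG.indicator measurableSet_ball
  have hm : Measurable fun z : ℝ × ℝ =>
      ENNReal.ofReal (z.2 ^ m) * G (consE z.1 (z.2 • (v : E (m + 1)))) :=
    (by fun_prop : Measurable _).mul
      (hGm.comp (measurable_consE_comp measurable_fst (by fun_prop)))
  rw [lintegral_half_plane hm]
  refine setLIntegral_congr_fun measurableSet_Ioo fun φ hφ => ?_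
  have hs := sin_pos_of_mem_Ioo hφ
  have hv : ‖(v : E (m + 1))‖ = 1 := by simp
  have hn : ‖consE (cos φ) (sin φ • (v : E (m + 1)))‖ = 1 := by
    rw [← sq_eq_sq₀ (norm_nonneg _) zero_le_one, norm_consE_sq, norm_smul, hv]
    simp
  simp only
  rw [← lintegral_pow_Ioo, ← lintegral_mul_const _ (by fun_prop),
    ← lintegral_indicator measurableSet_Ioi, ← lintegral_indicator measurableSet_Ioo]
  refine lintegral_congr fun r => ?_
  by_cases hr : 0 < r
  · have hcons : consE (r * cos φ) ((r * sin φ) • (v : E (m + 1)))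
        = r • consE (cos φ) (sin φ • (v : E (m + 1))) := by
      rw [smul_consE, smul_smul]
    have hn2 : ‖r • consE (cos φ) (sin φ • (v : E (m + 1)))‖ = r := by
      rw [norm_smul, hn, mul_one, Real.norm_of_nonneg hr.le]
    by_cases hr1 : r < 1
    · have h3 : G (r • consE (cos φ) (sin φ • (v : E (m + 1))))
          = F (consE (cos φ) (sin φ • (v : E (m + 1)))) := by
        rw [hGdef, indicator_of_mem (by simpa [hn2] using hr1), hn2, smul_smul,
          inv_mul_cancel₀ hr.ne', one_smul]
      rw [indicator_of_mem (mem_Ioi.2 hr), indicator_of_mem (mem_Ioo.2 ⟨hr, hr1⟩), hcons, h3,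
        ← mul_assoc, ← mul_assoc, ← ENNReal.ofReal_mul hr.le,
        ← ENNReal.ofReal_mul (pow_nonneg hr.le _)]
      congr 2
      ring
    · have h3 : G (r • consE (cos φ) (sin φ • (v : E (m + 1)))) = 0 := by
        rw [hGdef, indicator_of_notMem (by simpa [hn2] using hr1)]
      rw [indicator_of_mem (mem_Ioi.2 hr), hcons, h3,
        indicator_of_notMem (fun h => hr1 h.2)]
      simp
  · rw [indicator_of_notMem (by simpa using hr), indicator_of_notMem (fun h => hr h.1)]

/-- Slices of the sphere orthogonal to the first coordinate axis. -/
theorem lintegral_toSphere_slice {m : ℕ} {F : E (m + 2) → ℝ≥0∞} (hF : Measurable F) :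
    ∫⁻ x : Sph (m + 2), F x ∂(volume : Measure (E (m + 2))).toSphere =
      ∫⁻ φ in Ioo 0 π, ENNReal.ofReal (sin φ ^ m) *
        ∫⁻ v : Sph (m + 1), F (consE (cos φ) (sin φ • (v : E (m + 1))))
          ∂(volume : Measure (E (m + 1))).toSphere := by
  have hc : ENNReal.ofReal (1 / (((m + 1 : ℕ) : ℝ) + 1)) ≠ 0 := by
    simp only [one_div, ne_eq, ENNReal.ofReal_eq_zero, not_le]; positivity
  -- With the factor `1/(m+2)` the left side is a ball integral. There `y = (a, b)`, with `b = ϱv`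
  -- in polar coordinates, and then `(a, ϱ)` is written in polar coordinates of the half-plane.
  refine (ENNReal.mul_right_inj hc ENNReal.ofReal_ne_top).1 ?_
  have hG : Measurable fun y : E (m + 2) => F (‖y‖⁻¹ • y) := hF.comp (by fun_prop)
  set G : E (m + 2) → ℝ≥0∞ := (Metric.ball 0 1).indicator fun y => F (‖y‖⁻¹ • y) with hGdef
  have hGm : Measurable G := hG.indicator measurableSet_ball
  rw [← lintegral_ball_homogeneous hF, ← lintegral_indicator measurableSet_ball, ← hGdef,
    lintegral_consE hGm]
  have h1 : ∀ a : ℝ, ∫⁻ b : E (m + 1), G (consE a b) = ∫⁻ v : Sph (m + 1),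
      (∫⁻ ϱ in Ioi (0 : ℝ), ENNReal.ofReal (ϱ ^ m) * G (consE a (ϱ • (v : E (m + 1)))))
        ∂(volume : Measure (E (m + 1))).toSphere := fun a =>
    lintegral_eq_lintegral_toSphere (F := fun b => G (consE a b))
      (hGm.comp (measurable_consE_comp measurable_const measurable_id))
  simp_rw [h1]
  rw [lintegral_lintegral_swap]
  swap
  · refine Measurable.aemeasurable ?_
    refine Measurable.lintegral_prod_right' (f := fun q : (ℝ × Sph (m + 1)) × ℝ =>
      ENNReal.ofReal (q.2 ^ m) * G (consE q.1.1 (q.2 • (q.1.2 : E (m + 1))))) ?_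
    refine (by fun_prop : Measurable _).mul (hGm.comp (measurable_consE_comp ?_ ?_)) <;> fun_prop
  have h2 : ∀ v : Sph (m + 1), ∫⁻ a : ℝ, ∫⁻ ϱ in Ioi (0 : ℝ),
      ENNReal.ofReal (ϱ ^ m) * G (consE a (ϱ • (v : E (m + 1)))) =
      ∫⁻ φ in Ioo 0 π, ENNReal.ofReal (1 / (((m + 1 : ℕ) : ℝ) + 1)) *
        (ENNReal.ofReal (sin φ ^ m) * F (consE (cos φ) (sin φ • (v : E (m + 1))))) :=
    fun v => lintegral_half_plane_homogeneous hF v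
  clear_value G
  simp_rw [h2]
  have hm3 : Measurable fun z : Sph (m + 1) × ℝ =>
      F (consE (cos z.2) (sin z.2 • (z.1 : E (m + 1)))) := by
    refine hF.comp (measurable_consE_comp ?_ ?_) <;> fun_prop
  have hm5 : Measurable fun z : Sph (m + 1) × ℝ =>
      ENNReal.ofReal (1 / (((m + 1 : ℕ) : ℝ) + 1)) * (ENNReal.ofReal (sin z.2 ^ m) *
        F (consE (cos z.2) (sin z.2 • (z.1 : E (m + 1))))) :=
    measurable_const.mul ((by fun_prop : Measurable _).mul hm3)
  refine (lintegral_lintegral_swap hm5.aemeasurable).trans ?_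
  refine Eq.trans ?_ (lintegral_const_mul' _ _ ENNReal.ofReal_ne_top)
  refine lintegral_congr fun φ => ?_
  rw [lintegral_const_mul' _ _ ENNReal.ofReal_ne_top,
    lintegral_const_mul' _ _ ENNReal.ofReal_ne_top]


/-- Substitution `s = cos φ`: the Jacobian `sin φ` accounts for `sin^m φ = sin^{m-1} φ · sin φ`, and
`sin^{m-1} φ = (1-s²)^{(m-1)/2}`. -/
theorem lintegral_sin_cos (m : ℕ) (H : ℝ → ℝ → ℝ≥0∞) :
    ∫⁻ φ in Ioo 0 π, ENNReal.ofReal (sin φ ^ m) * H (cos φ) (sin φ) =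
      ∫⁻ s in Icc (-1 : ℝ) 1, ENNReal.ofReal ((1 - s ^ 2) ^ ((((m + 2 : ℕ) : ℝ) - 3) / 2))
        * H s (√(1 - s ^ 2)) := by
  have himg : cos '' Ioo 0 π = Ioo (-1) 1 := by
    ext s
    constructor
    · rintro ⟨φ, hφ, rfl⟩
      refine ⟨?_, ?_⟩
      · rw [← cos_pi]
        exact cos_lt_cos_of_nonneg_of_le_pi hφ.1.le le_rfl hφ.2
      · rw [← cos_zero]
        exact cos_lt_cos_of_nonneg_of_le_pi le_rfl hφ.2.le hφ.1
    · intro hs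
      refine ⟨arccos s, ⟨arccos_pos.2 hs.2, ?_⟩, cos_arccos hs.1.le hs.2.le⟩
      rw [← arccos_neg_one]
      exact arccos_lt_arccos le_rfl hs.1 hs.2.le
  have hinj : InjOn cos (Ioo 0 π) := injOn_cos.mono Ioo_subset_Icc_self
  rw [setLIntegral_congr (Ioo_ae_eq_Icc (a := (-1 : ℝ)) (b := 1)).symm, ← himg,
    lintegral_image_eq_lintegral_abs_deriv_mul measurableSet_Ioo
      (fun φ _ => (hasDerivAt_cos φ).hasDerivWithinAt) hinj]
  refine setLIntegral_congr_fun measurableSet_Ioo fun φ hφ => ?_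
  have hs := sin_pos_of_mem_Ioo hφ
  have h1 : 1 - cos φ ^ 2 = sin φ ^ 2 := by rw [sin_sq]
  rw [h1, sqrt_sq hs.le, ← mul_assoc, ← ENNReal.ofReal_mul (abs_nonneg _), abs_neg,
    abs_of_pos hs]
  congr 2
  rw [← Real.rpow_natCast (sin φ) 2, ← Real.rpow_mul hs.le]
  nth_rewrite 2 [← Real.rpow_one (sin φ)]
  rw [← Real.rpow_add hs, ← Real.rpow_natCast]
  congr 1
  push_cast
  ring

/-- The surface area of the unit sphere of `ℝ^{m+1}`. -/
theorem toSphere_univ (m : ℕ) :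
    (volume : Measure (E (m + 1))).toSphere univ = ENNReal.ofReal
      (2 * π ^ ((((m + 2 : ℕ) : ℝ) - 1) / 2) / Real.Gamma ((((m + 2 : ℕ) : ℝ) - 1) / 2)) := by
  rw [Measure.toSphere_apply_univ, EuclideanSpace.volume_ball]
  simp only [finrank_euclideanSpace, Fintype.card_fin, ENNReal.ofReal_one, one_pow, one_mul]
  rw [← ENNReal.ofReal_natCast, ← ENNReal.ofReal_mul (by positivity)]
  congr 1
  have h1 : (((m + 2 : ℕ) : ℝ) - 1) / 2 = ((m + 1 : ℕ) : ℝ) / 2 := by push_cast; ring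
  have h2 : ((m + 1 : ℕ) : ℝ) / 2 ≠ 0 := by positivity
  rw [h1, Real.Gamma_add_one h2, sqrt_eq_rpow, ← Real.rpow_natCast, ← Real.rpow_mul pi_pos.le]
  have h3 : Real.Gamma (((m + 1 : ℕ) : ℝ) / 2) ≠ 0 := (Real.Gamma_pos_of_pos (by positivity)).ne'
  have h4 : (1 / 2 : ℝ) * ((m + 1 : ℕ) : ℝ) = ((m + 1 : ℕ) : ℝ) / 2 := by ring
  rw [h4]
  field_simp

/-! ### Joint law of two orthogonal projections under the surface measure -/

theorem exists_basis_fst {m : ℕ} (θ : E (m + 2)) (hθ : ‖θ‖ = 1) :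
    ∃ b : OrthonormalBasis (Fin (m + 2)) ℝ (E (m + 2)), b 0 = θ := by
  have hv : Orthonormal ℝ (({0} : Set (Fin (m + 2))).domRestrict fun _ => θ) := by
    constructor
    · intro i
      simpa using hθ
    · intro i j hij
      exact absurd (Subsingleton.elim i j) hij
  obtain ⟨b, hb⟩ := hv.exists_orthonormalBasis_extension_of_card_eq (by simp)
  exact ⟨b, hb 0 rfl⟩

theorem exists_basis_fst_snd {m : ℕ} (θ e : E (m + 2)) (hθ : ‖θ‖ = 1) (he : ‖e‖ = 1)
    (hθe : ⟪θ, e⟫ = 0) :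
    ∃ b : OrthonormalBasis (Fin (m + 2)) ℝ (E (m + 2)), b 0 = θ ∧ b 1 = e := by
  have h10 : (1 : Fin (m + 2)) ≠ 0 := by simp
  have hv : Orthonormal ℝ (({0, 1} : Set (Fin (m + 2))).domRestrict
      fun i => if i = 0 then θ else e) := by
    constructor
    · rintro ⟨i, rfl | rfl⟩
      · simpa using hθ
      · simpa using he
    · rintro ⟨i, rfl | rfl⟩ ⟨j, rfl | rfl⟩ hij
      · exact absurd rfl hij
      · simpa using hθe
      · simpa [real_inner_comm] using hθe
      · exact absurd rfl hij
  obtain ⟨b, hb⟩ := hv.exists_orthonormalBasis_extension_of_card_eq (by simp)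
  refine ⟨b, ?_, ?_⟩
  · simpa using hb 0 (by simp)
  · simpa using hb 1 (by simp)

/-- The law of `x'θ` under the surface area measure. -/
theorem lintegral_toSphere_inner {m : ℕ} (θ : E (m + 2)) (hθ : ‖θ‖ = 1) {g : ℝ → ℝ≥0∞}
    (hg : Measurable g) :
    ∫⁻ x : Sph (m + 2), g ⟪(x : E (m + 2)), θ⟫ ∂(volume : Measure (E (m + 2))).toSphere =
      ENNReal.ofReal (2 * π ^ ((((m + 2 : ℕ) : ℝ) - 1) / 2)
        / Real.Gamma ((((m + 2 : ℕ) : ℝ) - 1) / 2)) *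
      ∫⁻ s in Icc (-1 : ℝ) 1,
        ENNReal.ofReal ((1 - s ^ 2) ^ ((((m + 2 : ℕ) : ℝ) - 3) / 2)) * g s := by
  obtain ⟨b, hb⟩ := exists_basis_fst θ hθ
  have hF : Measurable fun y : E (m + 2) => g (y 0) := hg.comp (by fun_prop)
  have h1 := lintegral_toSphere_isometry hF b.repr
  have h2 : ∀ x : E (m + 2), (b.repr x).ofLp 0 = ⟪x, θ⟫ := by
    intro x
    rw [b.repr_apply_apply, hb, real_inner_comm]
  simp only [h2] at h1
  rw [h1, lintegral_toSphere_slice hF, ← toSphere_univ]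
  simp only [consE_zero, lintegral_const]
  have h3 := lintegral_sin_cos m fun s _ =>
    g s * (volume : Measure (E (m + 1))).toSphere univ
  rw [h3]
  simp only [← mul_assoc]
  rw [lintegral_mul_const' _ _ (measure_ne_top _ _), mul_comm]

theorem lintegral_Icc_eq_add_neg {g : ℝ → ℝ≥0∞} (hg : Measurable g) :
    ∫⁻ r in Icc (-1 : ℝ) 1, g r = (∫⁻ r in Ioo (0 : ℝ) 1, g r)
      + ∫⁻ r in Ioo (0 : ℝ) 1, g (-r) := by
  have h1 : ∫⁻ r in Ioo (0 : ℝ) 1, g (-r) = ∫⁻ r in Ioo (-1 : ℝ) 0, g r := by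
    rw [← lintegral_indicator measurableSet_Ioo, ← lintegral_indicator measurableSet_Ioo,
      ← (Measure.measurePreserving_neg (volume : Measure ℝ)).lintegral_comp
        (hg.indicator measurableSet_Ioo)]
    refine lintegral_congr fun r => ?_
    simp only [indicator, mem_Ioo]
    congr 1
    rw [eq_iff_iff]
    constructor <;> rintro ⟨h, h'⟩ <;> constructor <;> linarith
  rw [h1, ← setLIntegral_congr (Ico_ae_eq_Icc (a := (-1 : ℝ)) (b := 1)),
    ← Ico_union_Ico_eq_Ico (a := (-1 : ℝ)) (b := 0) (c := 1) (by norm_num) (by norm_num),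
    lintegral_union measurableSet_Ico (by
      rw [Set.disjoint_left]; intro r h h'; exact absurd h.2 (not_lt.2 h'.1)), add_comm,
    setLIntegral_congr (Ioo_ae_eq_Ico (a := (0 : ℝ)) (b := 1)).symm,
    setLIntegral_congr (Ioo_ae_eq_Ico (a := (-1 : ℝ)) (b := 0)).symm]

/-- Substitution `w = r²`: the factor `w^{-1/2}` of the Beta density cancels against `dw = 2r dr`.
-/
theorem lintegral_betaMeasure_half {β : ℝ} (hβ : 0 < β) {g : ℝ → ℝ≥0∞}
    (hg : Measurable g) :
    ∫⁻ w, g (√w) ∂(betaMeasure (1 / 2) β) = ENNReal.ofReal (2 / beta (1 / 2) β) *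
      ∫⁻ r in Ioo (0 : ℝ) 1, ENNReal.ofReal ((1 - r ^ 2) ^ (β - 1)) * g r := by
  have himg : (fun r : ℝ => r ^ 2) '' Ioo 0 1 = Ioo 0 1 := by
    ext w
    constructor
    · rintro ⟨r, hr, rfl⟩
      exact ⟨pow_pos hr.1 2, pow_lt_one₀ hr.1.le hr.2 two_ne_zero⟩
    · rintro ⟨h0, h1⟩
      exact ⟨√w, ⟨sqrt_pos.2 h0, by rw [sqrt_lt' one_pos]; simpa using h1⟩, sq_sqrt h0.le⟩
  have hinj : InjOn (fun r : ℝ => r ^ 2) (Ioo 0 1) := by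
    intro a ha b hb h
    exact (sq_eq_sq₀ ha.1.le hb.1.le).1 h
  have hgm : Measurable fun w : ℝ => g (√w) := hg.comp (by fun_prop)
  have h1 : ∫⁻ w, g (√w) ∂(betaMeasure (1 / 2) β)
      = ∫⁻ w in Ioo (0 : ℝ) 1, betaPDF (1 / 2) β w * g (√w) := by
    have hpdf : Measurable (betaPDF (1 / 2) β) := (measurable_betaPDFReal _ _).ennreal_ofReal
    rw [betaMeasure, lintegral_withDensity_eq_lintegral_mul _ hpdf hgm, ← lintegral_indicator measurableSet_Ioo]
    refine lintegral_congr fun w => ?_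
    by_cases hw : w ∈ Ioo (0 : ℝ) 1
    · rw [indicator_of_mem hw]; rfl
    · rw [indicator_of_notMem hw]
      simp [betaPDF, betaPDFReal, show ¬ (0 < w ∧ w < 1) from hw]
  have h2 := lintegral_image_eq_lintegral_abs_deriv_mul measurableSet_Ioo
    (fun r _ => (hasDerivAt_pow 2 r).hasDerivWithinAt) hinj
    (fun w => betaPDF (1 / 2) β w * g (√w))
  rw [himg] at h2
  rw [h1, h2, ← lintegral_const_mul' _ _ ENNReal.ofReal_ne_top]
  refine setLIntegral_congr_fun measurableSet_Ioo fun r hr => ?_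
  have hr2 : r ^ 2 < 1 := pow_lt_one₀ hr.1.le hr.2 two_ne_zero
  rw [betaPDF_of_pos_lt_one (pow_pos hr.1 2) hr2, sqrt_sq hr.1.le, ← mul_assoc, ← mul_assoc,
    ← ENNReal.ofReal_mul (abs_nonneg _)]
  have hb : 0 < beta (1 / 2) β := beta_pos (by norm_num) hβ
  rw [← ENNReal.ofReal_mul (by positivity)]
  congr 2
  rw [← Real.rpow_natCast r 2, ← Real.rpow_mul hr.1.le,
    abs_of_nonneg (by have := hr.1; positivity)]
  have h3 : r ^ (((2 : ℕ) : ℝ) * (1 / 2 - 1)) = r⁻¹ := by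
    rw [← Real.rpow_neg_one]; norm_num
  rw [h3]
  have := hr.1.ne'
  field_simp
  norm_num


/-- A coordinate of a uniform point of the sphere has a symmetric law whose square is distributed as
`G`; this is where the Beta law of the hypotheses comes from. On the two-point sphere the coordinate
is `±1`, hence the Dirac mass. An upper bound with a constant independent of `g` is all that is
needed, so in that case each point may be charged to both signs. -/
theorem lintegral_fst_coord_le (m : ℕ) : ∃ C : ℝ≥0∞, C ≠ ∞ ∧ ∀ g : ℝ → ℝ≥0∞, Measurable g →
    ∫⁻ v : Sph (m + 1), g ((v : E (m + 1)) 0) ∂(volume : Measure (E (m + 1))).toSphere ≤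
      C * ((∫⁻ w, g (√w) ∂(lawG (m + 2))) + ∫⁻ w, g (-√w) ∂(lawG (m + 2))) := by
  rcases m with _ | k
  · refine ⟨(volume : Measure (E 1)).toSphere univ, measure_ne_top _ _, fun g hg => ?_⟩
    have hm : Measurable fun w : ℝ => g (√w) := hg.comp (by fun_prop)
    have hm' : Measurable fun w : ℝ => g (-√w) := hg.comp (by fun_prop)
    simp only [lawG, zero_add, if_true]
    rw [lintegral_dirac' _ hm, lintegral_dirac' _ hm', sqrt_one, mul_comm, ← lintegral_const]
    refine lintegral_mono fun v => ?_
    have hv : ‖(v : E 1)‖ ^ 2 = ((v : E 1) 0) ^ 2 := by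
      rw [EuclideanSpace.norm_sq_eq]; simp
    have h1 : ((v : E 1) 0) ^ 2 = 1 := by
      rw [← hv, norm_eq_of_mem_sphere, one_pow]
    rcases eq_or_eq_neg_of_sq_eq_sq _ _ (h1.trans (one_pow 2).symm) with h | h
    · simp only [h]; exact le_self_add
    · simp only [h]; exact le_add_self
  · have hβ : (0 : ℝ) < (((k + 3 : ℕ) : ℝ) - 2) / 2 := by push_cast; linarith [k.cast_nonneg (α := ℝ)]
    set β : ℝ := (((k + 3 : ℕ) : ℝ) - 2) / 2 with hβdef
    set c : ℝ≥0∞ := ENNReal.ofReal (2 / beta (1 / 2) β) with hc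
    have hc0 : c ≠ 0 := by
      have := beta_pos (α := 1 / 2) (by norm_num) hβ
      simp only [hc, ne_eq, ENNReal.ofReal_eq_zero, not_le]; positivity
    have hct : c ≠ ∞ := ENNReal.ofReal_ne_top
    set ω : ℝ≥0∞ := ENNReal.ofReal (2 * π ^ ((((k + 2 : ℕ) : ℝ) - 1) / 2)
        / Real.Gamma ((((k + 2 : ℕ) : ℝ) - 1) / 2)) with hω
    refine ⟨ω * c⁻¹, ENNReal.mul_ne_top ENNReal.ofReal_ne_top (ENNReal.inv_ne_top.2 hc0),
      fun g hg => le_of_eq ?_⟩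
    have h1 := lintegral_toSphere_inner (EuclideanSpace.single (0 : Fin (k + 2)) (1 : ℝ))
      (by simp) hg
    have h2 : ∀ v : E (k + 2), ⟪v, EuclideanSpace.single (0 : Fin (k + 2)) (1 : ℝ)⟫ = v 0 := by
      intro v
      simp [EuclideanSpace.inner_single_right]
    simp only [h2] at h1
    have hm : Measurable fun s : ℝ =>
        ENNReal.ofReal ((1 - s ^ 2) ^ ((((k + 2 : ℕ) : ℝ) - 3) / 2)) * g s :=
      Measurable.mul (by fun_prop) hg
    rw [h1, lintegral_Icc_eq_add_neg hm]
    have hL : lawG (k + 1 + 2) = betaMeasure (1 / 2) β := by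
      rw [lawG, if_neg (by omega)]
    have h3 := lintegral_betaMeasure_half hβ hg
    have h4 := lintegral_betaMeasure_half hβ (g := fun r => g (-r)) (hg.comp measurable_neg)
    have h5 : (((k + 2 : ℕ) : ℝ) - 3) / 2 = β - 1 := by
      rw [hβdef]; push_cast; ring
    rw [hL, h3, h4, h5, ← mul_add, mul_assoc ω, ← mul_assoc c⁻¹, ENNReal.inv_mul_cancel hc0 hct,
      one_mul]
    simp only [neg_sq]
    rfl

/-- Comparison of the law of `(x'θ, x'e)` under the surface area measure with the law of
`(s, ±(1-s²)^{1/2} w^{1/2})`. -/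
theorem lintegral_toSphere_inner_inner_le (m : ℕ) : ∃ C : ℝ≥0∞, C ≠ ∞ ∧
    ∀ θ e : E (m + 2), ‖θ‖ = 1 → ‖e‖ = 1 → ⟪θ, e⟫ = 0 →
    ∀ G : ℝ × ℝ → ℝ≥0∞, Measurable G →
    ∫⁻ x : Sph (m + 2), G (⟪(x : E (m + 2)), θ⟫, ⟪(x : E (m + 2)), e⟫)
        ∂(volume : Measure (E (m + 2))).toSphere ≤
      C * ∫⁻ s in Icc (-1 : ℝ) 1, ENNReal.ofReal ((1 - s ^ 2) ^ ((((m + 2 : ℕ) : ℝ) - 3) / 2)) *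
        ((∫⁻ w, G (s, √(1 - s ^ 2) * √w) ∂(lawG (m + 2)))
          + ∫⁻ w, G (s, -(√(1 - s ^ 2) * √w)) ∂(lawG (m + 2))) := by
  obtain ⟨C, hC, h⟩ := lintegral_fst_coord_le m
  refine ⟨C, hC, fun θ e hθ he hθe G hG => ?_⟩
  obtain ⟨b, hb0, hb1⟩ := exists_basis_fst_snd θ e hθ he hθe
  have hF : Measurable fun y : E (m + 2) => G (y 0, y 1) := hG.comp (by fun_prop)
  have h1 := lintegral_toSphere_isometry hF b.repr
  have h2 : ∀ x : E (m + 2), (b.repr x).ofLp 0 = ⟪x, θ⟫ := by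
    intro x
    rw [b.repr_apply_apply, hb0, real_inner_comm]
  have h3 : ∀ x : E (m + 2), (b.repr x).ofLp 1 = ⟪x, e⟫ := by
    intro x
    rw [b.repr_apply_apply, hb1, real_inner_comm]
  simp only [h2, h3] at h1
  rw [h1, lintegral_toSphere_slice hF]
  have h4 : ∀ (a : ℝ) (v : E (m + 1)), (consE a v) 1 = v 0 := fun a v => by
    rw [← Fin.succ_zero_eq_one, consE_succ]
  simp only [consE_zero, h4, PiLp.smul_apply, smul_eq_mul]
  rw [lintegral_sin_cos m fun s r => ∫⁻ v : Sph (m + 1), G (s, r * (v : E (m + 1)) 0)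
          ∂(volume : Measure (E (m + 1))).toSphere, ← lintegral_const_mul' _ _ hC]
  refine lintegral_mono fun s => ?_
  -- On the slice at height `s`, `x'e` is `√(1-s²)` times the first coordinate of a point of the
  -- lower-dimensional sphere.
  have h5 := h (fun r => G (s, √(1 - s ^ 2) * r)) (hG.comp (by fun_prop))
  simp only [mul_neg] at h5
  simp only
  rw [mul_left_comm]
  gcongr


/-! ### Laplace asymptotics on `[-1, 1]` -/

theorem integrableOn_one_sub_rpow_mul_one_add_rpow {ξ ζ : ℝ} (hξ : -1 < ξ) (hζ : -1 < ζ) :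
    IntegrableOn (fun s : ℝ => (1 - s) ^ ξ * (1 + s) ^ ζ) (Icc (-1) 1) := by
  have h1 : IntervalIntegrable (fun s : ℝ => (1 - s) ^ ξ * (1 + s) ^ ζ) volume (-1) 0 := by
    have h := (intervalIntegral.intervalIntegrable_rpow' (a := 0) (b := 1) hζ).comp_add_left 1
    norm_num at h
    refine h.continuousOn_mul ?_
    rw [uIcc_of_le (by norm_num)]
    refine ContinuousOn.rpow_const (by fun_prop) fun s hs => Or.inl ?_
    have := hs.2
    linarith
  have h2 : IntervalIntegrable (fun s : ℝ => (1 - s) ^ ξ * (1 + s) ^ ζ) volume 0 1 := by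
    have h := (intervalIntegral.intervalIntegrable_rpow' (a := 1) (b := 0) hξ).comp_sub_left 1
    norm_num at h
    refine h.mul_continuousOn ?_
    rw [uIcc_of_le (by norm_num)]
    refine ContinuousOn.rpow_const (by fun_prop) fun s hs => Or.inl ?_
    have := hs.1
    linarith
  have h3 := (intervalIntegrable_iff_integrableOn_Ioc_of_le (by norm_num)).1 (h1.trans h2)
  rwa [integrableOn_Icc_iff_integrableOn_Ioc]

/-- Substituting `s = 1 - r/l` turns the rescaled integral into one of `r^ξ (2 - r/l)^ζ e^{-r}` over
`(0, l]`, which tends to `2^ζ` times a Gamma integral by dominated convergence. -/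
theorem tendsto_rpow_mul_integral_exp_neg {ξ ζ : ℝ} (hξ : -1 < ξ) :
    Tendsto (fun l : ℝ => l ^ (ξ + 1) *
        ∫ s in (0 : ℝ)..1, (1 - s) ^ ξ * (1 + s) ^ ζ * exp ((s - 1) * l))
      atTop (𝓝 (2 ^ ζ * Real.Gamma (ξ + 1))) := by
  have hlim : Tendsto (fun l : ℝ => ∫ r in Ioi (0 : ℝ),
      (Ioc 0 l).indicator (fun r => r ^ ξ * (2 - r / l) ^ ζ * exp (-r)) r) atTop
      (𝓝 (∫ r in Ioi (0 : ℝ), 2 ^ ζ * (exp (-r) * r ^ (ξ + 1 - 1)))) := by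
    refine tendsto_integral_filter_of_dominated_convergence
      (fun r => 2 ^ |ζ| * (exp (-r) * r ^ (ξ + 1 - 1))) ?_ ?_ ?_ ?_
    · refine Eventually.of_forall fun l => Measurable.aestronglyMeasurable ?_
      exact Measurable.indicator (by fun_prop) measurableSet_Ioc
    · filter_upwards [eventually_gt_atTop 0] with l hl
      filter_upwards [ae_restrict_mem measurableSet_Ioi] with r hr
      have hr0 : 0 < r := hr
      by_cases hrl : r ≤ l
      · rw [indicator_of_mem (show r ∈ Ioc 0 l from ⟨hr, hrl⟩)]
        have h1 : r / l ≤ 1 := (div_le_one hl).2 hrl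
        have h2 : 0 < r / l := div_pos hr hl
        -- The base lies in `[1, 2]`, so this bound holds for either sign of `ζ`.
        have h3 : (2 - r / l) ^ ζ ≤ 2 ^ |ζ| :=
          (Real.rpow_le_rpow_of_exponent_le (by linarith) (le_abs_self ζ)).trans
            (Real.rpow_le_rpow (by linarith) (by linarith) (abs_nonneg _))
        have h4 : 0 ≤ (2 - r / l) ^ ζ := Real.rpow_nonneg (by linarith) _
        rw [Real.norm_of_nonneg (by positivity), add_sub_cancel_right]
        calc r ^ ξ * (2 - r / l) ^ ζ * exp (-r) ≤ r ^ ξ * 2 ^ |ζ| * exp (-r) := by gcongr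
          _ = _ := by ring
      · rw [indicator_of_notMem (fun h => hrl h.2), norm_zero]
        positivity
    · exact (Real.GammaIntegral_convergent (by linarith : 0 < ξ + 1)).const_mul _
    · filter_upwards [ae_restrict_mem measurableSet_Ioi] with r hr
      have hr0 : 0 < r := hr
      have h1 : Tendsto (fun l : ℝ => r ^ ξ * (2 - r / l) ^ ζ * exp (-r)) atTop
          (𝓝 (r ^ ξ * 2 ^ ζ * exp (-r))) := by
        refine Tendsto.mul_const _ (Tendsto.const_mul _ ?_)
        have h2 : Tendsto (fun l : ℝ => 2 - r / l) atTop (𝓝 (2 - 0)) :=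
          tendsto_const_nhds.sub (tendsto_const_nhds.div_atTop tendsto_id)
        rw [sub_zero] at h2
        exact h2.rpow_const (Or.inl two_ne_zero)
      have h5 : 2 ^ ζ * (exp (-r) * r ^ (ξ + 1 - 1)) = r ^ ξ * 2 ^ ζ * exp (-r) := by
        rw [add_sub_cancel_right]; ring
      rw [h5]
      refine h1.congr' ?_
      filter_upwards [eventually_ge_atTop r] with l hl
      rw [indicator_of_mem (show r ∈ Ioc 0 l from ⟨hr, hl⟩)]
  rw [integral_const_mul, ← Real.Gamma_eq_integral (by linarith)] at hlim
  refine hlim.congr' ?_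
  filter_upwards [eventually_gt_atTop 0] with l hl
  have hsub := intervalIntegral.integral_comp_sub_div (a := 0) (b := l)
    (fun s : ℝ => (1 - s) ^ ξ * (1 + s) ^ ζ * exp ((s - 1) * l)) hl.ne' 1
  simp only [div_self hl.ne', sub_self, zero_div, sub_zero, smul_eq_mul] at hsub
  rw [setIntegral_indicator measurableSet_Ioc,
    inter_eq_right.2 (Ioc_subset_Ioi_self : Ioc 0 l ⊆ Ioi 0),
    ← intervalIntegral.integral_of_le hl.le, Real.rpow_add hl, Real.rpow_one, mul_assoc, ← hsub,
    ← intervalIntegral.integral_const_mul]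
  refine intervalIntegral.integral_congr_ae (Eventually.of_forall fun r hr => ?_)
  rw [uIoc_of_le hl.le] at hr
  have h1 : 1 - (1 - r / l) = r / l := by ring
  have h2 : 1 + (1 - r / l) = 2 - r / l := by ring
  have h3 : (1 - r / l - 1) * l = -r := by field_simp; ring
  rw [h1, h2, h3, Real.div_rpow hr.1.le hl.le]
  have := (Real.rpow_pos_of_pos hl ξ).ne'
  field_simp

/-- Laplace asymptotics at the right endpoint. -/
theorem tendsto_rpow_mul_setIntegral_exp_neg {ξ ζ : ℝ} (hξ : -1 < ξ) (hζ : -1 < ζ) :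
    Tendsto (fun l : ℝ => l ^ (ξ + 1) *
        ∫ s in Icc (-1 : ℝ) 1, (1 - s) ^ ξ * (1 + s) ^ ζ * exp ((s - 1) * l))
      atTop (𝓝 (2 ^ ζ * Real.Gamma (ξ + 1))) := by
  have hI := integrableOn_one_sub_rpow_mul_one_add_rpow hξ hζ
  have hJ : ∀ l : ℝ, IntegrableOn
      (fun s : ℝ => (1 - s) ^ ξ * (1 + s) ^ ζ * exp ((s - 1) * l)) (Icc (-1) 1) := fun l =>
    hI.mul_continuousOn (by fun_prop) isCompact_Icc
  have hsplit : ∀ l : ℝ,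
      ∫ s in Icc (-1 : ℝ) 1, (1 - s) ^ ξ * (1 + s) ^ ζ * exp ((s - 1) * l)
      = (∫ s in (-1 : ℝ)..0, (1 - s) ^ ξ * (1 + s) ^ ζ * exp ((s - 1) * l))
        + ∫ s in (0 : ℝ)..1, (1 - s) ^ ξ * (1 + s) ^ ζ * exp ((s - 1) * l) := by
    intro l
    rw [integral_Icc_eq_integral_Ioc, ← intervalIntegral.integral_of_le (by norm_num),
      intervalIntegral.integral_add_adjacent_intervals]
    · refine (intervalIntegrable_iff_integrableOn_Icc_of_le (by norm_num)).2 ?_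
      exact (hJ l).mono_set (Icc_subset_Icc_right zero_le_one)
    · refine (intervalIntegrable_iff_integrableOn_Icc_of_le (by norm_num)).2 ?_
      exact (hJ l).mono_set (Icc_subset_Icc_left (by norm_num))
  -- On `[-1, 0]` the exponent is at most `-l`, so this half is exponentially small.
  have h0 : Tendsto (fun l : ℝ => l ^ (ξ + 1) *
      ∫ s in (-1 : ℝ)..0, (1 - s) ^ ξ * (1 + s) ^ ζ * exp ((s - 1) * l)) atTop (𝓝 0) := by
    set A := ∫ s in Icc (-1 : ℝ) 0, (1 - s) ^ ξ * (1 + s) ^ ζ with hA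
    have h1 := (tendsto_rpow_mul_exp_neg_mul_atTop_nhds_zero (ξ + 1) 1 one_pos).mul_const A
    rw [zero_mul] at h1
    have hnn : ∀ s ∈ Icc (-1 : ℝ) 0, 0 ≤ (1 - s) ^ ξ * (1 + s) ^ ζ := fun s hs =>
      mul_nonneg (Real.rpow_nonneg (by linarith [hs.2]) _)
        (Real.rpow_nonneg (by linarith [hs.1]) _)
    refine tendsto_of_tendsto_of_tendsto_of_le_of_le' tendsto_const_nhds h1 ?_ ?_
    · filter_upwards [eventually_gt_atTop 0] with l hl
      refine mul_nonneg (by positivity) ?_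
      exact intervalIntegral.integral_nonneg (by norm_num) fun s hs =>
        mul_nonneg (hnn s hs) (exp_pos _).le
    · filter_upwards [eventually_gt_atTop 0] with l hl
      rw [mul_assoc, intervalIntegral.integral_of_le (by norm_num), ← integral_Icc_eq_integral_Ioc]
      refine mul_le_mul_of_nonneg_left ?_ (by positivity)
      rw [hA, ← integral_const_mul]
      refine setIntegral_mono_on ((hJ l).mono_set (Icc_subset_Icc_right zero_le_one))
        ((hI.mono_set (Icc_subset_Icc_right zero_le_one)).const_mul _) measurableSet_Icc ?_
      intro s hs
      rw [mul_comm]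
      refine mul_le_mul_of_nonneg_right (exp_le_exp.2 ?_) (hnn s hs)
      nlinarith [hs.2]
  have h := h0.add (tendsto_rpow_mul_integral_exp_neg (ζ := ζ) hξ)
  rw [zero_add] at h
  refine h.congr fun l => ?_
  rw [hsplit, mul_add]

/-! ### Integrals against `f(κs)` for `f` in the class `𝓕` -/

variable {f : ℝ → ℝ}

theorem InF.monotone (hf : InF f) : Monotone f := by
  intro a b hab
  rcases le_total b 0 with hb | hb
  · exact hf.monotoneOn_neg (hab.trans hb) hb hab
  · rcases le_total a 0 with ha | ha
    · exact (hf.monotoneOn_neg ha (mem_Iic.2 le_rfl) ha).trans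
        (hf.strictMonoOn_pos.monotoneOn (mem_Ici.2 le_rfl) hb hb)
    · exact hf.strictMonoOn_pos.monotoneOn ha hb hab

theorem InF.measurable (hf : InF f) : Measurable f := hf.monotone.measurable

theorem InF.pos (hf : InF f) {z : ℝ} (hz : 0 < z) : 0 < f z :=
  (hf.nonneg 0).trans_lt (hf.strictMonoOn_pos (mem_Ici.2 le_rfl) hz.le hz)

theorem InF.le_of_mem_Icc (hf : InF f) {k s : ℝ} (hk : 0 < k) (hs : s ∈ Icc (-1 : ℝ) 1) :
    f (k * s) ≤ f k :=
  hf.monotone (by nlinarith [hs.2])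

theorem InF.integrableOn (hf : InF f) {ξ ζ : ℝ} (hξ : -1 < ξ) (hζ : -1 < ζ) {k : ℝ}
    (hk : 0 < k) :
    IntegrableOn (fun s : ℝ => (1 - s) ^ ξ * (1 + s) ^ ζ * f (k * s)) (Icc (-1) 1) := by
  refine Integrable.mul_bdd (c := f k) (integrableOn_one_sub_rpow_mul_one_add_rpow hξ hζ) ?_ ?_
  · exact (hf.measurable.comp (by fun_prop)).aestronglyMeasurable
  · filter_upwards [ae_restrict_mem measurableSet_Icc] with s hs
    rw [Real.norm_of_nonneg (hf.nonneg _)]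
    exact hf.le_of_mem_Icc hk hs

/-- Moments of the projection on the modal direction: the leading term. -/
theorem InF.tendsto_integral (hf : InF f) {ξ ζ : ℝ} (hξ : -1 < ξ) (hζ : -1 < ζ) :
    Tendsto (fun k : ℝ => (k * phi f k) ^ (ξ + 1) *
        ((∫ s in Icc (-1 : ℝ) 1, (1 - s) ^ ξ * (1 + s) ^ ζ * f (k * s)) / f k))
      atTop (𝓝 (2 ^ ζ * Real.Gamma (ξ + 1))) := by
  have h1 := (tendsto_rpow_mul_setIntegral_exp_neg hξ hζ).comp hf.tendsto_mul_phi
  -- Condition (iv) bounds the difference from the pure Laplace integral by `o(l^{-(ξ+1)})` with `l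
  -- = kφ_f(k)`, exactly what the factor `l^{ξ+1}` can absorb.
  refine (tendsto_iff_of_dist ?_).1 h1
  rw [Metric.tendsto_nhds]
  intro ε hε
  filter_upwards [hf.exp_approx ξ ζ hξ hζ (ε / 2) (by positivity),
    hf.tendsto_mul_phi.eventually_gt_atTop 0, eventually_gt_atTop 0] with k hk hl hk0
  set l := k * phi f k with hldef
  have hfk := hf.pos hk0
  have hA : IntegrableOn (fun s : ℝ => (1 - s) ^ ξ * (1 + s) ^ ζ * (f (k * s) / f k))
      (Icc (-1) 1) := by
    have := (hf.integrableOn hξ hζ hk0).div_const (f k)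
    simp only [mul_div_assoc] at this
    exact this
  have hB : IntegrableOn (fun s : ℝ => (1 - s) ^ ξ * (1 + s) ^ ζ * exp ((s - 1) * l))
      (Icc (-1) 1) :=
    (integrableOn_one_sub_rpow_mul_one_add_rpow hξ hζ).mul_continuousOn (by fun_prop)
      isCompact_Icc
  have hnn : ∀ s ∈ Icc (-1 : ℝ) 1, 0 ≤ (1 - s) ^ ξ * (1 + s) ^ ζ := fun s hs =>
    mul_nonneg (Real.rpow_nonneg (by linarith [hs.2]) _)
      (Real.rpow_nonneg (by linarith [hs.1]) _)
  have hC : ∀ᵐ s ∂(volume.restrict (Icc (-1 : ℝ) 1)),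
      ‖(1 - s) ^ ξ * (1 + s) ^ ζ * exp ((s - 1) * l)
        - (1 - s) ^ ξ * (1 + s) ^ ζ * (f (k * s) / f k)‖ =
      (1 - s) ^ ξ * (1 + s) ^ ζ * |f (k * s) / f k - exp ((s - 1) * l)| := by
    filter_upwards [ae_restrict_mem measurableSet_Icc] with s hs
    rw [← mul_sub, norm_mul, Real.norm_of_nonneg (hnn s hs), Real.norm_eq_abs, abs_sub_comm]
  have hD : ‖(∫ s in Icc (-1 : ℝ) 1, (1 - s) ^ ξ * (1 + s) ^ ζ * exp ((s - 1) * l))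
      - (∫ s in Icc (-1 : ℝ) 1, (1 - s) ^ ξ * (1 + s) ^ ζ * f (k * s)) / f k‖
      ≤ ε / 2 * (1 / l ^ (ξ + 1)) := by
    rw [← integral_div]
    simp only [mul_div_assoc]
    rw [← integral_sub hB hA]
    refine (norm_integral_le_integral_norm _).trans ?_
    rw [integral_congr_ae hC]
    rw [← ENNReal.ofReal_le_ofReal_iff (by positivity),
      ofReal_integral_eq_lintegral_ofReal ((hB.sub hA).norm.congr hC)]
    · exact hk
    · filter_upwards [ae_restrict_mem measurableSet_Icc] with s hs
      exact mul_nonneg (hnn s hs) (abs_nonneg _)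
  simp only [Function.comp, dist_zero_right, Real.norm_eq_abs]
  rw [Real.dist_eq, abs_abs, ← mul_sub, abs_mul, abs_of_pos (Real.rpow_pos_of_pos hl _)]
  have hlp := Real.rpow_pos_of_pos hl (ξ + 1)
  calc _ ≤ l ^ (ξ + 1) * (ε / 2 * (1 / l ^ (ξ + 1))) :=
        mul_le_mul_of_nonneg_left hD hlp.le
    _ = ε / 2 := by field_simp
    _ < ε := by linarith

/-! ### The law `Rot_p(θ, κ, f)`: normalisation, moments and symmetries -/

theorem one_sub_sq_rpow {s : ℝ} (hs : s ∈ Icc (-1 : ℝ) 1) (ξ : ℝ) :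
    (1 - s ^ 2) ^ ξ = (1 - s) ^ ξ * (1 + s) ^ ξ := by
  rw [← Real.mul_rpow (by linarith [hs.2]) (by linarith [hs.1])]
  congr 1
  ring

theorem neg_one_lt_exponent (m : ℕ) : -1 < (((m + 2 : ℕ) : ℝ) - 3) / 2 := by
  push_cast
  linarith [m.cast_nonneg (α := ℝ)]

theorem InF.integrableOn_weight (hf : InF f) (m : ℕ) {k : ℝ} (hk : 0 < k) :
    IntegrableOn (fun s : ℝ => (1 - s ^ 2) ^ ((((m + 2 : ℕ) : ℝ) - 3) / 2) * f (k * s))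
      (Icc (-1) 1) := by
  refine (hf.integrableOn (neg_one_lt_exponent m) (neg_one_lt_exponent m) hk).congr_fun ?_
    measurableSet_Icc
  intro s hs
  simp only [one_sub_sq_rpow hs]

theorem normConst_eq (m : ℕ) (k : ℝ) (f : ℝ → ℝ) : normConst (m + 2) k f =
    1 / ∫ s in Icc (-1 : ℝ) 1, (1 - s ^ 2) ^ ((((m + 2 : ℕ) : ℝ) - 3) / 2) * f (k * s) := by
  rw [normConst, intervalIntegral.integral_of_le (by norm_num), integral_Icc_eq_integral_Ioc]

theorem InF.integral_weight_pos (hf : InF f) (m : ℕ) {k : ℝ} (hk : 0 < k) :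
    0 < ∫ s in Icc (-1 : ℝ) 1, (1 - s ^ 2) ^ ((((m + 2 : ℕ) : ℝ) - 3) / 2) * f (k * s) := by
  rw [setIntegral_pos_iff_support_of_nonneg_ae _ (hf.integrableOn_weight m hk)]
  · refine lt_of_lt_of_le ?_ (measure_mono (s := Ioo (0 : ℝ) 1) ?_)
    · simp
    · intro s hs
      refine ⟨mul_ne_zero ?_ (hf.pos (mul_pos hk hs.1)).ne', by linarith [hs.1], hs.2.le⟩
      exact (Real.rpow_pos_of_pos (by nlinarith [hs.1, hs.2]) _).ne'
  · filter_upwards [ae_restrict_mem measurableSet_Icc] with s hs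
    exact mul_nonneg (Real.rpow_nonneg (by nlinarith [hs.1, hs.2]) _) (hf.nonneg _)

theorem InF.normConst_pos (hf : InF f) (m : ℕ) {k : ℝ} (hk : 0 < k) :
    0 < normConst (m + 2) k f := by
  rw [normConst_eq]
  exact one_div_pos.2 (hf.integral_weight_pos m hk)

/-- The law of `x'θ` under `Rot_p(θ, κ, f)`. -/
noncomputable def radialLaw (p : ℕ) (k : ℝ) (f : ℝ → ℝ) : Measure ℝ :=
  (volume.restrict (Icc (-1 : ℝ) 1)).withDensity fun s =>
    ENNReal.ofReal (normConst p k f * ((1 - s ^ 2) ^ (((p : ℝ) - 3) / 2) * f (k * s)))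

theorem InF.measurable_rotDensity (hf : InF f) (p : ℕ) (θ : E p) (k : ℝ) :
    Measurable (rotDensity p θ k f) := by
  have := hf.measurable
  unfold rotDensity
  fun_prop

theorem InF.lintegral_rot (hf : InF f) {p : ℕ} (θ : E p) (k : ℝ) {F : Sph p → ℝ≥0∞}
    (hF : Measurable F) :
    ∫⁻ x, F x ∂(rot p θ k f) = ∫⁻ x, ENNReal.ofReal (rotDensity p θ k f x) * F x
      ∂(volume : Measure (E p)).toSphere :=
  lintegral_withDensity_eq_lintegral_mul _ (hf.measurable_rotDensity p θ k).ennreal_ofReal hF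

theorem InF.rot_map_inner (hf : InF f) {m : ℕ} (θ : E (m + 2)) (hθ : ‖θ‖ = 1) {k : ℝ}
    (hk : 0 < k) :
    (rot (m + 2) θ k f).map (fun x : Sph (m + 2) => ⟪(x : E (m + 2)), θ⟫) = radialLaw (m + 2) k f := by
  have hfm := hf.measurable
  refine Measure.ext_of_lintegral _ fun g hg => ?_
  have hgm : Measurable fun x : Sph (m + 2) => g ⟪(x : E (m + 2)), θ⟫ := hg.comp (by fun_prop)
  rw [lintegral_map hg (by fun_prop), hf.lintegral_rot θ k hgm, radialLaw,
    lintegral_withDensity_eq_lintegral_mul _ (by fun_prop) hg]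
  have hc := (hf.normConst_pos m hk).le
  set c := normConst (m + 2) k f with hcdef
  have hΓ : 0 < Real.Gamma ((((m + 2 : ℕ) : ℝ) - 1) / 2) :=
    Real.Gamma_pos_of_pos (by push_cast; linarith [m.cast_nonneg (α := ℝ)])
  have h1 := lintegral_toSphere_inner θ hθ (g := fun s => ENNReal.ofReal
    (c * Real.Gamma ((((m + 2 : ℕ) : ℝ) - 1) / 2) / (2 * π ^ ((((m + 2 : ℕ) : ℝ) - 1) / 2))
    * f (k * s)) * g s) (Measurable.mul (by fun_prop) hg)
  have hπ : 0 < π ^ ((((m + 2 : ℕ) : ℝ) - 1) / 2) := Real.rpow_pos_of_pos pi_pos _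
  simp only [rotDensity, ← hcdef]
  rw [h1, ← lintegral_const_mul' _ _ ENNReal.ofReal_ne_top]
  refine setLIntegral_congr_fun measurableSet_Icc fun s hs => ?_
  simp only [Pi.mul_apply]
  have hw : 0 ≤ (1 - s ^ 2) ^ ((((m + 2 : ℕ) : ℝ) - 3) / 2) :=
    Real.rpow_nonneg (by nlinarith [hs.1, hs.2]) _
  rw [← mul_assoc, ← mul_assoc, ← ENNReal.ofReal_mul (by positivity),
    ← ENNReal.ofReal_mul (by positivity)]
  congr 2
  field_simp

theorem InF.lintegral_radialLaw (hf : InF f) {m : ℕ} {k : ℝ} (hk : 0 < k) {g : ℝ → ℝ≥0∞}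
    (hg : Measurable g) :
    ∫⁻ s, g s ∂(radialLaw (m + 2) k f) = ENNReal.ofReal (normConst (m + 2) k f) *
      ∫⁻ s in Icc (-1 : ℝ) 1, ENNReal.ofReal
        ((1 - s ^ 2) ^ ((((m + 2 : ℕ) : ℝ) - 3) / 2) * f (k * s)) * g s := by
  have hfm := hf.measurable
  rw [radialLaw, lintegral_withDensity_eq_lintegral_mul _ (by fun_prop) hg,
    ← lintegral_const_mul' _ _ ENNReal.ofReal_ne_top]
  refine lintegral_congr fun s => ?_
  rw [Pi.mul_apply, ENNReal.ofReal_mul (hf.normConst_pos m hk).le, mul_assoc]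

theorem InF.integral_radialLaw (hf : InF f) {m : ℕ} {k : ℝ} (hk : 0 < k) (g : ℝ → ℝ) :
    ∫ s, g s ∂(radialLaw (m + 2) k f) = normConst (m + 2) k f *
      ∫ s in Icc (-1 : ℝ) 1,
        (1 - s ^ 2) ^ ((((m + 2 : ℕ) : ℝ) - 3) / 2) * f (k * s) * g s := by
  have hfm := hf.measurable
  rw [radialLaw, integral_withDensity_eq_integral_toReal_smul (by fun_prop)
    (Eventually.of_forall fun s => ENNReal.ofReal_lt_top), ← integral_const_mul]
  refine setIntegral_congr_fun measurableSet_Icc fun s hs => ?_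
  have hw : 0 ≤ (1 - s ^ 2) ^ ((((m + 2 : ℕ) : ℝ) - 3) / 2) :=
    Real.rpow_nonneg (by nlinarith [hs.1, hs.2]) _
  simp only [smul_eq_mul]
  rw [ENNReal.toReal_ofReal
    (mul_nonneg (hf.normConst_pos m hk).le (mul_nonneg hw (hf.nonneg _))), mul_assoc]

theorem InF.isProbabilityMeasure_radialLaw (hf : InF f) (m : ℕ) {k : ℝ} (hk : 0 < k) :
    IsProbabilityMeasure (radialLaw (m + 2) k f) := by
  constructor
  have h := hf.lintegral_radialLaw (m := m) hk (g := fun _ => 1) measurable_const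
  simp only [lintegral_one, mul_one] at h
  rw [h, ← ofReal_integral_eq_lintegral_ofReal (hf.integrableOn_weight m hk),
    ← ENNReal.ofReal_mul (hf.normConst_pos m hk).le, normConst_eq,
    one_div_mul_cancel (hf.integral_weight_pos m hk).ne', ENNReal.ofReal_one]
  filter_upwards [ae_restrict_mem measurableSet_Icc] with s hs
  exact mul_nonneg (Real.rpow_nonneg (by nlinarith [hs.1, hs.2]) _) (hf.nonneg _)

theorem InF.isProbabilityMeasure_rot (hf : InF f) {m : ℕ} (θ : E (m + 2)) (hθ : ‖θ‖ = 1) {k : ℝ}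
    (hk : 0 < k) : IsProbabilityMeasure (rot (m + 2) θ k f) := by
  have h := hf.isProbabilityMeasure_radialLaw m hk
  rw [← hf.rot_map_inner θ hθ hk] at h
  exact Measure.isProbabilityMeasure_of_map fun x : Sph (m + 2) => ⟪(x : E (m + 2)), θ⟫

theorem InF.integral_rot_inner (hf : InF f) {m : ℕ} (θ : E (m + 2)) (hθ : ‖θ‖ = 1) {k : ℝ}
    (hk : 0 < k) {g : ℝ → ℝ} (hg : Measurable g) :
    ∫ x, g ⟪(x : E (m + 2)), θ⟫ ∂(rot (m + 2) θ k f) = normConst (m + 2) k f *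
      ∫ s in Icc (-1 : ℝ) 1,
        (1 - s ^ 2) ^ ((((m + 2 : ℕ) : ℝ) - 3) / 2) * f (k * s) * g s := by
  rw [← hf.integral_radialLaw hk, ← hf.rot_map_inner θ hθ hk,
    integral_map (by fun_prop) hg.aestronglyMeasurable]

theorem InF.lintegral_rot_inner (hf : InF f) {m : ℕ} (θ : E (m + 2)) (hθ : ‖θ‖ = 1) {k : ℝ}
    (hk : 0 < k) {g : ℝ → ℝ≥0∞} (hg : Measurable g) :
    ∫⁻ x, g ⟪(x : E (m + 2)), θ⟫ ∂(rot (m + 2) θ k f) =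
      ENNReal.ofReal (normConst (m + 2) k f) *
      ∫⁻ s in Icc (-1 : ℝ) 1, ENNReal.ofReal
        ((1 - s ^ 2) ^ ((((m + 2 : ℕ) : ℝ) - 3) / 2) * f (k * s)) * g s := by
  rw [← hf.lintegral_radialLaw hk hg, ← hf.rot_map_inner θ hθ hk,
    lintegral_map hg (by fun_prop)]

/-- The normalizing constant satisfies `c_{p,κ,f} f(κ) ∼ (κφ_f(κ))^{(p-1)/2} / (2^ξ Γ(ξ+1))`. -/
theorem InF.tendsto_normConst (hf : InF f) (m : ℕ) :
    Tendsto (fun k : ℝ => normConst (m + 2) k f * f k /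
        (k * phi f k) ^ ((((m + 2 : ℕ) : ℝ) - 1) / 2)) atTop
      (𝓝 (2 ^ ((((m + 2 : ℕ) : ℝ) - 3) / 2) * Real.Gamma ((((m + 2 : ℕ) : ℝ) - 1) / 2))⁻¹) := by
  have h := hf.tendsto_integral (neg_one_lt_exponent m) (neg_one_lt_exponent m)
  have hξ : (((m + 2 : ℕ) : ℝ) - 3) / 2 + 1 = (((m + 2 : ℕ) : ℝ) - 1) / 2 := by ring
  rw [hξ] at h
  have hΓ : 0 < Real.Gamma ((((m + 2 : ℕ) : ℝ) - 1) / 2) :=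
    Real.Gamma_pos_of_pos (by push_cast; linarith [m.cast_nonneg (α := ℝ)])
  refine (h.inv₀ (by positivity)).congr fun k => ?_
  rw [normConst_eq]
  have h1 : ∫ s in Icc (-1 : ℝ) 1, (1 - s ^ 2) ^ ((((m + 2 : ℕ) : ℝ) - 3) / 2) * f (k * s)
      = ∫ s in Icc (-1 : ℝ) 1, (1 - s) ^ ((((m + 2 : ℕ) : ℝ) - 3) / 2)
        * (1 + s) ^ ((((m + 2 : ℕ) : ℝ) - 3) / 2) * f (k * s) :=
    setIntegral_congr_fun measurableSet_Icc fun s hs => by simp only [one_sub_sq_rpow hs]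
  rw [h1, mul_inv, inv_div]
  ring

/-- The moment is a quotient of two Laplace integrals, with exponents `(ξ + a, ξ + b)` above and
`(ξ, ξ)` below, where `ξ = (p-3)/2`. Thus `1 - x'θ` is of order `1/(κφ_f(κ))`. -/
theorem InF.tendsto_moment (hf : InF f) {m : ℕ} (θ : E (m + 2)) (hθ : ‖θ‖ = 1) {a b : ℝ}
    (ha : 0 ≤ a) (hb : 0 ≤ b) :
    Tendsto (fun k : ℝ => (k * phi f k) ^ a * ∫ x, (1 - ⟪(x : E (m + 2)), θ⟫) ^ a
        * (1 + ⟪(x : E (m + 2)), θ⟫) ^ b ∂(rot (m + 2) θ k f)) atTop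
      (𝓝 (2 ^ b * Real.Gamma ((((m + 2 : ℕ) : ℝ) - 1) / 2 + a)
        / Real.Gamma ((((m + 2 : ℕ) : ℝ) - 1) / 2))) := by
  have hξ := neg_one_lt_exponent m
  set ξ := (((m + 2 : ℕ) : ℝ) - 3) / 2 with hξdef
  have hξ1 : (((m + 2 : ℕ) : ℝ) - 1) / 2 = ξ + 1 := by rw [hξdef]; ring
  have h1 := hf.tendsto_normConst m
  have h2 := hf.tendsto_integral (ξ := ξ + a) (ζ := ξ + b) (by linarith) (by linarith)
  have h3 := h1.mul h2
  have hΓ : 0 < Real.Gamma (ξ + 1) := Real.Gamma_pos_of_pos (by linarith)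
  have hlim : (2 ^ ξ * Real.Gamma (ξ + 1))⁻¹ * (2 ^ (ξ + b) * Real.Gamma (ξ + a + 1))
      = 2 ^ b * Real.Gamma (ξ + 1 + a) / Real.Gamma (ξ + 1) := by
    rw [Real.rpow_add two_pos, add_right_comm ξ a 1]
    field_simp
  rw [hξ1] at h3 ⊢
  rw [← hξdef, hlim] at h3
  refine h3.congr' ?_
  filter_upwards [hf.tendsto_mul_phi.eventually_gt_atTop 0, eventually_gt_atTop 0] with k hl hk
  rw [hf.integral_rot_inner θ hθ hk (g := fun s => (1 - s) ^ a * (1 + s) ^ b) (by fun_prop)]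
  have h4 : ∫ s in Icc (-1 : ℝ) 1, (1 - s ^ 2) ^ ((((m + 2 : ℕ) : ℝ) - 3) / 2) * f (k * s)
        * ((1 - s) ^ a * (1 + s) ^ b)
      = ∫ s in Icc (-1 : ℝ) 1, (1 - s) ^ (ξ + a) * (1 + s) ^ (ξ + b) * f (k * s) := by
    -- The endpoints are removed because adding exponents of real powers requires positive bases.
    rw [integral_Icc_eq_integral_Ioo, integral_Icc_eq_integral_Ioo]
    refine setIntegral_congr_fun measurableSet_Ioo fun s hs => ?_
    rw [← hξdef, one_sub_sq_rpow (Ioo_subset_Icc_self hs), Real.rpow_add (by linarith [hs.2]),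
      Real.rpow_add (by linarith [hs.1])]
    ring
  rw [h4, show ξ + a + 1 = (ξ + 1) + a by ring, Real.rpow_add hl (ξ + 1) a]
  have := (hf.pos hk).ne'
  have := (Real.rpow_pos_of_pos hl (ξ + 1)).ne'
  generalize (k * phi f k) ^ (ξ + 1) = P at *
  generalize (k * phi f k) ^ a = Q at *
  generalize (∫ s in Icc (-1 : ℝ) 1, (1 - s) ^ (ξ + a) * (1 + s) ^ (ξ + b) * f (k * s)) = I
  field_simp

theorem InF.lintegral_rot_isometry (hf : InF f) {m : ℕ} (θ : E (m + 2)) (k : ℝ)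
    (R : E (m + 2) ≃ₗᵢ[ℝ] E (m + 2)) (hR : R θ = θ) {F : E (m + 2) → ℝ≥0∞} (hF : Measurable F) :
    ∫⁻ x, F (R x) ∂(rot (m + 2) θ k f) = ∫⁻ x, F x ∂(rot (m + 2) θ k f) := by
  have hfm := hf.measurable
  have h1 : Measurable fun x : Sph (m + 2) => F x := hF.comp measurable_subtype_coe
  have h2 : Measurable fun x : Sph (m + 2) => F (R x) := hF.comp (by fun_prop)
  rw [hf.lintegral_rot θ k h1, hf.lintegral_rot θ k h2]
  have h3 := lintegral_toSphere_isometry (F := fun y => ENNReal.ofReal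
    (normConst (m + 2) k f * Real.Gamma ((((m + 2 : ℕ) : ℝ) - 1) / 2)
      / (2 * π ^ ((((m + 2 : ℕ) : ℝ) - 1) / 2)) * f (k * ⟪y, θ⟫)) * F y)
    (Measurable.mul (by fun_prop) hF) R
  have h4 : ∀ y : E (m + 2), ⟪R y, θ⟫ = ⟪y, θ⟫ := fun y => by
    nth_rewrite 1 [← hR]
    exact R.inner_map_map y θ
  simp only [h4] at h3
  exact h3

/-- Both the inclusion of the sphere and `R` are measurable embeddings, so `F` may be arbitrary. -/
theorem InF.integral_rot_isometry (hf : InF f) {m : ℕ} (θ : E (m + 2)) (k : ℝ)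
    (R : E (m + 2) ≃ₗᵢ[ℝ] E (m + 2)) (hR : R θ = θ) (F : E (m + 2) → ℝ) :
    ∫ x, F (R x) ∂(rot (m + 2) θ k f) = ∫ x, F x ∂(rot (m + 2) θ k f) := by
  have hemb : MeasurableEmbedding (Subtype.val : Sph (m + 2) → E (m + 2)) :=
    MeasurableEmbedding.subtype_coe Metric.isClosed_sphere.measurableSet
  have hR' : MeasurableEmbedding R := R.toHomeomorph.measurableEmbedding
  have hmap : ((rot (m + 2) θ k f).map Subtype.val).map R = (rot (m + 2) θ k f).map Subtype.val := by
    refine Measure.ext_of_lintegral _ fun g hg => ?_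
    have hgR : Measurable fun y => g (R y) := hg.comp R.continuous.measurable
    rw [lintegral_map hg R.continuous.measurable, lintegral_map hgR measurable_subtype_coe,
      lintegral_map hg measurable_subtype_coe]
    exact hf.lintegral_rot_isometry θ k R hR hg
  rw [← hemb.integral_map (μ := rot (m + 2) θ k f) (g := fun y => F y), ← hmap,
    hR'.integral_map, hemb.integral_map]

/-- The reflection that fixes the line of `θ` and negates its orthogonal complement preserves the
law and `x'θ`, but changes the sign of `x'a`. -/
theorem InF.integral_rot_odd (hf : InF f) {m : ℕ} (θ : E (m + 2)) (k : ℝ) {a : E (m + 2)}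
    (ha : ⟪a, θ⟫ = 0) (G : ℝ → ℝ) :
    ∫ x, ⟪(x : E (m + 2)), a⟫ * G ⟪(x : E (m + 2)), θ⟫ ∂(rot (m + 2) θ k f) = 0 := by
  set R := (ℝ ∙ θ).reflection
  have hR : R θ = θ :=
    (ℝ ∙ θ).reflection_mem_subspace_eq_self (Submodule.mem_span_singleton_self θ)
  have hRa : R a = -a := by
    refine (ℝ ∙ θ).reflection_mem_subspace_orthogonalComplement_eq_neg ?_
    rw [Submodule.mem_orthogonal_singleton_iff_inner_left]
    exact ha
  have h := hf.integral_rot_isometry θ k R hR fun y => ⟪y, a⟫ * G ⟪y, θ⟫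
  have h1 : ∀ y, ⟪R y, θ⟫ = ⟪y, θ⟫ := fun y => by
    nth_rewrite 1 [← hR]
    exact R.inner_map_map y θ
  have h2 : ∀ y, ⟪R y, a⟫ = -⟪y, a⟫ := fun y => by
    have := R.inner_map_map y a
    rw [hRa, inner_neg_right] at this
    linarith
  simp only [h1, h2, neg_mul, integral_neg] at h
  linarith

/-- Only the component of `x` orthogonal to `θ`, of squared norm `1 - (x'θ)²`, pairs with `a`; then
Cauchy–Schwarz applies. -/
theorem inner_sq_le {p : ℕ} (θ : E p) (hθ : ‖θ‖ = 1) {a : E p} (ha : ⟪a, θ⟫ = 0) (x : Sph p) :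
    ⟪(x : E p), a⟫ ^ 2 ≤ ‖a‖ ^ 2 * (1 - ⟪(x : E p), θ⟫ ^ 2) := by
  have hx : ‖(x : E p)‖ = 1 := by simp
  have h1 : ⟪(x : E p) - ⟪(x : E p), θ⟫ • θ, a⟫ = ⟪(x : E p), a⟫ := by
    rw [inner_sub_left, inner_smul_left, real_inner_comm a θ, ha]
    simp
  have h2 : ‖(x : E p) - ⟪(x : E p), θ⟫ • θ‖ ^ 2 = 1 - ⟪(x : E p), θ⟫ ^ 2 := by
    rw [norm_sub_sq_real, norm_smul, hx, hθ, inner_smul_right]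
    simp
    ring
  have h3 := abs_real_inner_le_norm ((x : E p) - ⟪(x : E p), θ⟫ • θ) a
  rw [h1] at h3
  rw [← h2, ← sq_abs, ← mul_pow, mul_comm ‖a‖]
  exact pow_le_pow_left₀ (abs_nonneg _) h3 2

theorem abs_inner_le_one {p : ℕ} (θ : E p) (hθ : ‖θ‖ = 1) (x : Sph p) : |⟪(x : E p), θ⟫| ≤ 1 := by
  have := abs_real_inner_le_norm (x : E p) θ
  rwa [hθ, norm_eq_of_mem_sphere, one_mul] at this

theorem integrable_of_bounded {p : ℕ} {μ : Measure (Sph p)} [IsFiniteMeasure μ] {g : Sph p → ℝ}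
    (hg : Measurable g) (C : ℝ) (h : ∀ x, |g x| ≤ C) : Integrable g μ :=
  Integrable.of_bound hg.aestronglyMeasurable C (Eventually.of_forall h)

/-- Complete `θ` and `a/‖a‖` to an orthonormal basis. The `p - 1` coordinates orthogonal to `θ` have
equal second moments, and their squares sum to `1 - (x'θ)²`. -/
theorem InF.integral_rot_sq (hf : InF f) {m : ℕ} (θ : E (m + 2)) (hθ : ‖θ‖ = 1) {k : ℝ}
    (hk : 0 < k) {a : E (m + 2)} (ha : ⟪a, θ⟫ = 0) :
    ∫ x, ⟪(x : E (m + 2)), a⟫ ^ 2 ∂(rot (m + 2) θ k f) =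
      ‖a‖ ^ 2 / (((m + 2 : ℕ) : ℝ) - 1) *
        ∫ x, (1 - ⟪(x : E (m + 2)), θ⟫ ^ 2) ∂(rot (m + 2) θ k f) := by
  have hprob := hf.isProbabilityMeasure_rot θ hθ hk
  rcases eq_or_ne a 0 with rfl | ha0
  · simp
  have hna : ‖a‖ ≠ 0 := norm_ne_zero_iff.2 ha0
  obtain ⟨b, hb0, hb1⟩ := exists_basis_fst_snd θ (‖a‖⁻¹ • a) hθ
    (by rw [norm_smul, norm_inv, norm_norm, inv_mul_cancel₀ hna])
    (by rw [inner_smul_right, real_inner_comm, ha, mul_zero])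
  have hint : ∀ c : E (m + 2), Integrable (fun x : Sph (m + 2) => ⟪(x : E (m + 2)), c⟫ ^ 2)
      (rot (m + 2) θ k f) := fun c => by
    refine integrable_of_bounded (by fun_prop) (‖c‖ ^ 2) fun x => ?_
    have := abs_real_inner_le_norm (x : E (m + 2)) c
    rw [norm_eq_of_mem_sphere, one_mul] at this
    rw [abs_pow]
    exact pow_le_pow_left₀ (abs_nonneg _) this 2
  have hI : ∀ i : Fin (m + 1), ∫ x, ⟪(x : E (m + 2)), b i.succ⟫ ^ 2 ∂(rot (m + 2) θ k f)
      = ∫ x, ⟪(x : E (m + 2)), b 1⟫ ^ 2 ∂(rot (m + 2) θ k f) := by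
    intro i
    -- Swapping two basis vectors other than `b 0 = θ` is an isometry fixing `θ`.
    set R := b.equiv b (Equiv.swap 1 i.succ)
    have hR : R θ = θ := by
      rw [← hb0, OrthonormalBasis.equiv_apply_basis, Equiv.swap_apply_of_ne_of_ne (by simp)
        (Fin.succ_ne_zero i).symm]
    have hR1 : R (b 1) = b i.succ := by
      rw [OrthonormalBasis.equiv_apply_basis, Equiv.swap_apply_left]
    have h := hf.integral_rot_isometry θ k R hR fun y => ⟪y, b i.succ⟫ ^ 2
    rw [← h]
    refine integral_congr_ae (Eventually.of_forall fun x => ?_)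
    simp only
    rw [← hR1, R.inner_map_map]
  have hsum : ∀ x : Sph (m + 2), 1 - ⟪(x : E (m + 2)), θ⟫ ^ 2
      = ∑ i : Fin (m + 1), ⟪(x : E (m + 2)), b i.succ⟫ ^ 2 := by
    intro x
    have h := b.sum_sq_norm_inner_left (x : E (m + 2))
    simp only [norm_eq_of_mem_sphere, one_pow, Real.norm_eq_abs, sq_abs] at h
    rw [Fin.sum_univ_succ, hb0] at h
    linarith
  simp only [hsum]
  rw [integral_finsetSum _ fun i _ => hint _]
  simp only [hI, Finset.sum_const, Finset.card_univ, Fintype.card_fin, nsmul_eq_mul, hb1,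
    inner_smul_right, mul_pow, integral_const_mul]
  have h1 : ((m + 2 : ℕ) : ℝ) - 1 = ((m + 1 : ℕ) : ℝ) := by push_cast; ring
  have h2 : ((m + 1 : ℕ) : ℝ) ≠ 0 := by positivity
  rw [h1]
  field_simp

/-! ### The conditions of `𝓕_LAN` as expectations under `Rot_p(θ, κ, f)` -/

theorem InF.measurable_phi (hf : InF f) : Measurable (phi f) :=
  (measurable_deriv f).div hf.measurable

/-- The hypotheses divide by `f(k)`, expectations multiply by the normalising constant; this bounds
the price of passing from one to the other. -/
theorem InF.exists_normConst_le (hf : InF f) (m : ℕ) : ∃ D : ℝ, 0 < D ∧ ∀ᶠ k : ℝ in atTop,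
    normConst (m + 2) k f * f k ≤ D * (k * phi f k) ^ ((((m + 2 : ℕ) : ℝ) - 1) / 2) := by
  have h := hf.tendsto_normConst m
  set L := (2 ^ ((((m + 2 : ℕ) : ℝ) - 3) / 2) * Real.Gamma ((((m + 2 : ℕ) : ℝ) - 1) / 2))⁻¹ with hL
  refine ⟨|L| + 1, by positivity, ?_⟩
  filter_upwards [h.eventually_lt_const (show L < |L| + 1 by linarith [le_abs_self L]),
    hf.tendsto_mul_phi.eventually_gt_atTop 0] with k hk hl
  exact ((div_lt_iff₀ (Real.rpow_pos_of_pos hl _)).1 hk).le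

/-- With `q = (p-3)/2`, the factor `(kφ)^{q+1}` from the normalisation times the assumed rate
`1/(k^{q+2} φ^q)` is `φ/k`. -/
theorem InFLAN.score_isSmallO {m : ℕ} {κ t : ℕ → ℝ} (hf : InFLAN (m + 2) κ t f)
    (θ : E (m + 2)) (hθ : ‖θ‖ = 1) :
    IsSmallO (atTop : Filter ℝ)
      (fun k => ∫⁻ x, ENNReal.ofReal ((phi f (k * ⟪(x : E (m + 2)), θ⟫) - phi f k) ^ 2)
        ∂(rot (m + 2) θ k f))
      (fun k => phi f k / k) := by
  intro ε hε
  have hF := hf.inF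
  have hφm := hF.measurable_phi
  obtain ⟨D, hD, hDk⟩ := hF.exists_normConst_le m
  filter_upwards [hf.score_approx (ε / D) (by positivity), hDk, eventually_gt_atTop 0,
    hF.tendsto_mul_phi.eventually_gt_atTop 0] with k hk hDk hk0 hl
  have hφ : 0 < phi f k := pos_of_mul_pos_right hl hk0.le
  have hfk := hF.pos hk0
  rw [hF.lintegral_rot_inner θ hθ hk0 (g := fun s =>
    ENNReal.ofReal ((phi f (k * s) - phi f k) ^ 2)) (by fun_prop)]
  have h1 : ∫⁻ s in Icc (-1 : ℝ) 1, ENNReal.ofReal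
        ((1 - s ^ 2) ^ ((((m + 2 : ℕ) : ℝ) - 3) / 2) * f (k * s))
        * ENNReal.ofReal ((phi f (k * s) - phi f k) ^ 2)
      = ∫⁻ s in Icc (-1 : ℝ) 1, ENNReal.ofReal
        ((phi f (k * s) - phi f k) ^ 2 * (1 - s ^ 2) ^ ((((m + 2 : ℕ) : ℝ) - 3) / 2)
          * f (k * s)) := by
    refine lintegral_congr fun s => ?_
    rw [mul_comm, ← ENNReal.ofReal_mul (sq_nonneg _), mul_assoc]
  have h2 : normConst (m + 2) k f = normConst (m + 2) k f * f k * (1 / f k) := by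
    field_simp
  rw [h1, h2, ENNReal.ofReal_mul (mul_nonneg (hF.normConst_pos m hk0).le hfk.le), mul_assoc]
  calc _ ≤ ENNReal.ofReal (D * (k * phi f k) ^ ((((m + 2 : ℕ) : ℝ) - 1) / 2)) *
        ENNReal.ofReal (ε / D * (1 / (k ^ ((((m + 2 : ℕ) : ℝ) + 1) / 2)
          * phi f k ^ ((((m + 2 : ℕ) : ℝ) - 3) / 2)))) :=
        mul_le_mul' (ENNReal.ofReal_le_ofReal hDk) hk
    _ = ENNReal.ofReal (ε * (phi f k / k)) := by
        rw [← ENNReal.ofReal_mul (by positivity)]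
        congr 1
        rw [Real.mul_rpow hk0.le hφ.le,
          show (((m + 2 : ℕ) : ℝ) + 1) / 2 = (((m + 2 : ℕ) : ℝ) - 3) / 2 + 1 + 1 by ring,
          show (((m + 2 : ℕ) : ℝ) - 1) / 2 = (((m + 2 : ℕ) : ℝ) - 3) / 2 + 1 by ring]
        generalize (((m + 2 : ℕ) : ℝ) - 3) / 2 = q
        rw [Real.rpow_add hk0 (q + 1), Real.rpow_add hk0 q, Real.rpow_add hφ q]
        have := (Real.rpow_pos_of_pos hk0 q).ne'
        have := (Real.rpow_pos_of_pos hφ q).ne'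
        simp only [Real.rpow_one]
        generalize k ^ q = A at *
        generalize phi f k ^ q = B at *
        field_simp

open Classical in
/-- `|log f(a+h) - log f(a) - h φ_f(a)|`, with the value `0` if `f(a) = 0`, and `∞` if
`f(a) ≠ 0` and `f(a+h) = 0`. -/
noncomputable def logError (f : ℝ → ℝ) (a h : ℝ) : ℝ≥0∞ :=
  if f a = 0 then 0
  else if f (a + h) = 0 then ∞
  else ENNReal.ofReal |Real.log (f (a + h)) - Real.log (f a) - h * phi f a|

theorem InF.logRemainder_eq (hf : InF f) (a h : ℝ) :
    logRemainder f a h = ENNReal.ofReal (f a) * logError f a h := by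
  unfold logRemainder logError
  split_ifs with h1 h2
  · simp
  · have : 0 < f a := lt_of_le_of_ne (hf.nonneg a) (Ne.symm h1)
    rw [ENNReal.mul_top]
    simpa using this
  · rw [mul_comm, ENNReal.ofReal_mul (hf.nonneg a)]

theorem InF.measurable_logError (hf : InF f) :
    Measurable fun z : ℝ × ℝ => logError f z.1 z.2 := by
  have hfm := hf.measurable
  have hφ := hf.measurable_phi
  unfold logError
  refine Measurable.ite ?_ measurable_const (Measurable.ite ?_ measurable_const ?_)
  · exact (hfm.comp measurable_fst) (measurableSet_singleton 0)
  · exact (hfm.comp (measurable_fst.add measurable_snd)) (measurableSet_singleton 0)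
  · fun_prop

theorem InF.measurable_logRemainder (hf : InF f) :
    Measurable fun z : ℝ × ℝ => logRemainder f z.1 z.2 := by
  have hfm := hf.measurable
  simp only [hf.logRemainder_eq]
  exact Measurable.mul (by fun_prop) hf.measurable_logError

theorem isProbabilityMeasure_lawG (m : ℕ) : IsProbabilityMeasure (lawG (m + 2)) := by
  unfold lawG
  split_ifs with h
  · infer_instance
  · refine isProbabilityMeasureBeta (by norm_num) ?_
    have hm : 0 < m := by omega
    have : (0 : ℝ) < m := by exact_mod_cast hm
    push_cast
    linarith

/-- Expand `‖θ + ντ‖² = 1`. This relation is the source of the quadratic term of the expansion. -/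
theorem inner_of_norm_add_smul {p : ℕ} {θ τ : E p} {ν : ℝ} (hν : ν ≠ 0) (hθ : ‖θ‖ = 1)
    (h : ‖θ + ν • τ‖ = 1) : ⟪τ, θ⟫ = -(1 / 2) * ν * ‖τ‖ ^ 2 := by
  have h1 := norm_add_sq_real θ (ν • τ)
  rw [h, hθ, inner_smul_right, norm_smul, mul_pow, Real.norm_eq_abs, sq_abs,
    real_inner_comm] at h1
  have h2 : ν * (2 * ⟪τ, θ⟫ + ν * ‖τ‖ ^ 2) = 0 := by linarith
  rcases mul_eq_zero.1 h2 with h3 | h3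
  · exact absurd h3 hν
  · linarith

/-- The decomposition of `τ` along `θ` and its orthogonal complement. -/
theorem exists_tangent_direction {m : ℕ} {θ τ : E (m + 2)} {ν : ℝ} (hν : ν ≠ 0) (hθ : ‖θ‖ = 1)
    (h : ‖θ + ν • τ‖ = 1) : ∃ e : E (m + 2), ‖e‖ = 1 ∧ ⟪θ, e⟫ = 0 ∧
      τ = (-(1 / 2) * ν * ‖τ‖ ^ 2) • θ + (√(1 - 1 / 4 * ν ^ 2 * ‖τ‖ ^ 2) * ‖τ‖) • e := by
  have hin := inner_of_norm_add_smul hν hθ h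
  set d := τ - (-(1 / 2) * ν * ‖τ‖ ^ 2) • θ with hd
  have hdθ : ⟪θ, d⟫ = 0 := by
    rw [hd, inner_sub_right, inner_smul_right, real_inner_comm, hin, real_inner_self_eq_norm_sq,
      hθ]
    ring
  have hdn : ‖d‖ ^ 2 = (1 - 1 / 4 * ν ^ 2 * ‖τ‖ ^ 2) * ‖τ‖ ^ 2 := by
    rw [hd, norm_sub_sq_real, inner_smul_right, hin, norm_smul, hθ, mul_one, Real.norm_eq_abs,
      sq_abs]
    ring
  have hdn' : ‖d‖ = √(1 - 1 / 4 * ν ^ 2 * ‖τ‖ ^ 2) * ‖τ‖ := by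
    rcases eq_or_ne τ 0 with h0 | h0
    · have : ‖d‖ ^ 2 = 0 := by rw [hdn, h0]; simp
      rw [pow_eq_zero_iff two_ne_zero] at this
      rw [this, h0]; simp
    · have hτ : 0 < ‖τ‖ := norm_pos_iff.2 h0
      have h1 : 0 ≤ 1 - 1 / 4 * ν ^ 2 * ‖τ‖ ^ 2 := by
        by_contra hc
        have : (1 - 1 / 4 * ν ^ 2 * ‖τ‖ ^ 2) * ‖τ‖ ^ 2 < 0 :=
          mul_neg_of_neg_of_pos (not_le.1 hc) (by positivity)
        linarith [sq_nonneg ‖d‖]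
      rw [← sq_eq_sq₀ (norm_nonneg _) (by positivity), mul_pow, sq_sqrt h1, hdn]
  -- If the tangential part vanishes, its coefficient is zero and any unit vector orthogonal to `θ`
  -- will do.
  rcases eq_or_ne d 0 with h0 | h0
  · obtain ⟨b, hb⟩ := exists_basis_fst θ hθ
    refine ⟨b 1, b.norm_eq_one 1, ?_, ?_⟩
    · rw [← hb]
      exact b.inner_eq_zero (by simp)
    · rw [← hdn', h0, norm_zero, zero_smul, add_zero]
      exact sub_eq_zero.1 h0
  · have hn : ‖d‖ ≠ 0 := norm_ne_zero_iff.2 h0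
    refine ⟨‖d‖⁻¹ • d, ?_, ?_, ?_⟩
    · rw [norm_smul, norm_inv, norm_norm, inv_mul_cancel₀ hn]
    · rw [inner_smul_right, hdθ, mul_zero]
    · rw [← hdn', smul_smul, mul_inv_cancel₀ hn, one_smul, hd]
      abel

theorem rate_pos {κ : ℕ → ℝ} {n : ℕ} (h : 0 < (n : ℝ) * κ n * phi f (κ n)) : 0 < rate f κ n :=
  one_div_pos.2 (sqrt_pos.2 h)

theorem InF.eventually_pos (hf : InF f) {κ : ℕ → ℝ} (hκ : Tendsto κ atTop atTop) :
    ∀ᶠ n : ℕ in atTop, 0 < (n : ℝ) ∧ 0 < κ n ∧ 0 < phi f (κ n) ∧ 0 < rate f κ n := by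
  filter_upwards [eventually_gt_atTop 0, hκ.eventually_gt_atTop 0,
    (hf.tendsto_mul_phi.comp hκ).eventually_gt_atTop 0] with n hn hk hl
  have hn' : (0 : ℝ) < n := by exact_mod_cast hn
  have hl' : 0 < κ n * phi f (κ n) := hl
  refine ⟨hn', hk, pos_of_mul_pos_right hl' hk.le, rate_pos ?_⟩
  rw [mul_assoc]
  positivity

/-- With `x'θ = s` and `x'e = ±√(1-s²)√w`, where `e` is the tangent direction of `τ`, the shift `κ ν
x'τ` is exactly `h^±(s, w)`. The comparison of laws bounds the expectation by the two integrals of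
the hypothesis, and the power of `κφ` in their rate cancels that of the normalising constant. -/
theorem InFLAN.tendsto_logError {m : ℕ} {κ : ℕ → ℝ} {τ : ℕ → E (m + 2)}
    (hf : InFLAN (m + 2) κ (fun n => ‖τ n‖) f) (θ : E (m + 2)) (hθ : ‖θ‖ = 1)
    (hκ : Tendsto κ atTop atTop) (hθn : ∀ n, ‖θ + rate f κ n • τ n‖ = 1) :
    Tendsto (fun n : ℕ => (n : ℝ≥0∞) * ∫⁻ x, logError f (κ n * ⟪(x : E (m + 2)), θ⟫)
      (κ n * (rate f κ n * ⟪(x : E (m + 2)), τ n⟫)) ∂(rot (m + 2) θ (κ n) f)) atTop (𝓝 0) := by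
  have hF := hf.inF
  have hfm := hF.measurable
  have hsf := isProbabilityMeasure_lawG m
  obtain ⟨C, hC, hCle⟩ := lintegral_toSphere_inner_inner_le m
  obtain ⟨D, hD, hDk⟩ := hF.exists_normConst_le m
  set K : ℝ := Real.Gamma ((((m + 2 : ℕ) : ℝ) - 1) / 2) / (2 * π ^ ((((m + 2 : ℕ) : ℝ) - 1) / 2))
    with hK
  have hΓ : 0 < Real.Gamma ((((m + 2 : ℕ) : ℝ) - 1) / 2) :=
    Real.Gamma_pos_of_pos (by push_cast; linarith [m.cast_nonneg (α := ℝ)])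
  have hK0 : 0 < K := by positivity
  rw [ENNReal.tendsto_nhds_zero]
  intro δ hδ
  -- `C` comes from the comparison of laws, `2` from the two signs, `K` from the Gamma factor of the
  -- density and `D` from the normalising constant.
  obtain ⟨ε, hε, hεδ⟩ : ∃ ε : ℝ, 0 < ε ∧ C * ENNReal.ofReal (2 * K * D * ε) ≤ δ := by
    rcases eq_or_ne δ ∞ with rfl | hδt
    · exact ⟨1, one_pos, le_top⟩
    · have hδr : 0 < δ.toReal := ENNReal.toReal_pos hδ.ne' hδt
      refine ⟨δ.toReal / (2 * K * D * (C.toReal + 1)), by positivity, ?_⟩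
      rw [← ENNReal.ofReal_toReal hC, ← ENNReal.ofReal_mul ENNReal.toReal_nonneg,
        ENNReal.toReal_ofReal ENNReal.toReal_nonneg]
      refine ENNReal.ofReal_le_of_le_toReal ?_
      have : C.toReal * (2 * K * D * (δ.toReal / (2 * K * D * (C.toReal + 1))))
          = C.toReal / (C.toReal + 1) * δ.toReal := by
        field_simp
      rw [this]
      refine mul_le_of_le_one_left hδr.le ((div_le_one (by positivity)).2 (by linarith))
  filter_upwards [hF.eventually_pos hκ, hκ.eventually hDk,
    hf.log_approx 1 (Or.inl rfl) ε hε, hf.log_approx (-1) (Or.inr rfl) ε hε] with n hpos hDn hp hm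
  obtain ⟨hn, hk, hφ, hν⟩ := hpos
  obtain ⟨e, he, hθe, hτe⟩ := exists_tangent_direction hν.ne' hθ (hθn n)
  set ν := rate f κ n with hνdef
  set k := κ n with hkdef
  set c := normConst (m + 2) k f with hc
  have hc0 : 0 < c := hF.normConst_pos m hk
  set t := ‖τ n‖ with ht
  have hfk := hF.pos hk
  set G : ℝ × ℝ → ℝ≥0∞ := fun z => logRemainder f (k * z.1)
    (k * (ν * (-(1 / 2) * ν * t ^ 2 * z.1 + √(1 - 1 / 4 * ν ^ 2 * t ^ 2) * t * z.2))) with hG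
  have hpair : Measurable fun z : ℝ × ℝ => (k * z.1,
      k * (ν * (-(1 / 2) * ν * t ^ 2 * z.1 + √(1 - 1 / 4 * ν ^ 2 * t ^ 2) * t * z.2))) := by
    fun_prop
  have hGm : Measurable G := hF.measurable_logRemainder.comp hpair
  have hinner : ∀ x : E (m + 2), ⟪x, τ n⟫ = -(1 / 2) * ν * t ^ 2 * ⟪x, θ⟫
      + √(1 - 1 / 4 * ν ^ 2 * t ^ 2) * t * ⟪x, e⟫ := fun x => by
    conv_lhs => rw [hτe]
    rw [inner_add_right, inner_smul_right, inner_smul_right]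
  have hlm : Measurable fun x : Sph (m + 2) => logError f (k * ⟪(x : E (m + 2)), θ⟫)
      (k * (ν * ⟪(x : E (m + 2)), τ n⟫)) :=
    hF.measurable_logError.comp
      (g := fun z : ℝ × ℝ => logError f z.1 z.2)
      (f := fun x : Sph (m + 2) => (k * ⟪(x : E (m + 2)), θ⟫, k * (ν * ⟪(x : E (m + 2)), τ n⟫)))
      (by fun_prop)
  have h1 : ∫⁻ x, logError f (k * ⟪(x : E (m + 2)), θ⟫)
      (k * (ν * ⟪(x : E (m + 2)), τ n⟫)) ∂(rot (m + 2) θ k f) = ENNReal.ofReal (c * K) *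
      ∫⁻ x : Sph (m + 2), G (⟪(x : E (m + 2)), θ⟫, ⟪(x : E (m + 2)), e⟫)
        ∂(volume : Measure (E (m + 2))).toSphere := by
    rw [hF.lintegral_rot θ k hlm, ← lintegral_const_mul' _ _ ENNReal.ofReal_ne_top]
    refine lintegral_congr fun x => ?_
    simp only [hG, hF.logRemainder_eq, ← hinner]
    have hdens : rotDensity (m + 2) θ k f x = c * K * f (k * ⟪(x : E (m + 2)), θ⟫) := by
      simp only [rotDensity, ← hc, hK]
      ring
    rw [hdens, ENNReal.ofReal_mul (by positivity), mul_assoc]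
  have h2 := hCle θ e hθ he hθe G hGm
  have hsq : ∀ σ : ℝ, ∫⁻ s in Icc (-1 : ℝ) 1,
      ENNReal.ofReal ((1 - s ^ 2) ^ ((((m + 2 : ℕ) : ℝ) - 3) / 2)) *
        ∫⁻ w, G (s, σ * (√(1 - s ^ 2) * √w)) ∂(lawG (m + 2))
      = ∫⁻ s in Icc (-1 : ℝ) 1, ∫⁻ w, logRemainder f (k * s) (hFun σ t k ν s w)
        * ENNReal.ofReal ((1 - s ^ 2) ^ ((((m + 2 : ℕ) : ℝ) - 3) / 2)) ∂(lawG (m + 2)) := by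
    intro σ
    refine lintegral_congr fun s => ?_
    rw [lintegral_mul_const' _ _ ENNReal.ofReal_ne_top, mul_comm]
    congr 1
    refine lintegral_congr fun w => ?_
    simp only [hG, hFun]
    congr 1
    ring
  have h3 : ∀ A : ℝ≥0∞, ENNReal.ofReal (1 / f k) * A ≤
      ENNReal.ofReal (ε * (1 / ((n : ℝ) * (k * phi f k) ^ ((((m + 2 : ℕ) : ℝ) - 1) / 2)))) →
      A ≤ ENNReal.ofReal
        (f k * (ε * (1 / ((n : ℝ) * (k * phi f k) ^ ((((m + 2 : ℕ) : ℝ) - 1) / 2))))) := by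
    intro A hA
    rw [ENNReal.ofReal_mul hfk.le]
    refine le_trans (le_of_eq ?_) (mul_le_mul_right hA _)
    rw [← mul_assoc, ← ENNReal.ofReal_mul hfk.le, mul_one_div_cancel hfk.ne', ENNReal.ofReal_one,
      one_mul]
  have h4 : ∫⁻ s in Icc (-1 : ℝ) 1,
      ENNReal.ofReal ((1 - s ^ 2) ^ ((((m + 2 : ℕ) : ℝ) - 3) / 2)) *
        ((∫⁻ w, G (s, √(1 - s ^ 2) * √w) ∂(lawG (m + 2)))
          + ∫⁻ w, G (s, -(√(1 - s ^ 2) * √w)) ∂(lawG (m + 2))) ≤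
      2 * ENNReal.ofReal
        (f k * (ε * (1 / ((n : ℝ) * (k * phi f k) ^ ((((m + 2 : ℕ) : ℝ) - 1) / 2))))) := by
    have hp1 := hsq 1
    have hm1 := hsq (-1)
    simp only [one_mul, neg_mul] at hp1 hm1
    simp only [mul_add]
    rw [lintegral_add_left, hp1, hm1, two_mul]
    · exact add_le_add (h3 _ hp) (h3 _ hm)
    · refine Measurable.mul (by fun_prop) ?_
      refine Measurable.lintegral_prod_right' (f := fun q : ℝ × ℝ =>
        G (q.1, √(1 - q.1 ^ 2) * √q.2)) ?_
      exact hGm.comp (by fun_prop)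
  rw [h1]
  refine le_trans ?_ hεδ
  calc (n : ℝ≥0∞) * (ENNReal.ofReal (c * K) *
      ∫⁻ x : Sph (m + 2), G (⟪(x : E (m + 2)), θ⟫, ⟪(x : E (m + 2)), e⟫)
        ∂(volume : Measure (E (m + 2))).toSphere)
      ≤ (n : ℝ≥0∞) * (ENNReal.ofReal (c * K) * (C * (2 * ENNReal.ofReal
        (f k * (ε * (1 / ((n : ℝ) * (k * phi f k) ^ ((((m + 2 : ℕ) : ℝ) - 1) / 2)))))))) := by
        gcongr
        exact h2.trans (mul_le_mul_right h4 _)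
    _ = C * ENNReal.ofReal ((n : ℝ) * ((c * K) * (2 *
        (f k * (ε * (1 / ((n : ℝ) * (k * phi f k) ^ ((((m + 2 : ℕ) : ℝ) - 1) / 2)))))))) := by
        rw [ENNReal.ofReal_mul hn.le, ENNReal.ofReal_mul (p := c * K) (by positivity),
          ENNReal.ofReal_mul two_pos.le, ENNReal.ofReal_natCast, ENNReal.ofReal_ofNat]
        ring
    _ ≤ C * ENNReal.ofReal (2 * K * D * ε) := by
        refine mul_le_mul_right (ENNReal.ofReal_le_ofReal ?_) _
        have hlq : 0 < (k * phi f k) ^ ((((m + 2 : ℕ) : ℝ) - 1) / 2) :=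
          Real.rpow_pos_of_pos (by positivity) _
        have : (n : ℝ) * ((c * K) * (2 *
            (f k * (ε * (1 / ((n : ℝ) * (k * phi f k) ^ ((((m + 2 : ℕ) : ℝ) - 1) / 2)))))))
            = 2 * K * ε * ((c * f k) / (k * phi f k) ^ ((((m + 2 : ℕ) : ℝ) - 1) / 2)) := by
          field_simp
        rw [this]
        calc _ ≤ 2 * K * ε * D := by
              gcongr
              exact (div_le_iff₀ hlq).2 hDn
          _ = _ := by ring

/-! ### Likelihood ratios and sums under product measures -/

section Product

variable {Ω : Type*} [MeasurableSpace Ω] {n : ℕ}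

/-- It suffices to test on boxes, where the truncated product density is a product of independent
truncated factors. -/
theorem pi_withDensity {Q : Measure Ω} [IsProbabilityMeasure Q] {r : Ω → ℝ≥0∞}
    (hr : Measurable r) [IsFiniteMeasure (Q.withDensity r)] :
    Measure.pi (fun _ : Fin n => Q.withDensity r) =
      (Measure.pi fun _ : Fin n => Q).withDensity fun x => ∏ i, r (x i) := by
  refine Measure.pi_eq fun s hs => ?_
  have hbox : MeasurableSet (univ.pi s) := MeasurableSet.univ_pi hs
  have hm : ∀ i, Measurable ((s i).indicator r) := fun i => hr.indicator (hs i)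
  have hind : iIndepFun (fun i (x : Fin n → Ω) => (s i).indicator r (x i))
      (Measure.pi fun _ : Fin n => Q) := iIndepFun_pi fun i => (hm i).aemeasurable
  rw [withDensity_apply _ hbox, ← lintegral_indicator hbox]
  have h1 : ∀ x : Fin n → Ω, (univ.pi s).indicator (fun x => ∏ i, r (x i)) x
      = ∏ i, (s i).indicator r (x i) := by
    intro x
    by_cases hx : x ∈ univ.pi s
    · rw [indicator_of_mem hx]
      exact Finset.prod_congr rfl fun i _ => (indicator_of_mem (hx i (mem_univ i)) r).symm
    · rw [indicator_of_notMem hx]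
      obtain ⟨i, hi⟩ : ∃ i, x i ∉ s i := by
        by_contra hc
        push Not at hc
        exact hx fun i _ => hc i
      exact (Finset.prod_eq_zero (Finset.mem_univ i) (indicator_of_notMem hi r)).symm
  simp only [h1]
  rw [lintegral_prod_eq_prod_lintegral_of_indepFun Finset.univ
    (fun i (x : Fin n → Ω) => (s i).indicator r (x i)) hind
    (fun i => (hm i).comp (measurable_pi_apply i))]
  refine Finset.prod_congr rfl fun i _ => ?_
  rw [withDensity_apply _ (hs i), ← lintegral_indicator (hs i)]
  exact (measurePreserving_eval (fun _ : Fin n => Q) i).lintegral_comp (hm i)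

/-- The likelihood ratio of product measures, when the first factor need not be dominated by the
second one. -/
theorem rnDeriv_pi {P Q : Measure Ω} [IsProbabilityMeasure P] [IsProbabilityMeasure Q]
    {A : Set Ω} (hA : MeasurableSet A) (hQA : Q Aᶜ = 0) {r : Ω → ℝ≥0∞} (hr : Measurable r)
    (hPQ : P.restrict A = Q.withDensity r) :
    ∀ᵐ x ∂(Measure.pi fun _ : Fin n => Q), (∀ i, x i ∈ A) ∧
      (Measure.pi fun _ : Fin n => P).rnDeriv (Measure.pi fun _ : Fin n => Q) x
        = ∏ i, r (x i) := by
  have hfin : IsFiniteMeasure (Q.withDensity r) := by rw [← hPQ]; infer_instance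
  set B : Set (Fin n → Ω) := univ.pi fun _ => A with hB
  have hBm : MeasurableSet B := MeasurableSet.univ_pi fun _ => hA
  have hae : ∀ᵐ x ∂(Measure.pi fun _ : Fin n => Q), ∀ i, x i ∈ A := by
    rw [ae_all_iff]
    intro i
    have h1 : ∀ᵐ y ∂Q, y ∈ A := hQA
    exact (measurePreserving_eval (fun _ : Fin n => Q) i).quasiMeasurePreserving.ae h1
  have hQB : (Measure.pi fun _ : Fin n => Q) Bᶜ = 0 := by
    have h2 : ∀ᵐ x ∂(Measure.pi fun _ : Fin n => Q), x ∈ B := by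
      filter_upwards [hae] with x hx i _ using hx i
    exact h2
  -- This is the Lebesgue decomposition: the part outside `B = A^n` is singular because `B` has full
  -- measure for the product of the `Q`. Uniqueness identifies the derivative.
  have hadd : (Measure.pi fun _ : Fin n => P) = (Measure.pi fun _ : Fin n => P).restrict Bᶜ +
      (Measure.pi fun _ : Fin n => Q).withDensity fun x => ∏ i, r (x i) := by
    rw [← pi_withDensity hr, ← hPQ, ← Measure.restrict_pi_pi, ← hB, add_comm,
      Measure.restrict_add_restrict_compl hBm]
  have hsing : (Measure.pi fun _ : Fin n => P).restrict Bᶜ ⟂ₘ Measure.pi fun _ : Fin n => Q := by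
    refine ⟨B, hBm, ?_, hQB⟩
    rw [Measure.restrict_apply hBm, inter_compl_self, measure_empty]
  have hrm : Measurable fun x : Fin n → Ω => ∏ i, r (x i) :=
    Finset.measurable_prod _ fun i _ => hr.comp (measurable_pi_apply i)
  filter_upwards [hae, Measure.eq_rnDeriv hrm hsing hadd] with x hx hx' using ⟨hx, hx'.symm⟩

theorem lintegral_pi_sum {Q : Measure Ω} [IsProbabilityMeasure Q] {g : Ω → ℝ≥0∞}
    (hg : Measurable g) :
    ∫⁻ x, ∑ i, g (x i) ∂(Measure.pi fun _ : Fin n => Q) = n * ∫⁻ y, g y ∂Q := by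
  have hm : ∀ i : Fin n, Measurable fun x : Fin n → Ω => g (x i) :=
    fun i => hg.comp (measurable_pi_apply i)
  rw [lintegral_finsetSum _ fun i _ => hm i]
  have h : ∀ i : Fin n, ∫⁻ x, g (x i) ∂(Measure.pi fun _ : Fin n => Q) = ∫⁻ y, g y ∂Q := fun i =>
    (measurePreserving_eval (fun _ : Fin n => Q) i).lintegral_comp hg
  simp [h]

/-- Integrate `|S| ≤ η + S²/η` and use that variances of independent centred terms add. -/
theorem lintegral_abs_pi_sum_le {Q : Measure Ω} [IsProbabilityMeasure Q] {g : Ω → ℝ}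
    (hg : Measurable g) (hfin : ∫⁻ y, ENNReal.ofReal (g y ^ 2) ∂Q ≠ ∞) (h0 : ∫ y, g y ∂Q = 0)
    {η : ℝ} (hη : 0 < η) :
    ∫⁻ x, ENNReal.ofReal |∑ i, g (x i)| ∂(Measure.pi fun _ : Fin n => Q) ≤
      ENNReal.ofReal η + ENNReal.ofReal (1 / η) *
        (n * ∫⁻ y, ENNReal.ofReal (g y ^ 2) ∂Q) := by
  have hint : Integrable (fun y => g y ^ 2) Q := by
    refine ⟨(hg.pow_const 2).aestronglyMeasurable, ?_⟩
    rw [hasFiniteIntegral_iff_ofReal (Eventually.of_forall fun y => sq_nonneg _)]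
    exact hfin.lt_top
  have hLp : MemLp g 2 Q := (memLp_two_iff_integrable_sq hg.aestronglyMeasurable).2 hint
  have hsm : Measurable fun x : Fin n → Ω => ∑ i, g (x i) :=
    Finset.measurable_sum _ fun i _ => hg.comp (measurable_pi_apply i)
  have hLpi : ∀ i : Fin n, MemLp (fun x : Fin n → Ω => g (x i)) 2 (Measure.pi fun _ => Q) :=
    fun i => hLp.comp_measurePreserving (measurePreserving_eval (fun _ : Fin n => Q) i)
  have hsumeq : (∑ i : Fin n, fun x : Fin n → Ω => g (x i)) = fun x => ∑ i, g (x i) := by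
    ext x; simp
  have hsLp : MemLp (fun x : Fin n → Ω => ∑ i, g (x i)) 2 (Measure.pi fun _ => Q) := by
    rw [← hsumeq]
    exact memLp_finsetSum' _ fun i _ => hLpi i
  have hmean : ∫ x, ∑ i, g (x i) ∂(Measure.pi fun _ : Fin n => Q) = 0 := by
    rw [integral_finsetSum _ fun i _ => (hLpi i).integrable one_le_two]
    refine Finset.sum_eq_zero fun i _ => ?_
    rw [integral_comp_eval (μ := fun _ : Fin n => Q) (f := g) hg.aestronglyMeasurable, h0]
  have hvar := variance_sum_pi (μ := fun _ : Fin n => Q) (X := fun _ => g) fun _ => hLp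
  rw [hsumeq] at hvar
  have hsq : ∫⁻ x, ENNReal.ofReal ((∑ i, g (x i)) ^ 2) ∂(Measure.pi fun _ : Fin n => Q)
      = n * ∫⁻ y, ENNReal.ofReal (g y ^ 2) ∂Q := by
    have h1 := ofReal_variance hsLp
    have h2 := ofReal_variance hLp
    rw [evariance_eq_lintegral_ofReal] at h1 h2
    rw [hmean] at h1
    rw [h0] at h2
    simp only [sub_zero] at h1 h2
    rw [← h1, ← h2, hvar, Finset.sum_const, Finset.card_univ, Fintype.card_fin, nsmul_eq_mul,
      ENNReal.ofReal_mul (by positivity), ENNReal.ofReal_natCast]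
  rw [← hsq, ← lintegral_const_mul' _ _ ENNReal.ofReal_ne_top]
  calc _ ≤ ∫⁻ x, (ENNReal.ofReal η + ENNReal.ofReal (1 / η)
        * ENNReal.ofReal ((∑ i, g (x i)) ^ 2)) ∂(Measure.pi fun _ : Fin n => Q) := by
        refine lintegral_mono fun x => ?_
        rw [← ENNReal.ofReal_mul (by positivity), ← ENNReal.ofReal_add hη.le (by positivity)]
        refine ENNReal.ofReal_le_ofReal ?_
        generalize (∑ i, g (x i)) = S
        rw [← sq_abs S, one_div, inv_mul_eq_div, ← sub_le_iff_le_add', le_div_iff₀ hη]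
        nlinarith [sq_nonneg (|S| - η), abs_nonneg S]
    _ = _ := by
        rw [lintegral_add_left measurable_const, lintegral_const, measure_univ, mul_one]

end Product

/-! ### The log-likelihood ratio and its expansion -/

theorem InF.logLR_ae (hf : InF f) {m n : ℕ} {θ θ' : E (m + 2)} (hθ : ‖θ‖ = 1) (hθ' : ‖θ'‖ = 1)
    {k : ℝ} (hk : 0 < k) :
    ∀ᵐ x ∂(sampleLaw (m + 2) n θ k f), (∀ i, 0 < f (k * ⟪(x i : E (m + 2)), θ⟫)) ∧
      ((∀ i, 0 < f (k * ⟪(x i : E (m + 2)), θ'⟫)) →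
        logLR (sampleLaw (m + 2) n θ' k f) (sampleLaw (m + 2) n θ k f) x =
          ((∑ i, (Real.log (f (k * ⟪(x i : E (m + 2)), θ'⟫))
            - Real.log (f (k * ⟪(x i : E (m + 2)), θ⟫))) : ℝ) : EReal)) := by
  have hfm := hf.measurable
  have hP := hf.isProbabilityMeasure_rot θ' hθ' hk
  have hQ := hf.isProbabilityMeasure_rot θ hθ hk
  -- Since `f` may vanish on part of the negative axis, the law at `θ'` need not be dominated. On
  -- `A` it has density `r` with respect to the law at `θ`; the normalising constants do not depend
  -- on the direction and cancel.
  set A : Set (Sph (m + 2)) := {x | 0 < f (k * ⟪(x : E (m + 2)), θ⟫)} with hA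
  have hAm : MeasurableSet A := measurableSet_lt measurable_const (by fun_prop)
  set r : Sph (m + 2) → ℝ≥0∞ := fun x =>
    ENNReal.ofReal (f (k * ⟪(x : E (m + 2)), θ'⟫) / f (k * ⟪(x : E (m + 2)), θ⟫)) with hr
  have hrm : Measurable r := by
    rw [hr]; fun_prop
  have hc := hf.normConst_pos m hk
  have hΓ : 0 < Real.Gamma ((((m + 2 : ℕ) : ℝ) - 1) / 2) :=
    Real.Gamma_pos_of_pos (by push_cast; linarith [m.cast_nonneg (α := ℝ)])
  have hdens0 : ∀ x, x ∉ A → rotDensity (m + 2) θ k f x = 0 := by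
    intro x hx
    have : f (k * ⟪(x : E (m + 2)), θ⟫) = 0 := le_antisymm (not_lt.1 hx) (hf.nonneg _)
    rw [rotDensity, this, mul_zero]
  have hQA : (rot (m + 2) θ k f) Aᶜ = 0 := by
    rw [rot, withDensity_apply _ hAm.compl,
      setLIntegral_congr_fun (g := fun _ => 0) hAm.compl, lintegral_zero]
    intro x hx
    simp only [hdens0 x hx, ENNReal.ofReal_zero]
  have hPQ : (rot (m + 2) θ' k f).restrict A = (rot (m + 2) θ k f).withDensity r := by
    rw [rot, rot, restrict_withDensity hAm, ← withDensity_indicator hAm, ← withDensity_mul _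
      (hf.measurable_rotDensity _ θ k).ennreal_ofReal hrm]
    congr 1
    ext x
    rw [Pi.mul_apply]
    by_cases hx : x ∈ A
    · have hx' : f (k * ⟪(x : E (m + 2)), θ⟫) ≠ 0 := ne_of_gt hx
      rw [indicator_of_mem hx, hr, ← ENNReal.ofReal_mul (by
        rw [rotDensity]; have := hf.nonneg (k * ⟪(x : E (m + 2)), θ⟫); positivity)]
      simp only [rotDensity]
      congr 1
      field_simp
    · rw [indicator_of_notMem hx, hdens0 x hx, ENNReal.ofReal_zero, zero_mul]
  filter_upwards [rnDeriv_pi (n := n) hAm hQA hrm hPQ] with x hx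
  refine ⟨hx.1, fun hpos => ?_⟩
  rw [logLR, sampleLaw, sampleLaw, hx.2]
  have hprod : ∏ i, r (x i) = ENNReal.ofReal (∏ i,
      (f (k * ⟪(x i : E (m + 2)), θ'⟫) / f (k * ⟪(x i : E (m + 2)), θ⟫))) :=
    (ENNReal.ofReal_prod_of_nonneg fun i _ => (div_pos (hpos i) (hx.1 i)).le).symm
  rw [hprod, ENNReal.log_ofReal_of_pos (Finset.prod_pos fun i _ => div_pos (hpos i) (hx.1 i)),
    Real.log_prod fun i _ => (div_pos (hpos i) (hx.1 i)).ne']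
  congr 1
  exact Finset.sum_congr rfl fun i _ => Real.log_div (hpos i).ne' (hx.1 i).ne'

theorem infoMatrix_toEuclideanCLM {p : ℕ} (θ v : E p) :
    Matrix.toEuclideanCLM (𝕜 := ℝ) (infoMatrix θ) v = v - ⟪θ, v⟫ • θ := by
  ext i
  rw [Matrix.ofLp_toEuclideanCLM, infoMatrix, Matrix.sub_mulVec, Matrix.one_mulVec,
    Matrix.vecMulVec_mulVec]
  simp [PiLp.inner_apply, dotProduct, mul_comm]

theorem inner_infoMatrix {p : ℕ} (θ τ v : E p) :
    ⟪τ, Matrix.toEuclideanCLM (𝕜 := ℝ) (infoMatrix θ) v⟫ = ⟪τ, v⟫ - ⟪θ, v⟫ * ⟪τ, θ⟫ := by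
  rw [infoMatrix_toEuclideanCLM, inner_sub_right, inner_smul_right]

/-- Markov's inequality. The bound `W` may be infinite at points where `R` is. -/
theorem isLittleOP_of_lintegral {Ω : ℕ → Type*} [∀ n, MeasurableSpace (Ω n)]
    {P : ∀ n, Measure (Ω n)} {R : ∀ n, Ω n → EReal} {W : ∀ n, Ω n → ℝ≥0∞}
    (hW : ∀ n, Measurable (W n)) (hRW : ∀ᶠ n in atTop, ∀ᵐ x ∂(P n), (R n x).abs ≤ W n x)
    (h0 : Tendsto (fun n => ∫⁻ x, W n x ∂(P n)) atTop (𝓝 0)) : IsLittleOP P R := by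
  intro ε hε
  have hε0 : ENNReal.ofReal ε ≠ 0 := by simpa using hε
  have h1 : Tendsto (fun n => (∫⁻ x, W n x ∂(P n)) / ENNReal.ofReal ε) atTop (𝓝 0) := by
    have := ENNReal.Tendsto.div_const h0 (b := ENNReal.ofReal ε) (Or.inr hε0)
    rwa [ENNReal.zero_div] at this
  refine tendsto_of_tendsto_of_tendsto_of_le_of_le' tendsto_const_nhds h1
    (Eventually.of_forall fun n => zero_le) ?_
  filter_upwards [hRW] with n hn
  refine le_trans (measure_mono_ae ?_)
    (meas_ge_le_lintegral_div (hW n).aemeasurable hε0 ENNReal.ofReal_ne_top)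
  filter_upwards [hn] with x hx hx'
  exact le_trans hx' hx

/-- Pure algebra: `ℓ i` stands for a log-ratio, `s i` for `φ_f(κ x_i'θ)` and `φ` for `φ_f(κ)`. The
first four sums are the remainders (A), (B), (C) and (D) described above; the last term is the
difference between `½‖τ‖²` and `½τ'Γτ`. -/
theorem abs_logLikelihood_expansion_le {p n : ℕ} (hn : (n : ℝ) ≠ 0) {θ τ : E p} (hθ : ‖θ‖ = 1)
    {k ν φ : ℝ} (hk : 0 < k) (hν : 0 < ν) (hrate : n * k * φ * ν ^ 2 = 1)
    (hτ : ⟪τ, θ⟫ = -(1 / 2) * ν * ‖τ‖ ^ 2) (x : Fin n → Sph p) (ℓ s : Fin n → ℝ) :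
    |∑ i, ℓ i - (⟪τ, centralSeq θ ν x⟫
        - 1 / 2 * ⟪τ, Matrix.toEuclideanCLM (𝕜 := ℝ) (infoMatrix θ) τ⟫)| ≤
      ∑ i, |ℓ i - k * (ν * ⟪(x i : E p), τ⟫) * s i|
      + |∑ i, k * ν * ⟪(x i : E p), τ - ⟪τ, θ⟫ • θ⟫ * (s i - φ)|
      + ∑ i, 1 / 2 * k * ν ^ 2 * ‖τ‖ ^ 2 * |s i - φ|
      + ∑ i, 1 / 2 * ‖τ‖ ^ 2 * (1 - ⟪(x i : E p), θ⟫) / n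
      + 1 / 8 * ν ^ 2 * ‖τ‖ ^ 4 := by
  have hT : ⟪τ, ∑ i, (x i : E p)⟫ = ∑ i, ⟪(x i : E p), τ⟫ := by
    rw [inner_sum]
    exact Finset.sum_congr rfl fun i _ => real_inner_comm _ _
  have hU : ⟪θ, ∑ i, (x i : E p)⟫ = ∑ i, ⟪(x i : E p), θ⟫ := by
    rw [inner_sum]
    exact Finset.sum_congr rfl fun i _ => real_inner_comm _ _
  have hcs : ⟪τ, centralSeq θ ν x⟫ = ν⁻¹ * ((n : ℝ)⁻¹ * ∑ i, ⟪(x i : E p), τ⟫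
      - (n : ℝ)⁻¹ * (∑ i, ⟪(x i : E p), θ⟫) * ⟪τ, θ⟫) := by
    rw [centralSeq, inner_smul_right, inner_infoMatrix, sampleMean, inner_smul_right,
      inner_smul_right, hT, hU]
  have hinfo : ⟪τ, Matrix.toEuclideanCLM (𝕜 := ℝ) (infoMatrix θ) τ⟫ = ‖τ‖ ^ 2 - ⟪τ, θ⟫ ^ 2 := by
    rw [inner_infoMatrix, real_inner_self_eq_norm_sq, real_inner_comm]
    ring
  -- The rate is chosen for this: the linear term acquires the scaling of the central sequence.
  have hkφ : k * φ * ν = ν⁻¹ * (n : ℝ)⁻¹ := by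
    field_simp
    linarith
  have hsplit : ∑ i, k * (ν * ⟪(x i : E p), τ⟫) * s i
      = ∑ i, k * ν * ⟪(x i : E p), τ - ⟪τ, θ⟫ • θ⟫ * (s i - φ)
        + ∑ i, k * ν * ⟪τ, θ⟫ * ⟪(x i : E p), θ⟫ * (s i - φ)
        + k * φ * ν * ∑ i, ⟪(x i : E p), τ⟫ := by
    rw [Finset.mul_sum, ← Finset.sum_add_distrib, ← Finset.sum_add_distrib]
    refine Finset.sum_congr rfl fun i _ => ?_
    rw [inner_sub_right, inner_smul_right]
    ring
  have hD : ∑ i, 1 / 2 * ‖τ‖ ^ 2 * (1 - ⟪(x i : E p), θ⟫) / n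
      = 1 / 2 * ‖τ‖ ^ 2 - 1 / 2 * ‖τ‖ ^ 2 * (n : ℝ)⁻¹ * ∑ i, ⟪(x i : E p), θ⟫ := by
    rw [← Finset.sum_div, ← Finset.mul_sum, Finset.sum_sub_distrib]
    simp only [Finset.sum_const, Finset.card_univ, Fintype.card_fin, nsmul_eq_mul, mul_one]
    field_simp
  have hkey : ∑ i, ℓ i - (⟪τ, centralSeq θ ν x⟫
        - 1 / 2 * ⟪τ, Matrix.toEuclideanCLM (𝕜 := ℝ) (infoMatrix θ) τ⟫)
      = ∑ i, (ℓ i - k * (ν * ⟪(x i : E p), τ⟫) * s i)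
      + ∑ i, k * ν * ⟪(x i : E p), τ - ⟪τ, θ⟫ • θ⟫ * (s i - φ)
      + ∑ i, k * ν * ⟪τ, θ⟫ * ⟪(x i : E p), θ⟫ * (s i - φ)
      + ∑ i, 1 / 2 * ‖τ‖ ^ 2 * (1 - ⟪(x i : E p), θ⟫) / n
      - 1 / 8 * ν ^ 2 * ‖τ‖ ^ 4 := by
    rw [Finset.sum_sub_distrib, hsplit, hD, hkφ, hcs, hinfo, hτ]
    field_simp
    ring
  rw [hkey]
  have hA := Finset.abs_sum_le_sum_abs (fun i => ℓ i - k * (ν * ⟪(x i : E p), τ⟫) * s i)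
    Finset.univ
  have hC : |∑ i, k * ν * ⟪τ, θ⟫ * ⟪(x i : E p), θ⟫ * (s i - φ)| ≤
      ∑ i, 1 / 2 * k * ν ^ 2 * ‖τ‖ ^ 2 * |s i - φ| := by
    refine (Finset.abs_sum_le_sum_abs _ _).trans (Finset.sum_le_sum fun i _ => ?_)
    rw [abs_mul, abs_mul, hτ]
    refine mul_le_mul_of_nonneg_right ?_ (abs_nonneg _)
    have h1 : |k * ν * (-(1 / 2) * ν * ‖τ‖ ^ 2)| = 1 / 2 * k * ν ^ 2 * ‖τ‖ ^ 2 := by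
      rw [show k * ν * (-(1 / 2) * ν * ‖τ‖ ^ 2) = -(1 / 2 * k * ν ^ 2 * ‖τ‖ ^ 2) by ring, abs_neg,
        abs_of_nonneg (by positivity)]
    rw [h1]
    exact mul_le_of_le_one_right (by positivity) (abs_inner_le_one θ hθ (x i))
  have hDn : 0 ≤ ∑ i, 1 / 2 * ‖τ‖ ^ 2 * (1 - ⟪(x i : E p), θ⟫) / n :=
    Finset.sum_nonneg fun i _ => by
      have := (abs_le.1 (abs_inner_le_one θ hθ (x i))).2
      exact div_nonneg (mul_nonneg (by positivity) (by linarith)) n.cast_nonneg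
  have he : 0 ≤ 1 / 8 * ν ^ 2 * ‖τ‖ ^ 4 := by positivity
  generalize ∑ i, (ℓ i - k * (ν * ⟪(x i : E p), τ⟫) * s i) = a at *
  generalize ∑ i, k * ν * ⟪(x i : E p), τ - ⟪τ, θ⟫ • θ⟫ * (s i - φ) = b at *
  generalize ∑ i, k * ν * ⟪τ, θ⟫ * ⟪(x i : E p), θ⟫ * (s i - φ) = c at *
  generalize ∑ i, 1 / 2 * ‖τ‖ ^ 2 * (1 - ⟪(x i : E p), θ⟫) / n = d at *
  rw [abs_le]
  constructor <;> linarith [neg_abs_le a, le_abs_self a, neg_abs_le b, le_abs_self b,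
    neg_abs_le c, le_abs_self c]

theorem rate_sq {κ : ℕ → ℝ} {n : ℕ} (hn : 0 < (n : ℝ)) (hk : 0 < κ n) (hφ : 0 < phi f (κ n)) :
    n * κ n * phi f (κ n) * rate f κ n ^ 2 = 1 := by
  rw [rate, div_pow, sq_sqrt (by positivity)]
  field_simp

theorem norm_sub_inner_smul_le {p : ℕ} {θ : E p} (hθ : ‖θ‖ = 1) (τ : E p) :
    ‖τ - ⟪τ, θ⟫ • θ‖ ≤ ‖τ‖ := by
  rw [← sq_le_sq₀ (norm_nonneg _) (norm_nonneg _), norm_sub_sq_real, inner_smul_right, norm_smul,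
    hθ, mul_one, Real.norm_eq_abs, sq_abs]
  nlinarith [sq_nonneg ⟪τ, θ⟫]

theorem inner_sub_inner_smul {p : ℕ} {θ : E p} (hθ : ‖θ‖ = 1) (τ : E p) :
    ⟪τ - ⟪τ, θ⟫ • θ, θ⟫ = 0 := by
  rw [inner_sub_left, inner_smul_left, real_inner_self_eq_norm_sq, hθ]
  simp

/-! ### The remainders vanish in mean -/

section Remainders

variable {m : ℕ} {κ : ℕ → ℝ} {τ : ℕ → E (m + 2)} {θ : E (m + 2)}

/-- The summands are independent, and centred by the reflection symmetry. The second moment of the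
sum is therefore at most `n κ²ν²B² · o(φ/κ) = o(1)`, because `n κ φ ν² = 1`. -/
theorem InFLAN.tendsto_tangential (hf : InFLAN (m + 2) κ (fun n => ‖τ n‖) f) (hθ : ‖θ‖ = 1)
    (hκ : Tendsto κ atTop atTop) {B : ℝ} (hB : ∀ n, ‖τ n‖ ≤ B) :
    Tendsto (fun n => ∫⁻ x, ENNReal.ofReal |∑ i, κ n * rate f κ n *
        ⟪(x i : E (m + 2)), τ n - ⟪τ n, θ⟫ • θ⟫ *
          (phi f (κ n * ⟪(x i : E (m + 2)), θ⟫) - phi f (κ n))|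
        ∂(sampleLaw (m + 2) n θ (κ n) f)) atTop (𝓝 0) := by
  have hF := hf.inF
  have hφm := hF.measurable_phi
  have hB0 : 0 ≤ B := (norm_nonneg _).trans (hB 0)
  rw [ENNReal.tendsto_nhds_zero]
  intro δ hδ
  obtain ⟨η, hη, hηδ⟩ : ∃ η : ℝ, 0 < η ∧ ENNReal.ofReal (2 * η) ≤ δ := by
    rcases eq_or_ne δ ∞ with rfl | hδt
    · exact ⟨1, one_pos, le_top⟩
    · have hδr : 0 < δ.toReal := ENNReal.toReal_pos hδ.ne' hδt
      refine ⟨δ.toReal / 2, by positivity, ?_⟩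
      rw [mul_div_cancel₀ _ two_ne_zero, ENNReal.ofReal_toReal hδt]
  -- Makes the second moment at most `η²`, so each of the two terms of the `L¹` bound is at most
  -- `η`.
  set ε := η ^ 2 / (B ^ 2 + 1) with hε
  have hε0 : 0 < ε := by positivity
  filter_upwards [hF.eventually_pos hκ, hκ.eventually (hf.score_isSmallO θ hθ ε hε0)]
    with n hpos hsc
  obtain ⟨hn, hk, hφ, hν⟩ := hpos
  have hr := rate_sq hn hk hφ
  have hQ := hF.isProbabilityMeasure_rot θ hθ hk
  set k := κ n
  set ν := rate f κ n
  set a := τ n - ⟪τ n, θ⟫ • θ with ha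
  set g : Sph (m + 2) → ℝ := fun y =>
    k * ν * ⟪(y : E (m + 2)), a⟫ * (phi f (k * ⟪(y : E (m + 2)), θ⟫) - phi f k) with hg
  have hgm : Measurable g := by rw [hg]; fun_prop
  have hsq : ∫⁻ y, ENNReal.ofReal (g y ^ 2) ∂(rot (m + 2) θ k f) ≤
      ENNReal.ofReal (k ^ 2 * ν ^ 2 * B ^ 2 * (ε * (phi f k / k))) := by
    rw [ENNReal.ofReal_mul (by positivity)]
    refine le_trans ?_ (mul_le_mul_right hsc _)
    rw [← lintegral_const_mul' _ _ ENNReal.ofReal_ne_top]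
    refine lintegral_mono fun y => ?_
    rw [← ENNReal.ofReal_mul (by positivity)]
    refine ENNReal.ofReal_le_ofReal ?_
    rw [hg, mul_pow, mul_pow, mul_pow]
    have h1 : ⟪(y : E (m + 2)), a⟫ ^ 2 ≤ B ^ 2 := by
      rw [← sq_abs]
      refine pow_le_pow_left₀ (abs_nonneg _) ?_ 2
      have := abs_real_inner_le_norm (y : E (m + 2)) a
      rw [norm_eq_of_mem_sphere, one_mul] at this
      exact this.trans ((norm_sub_inner_smul_le hθ _).trans (hB n))
    gcongr
  have h0 : ∫ y, g y ∂(rot (m + 2) θ k f) = 0 := by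
    have := hF.integral_rot_odd θ k (a := a) (inner_sub_inner_smul hθ _)
      fun u => k * ν * (phi f (k * u) - phi f k)
    rw [← this]
    refine integral_congr_ae (Eventually.of_forall fun y => ?_)
    simp only [hg]
    ring
  refine le_trans (lintegral_abs_pi_sum_le (n := n) hgm
    (hsq.trans_lt ENNReal.ofReal_lt_top).ne h0 hη) (le_trans ?_ hηδ)
  calc _ ≤ ENNReal.ofReal η + ENNReal.ofReal (1 / η) *
        (n * ENNReal.ofReal (k ^ 2 * ν ^ 2 * B ^ 2 * (ε * (phi f k / k)))) := by gcongr
    _ = ENNReal.ofReal (η + 1 / η * (n * (k ^ 2 * ν ^ 2 * B ^ 2 * (ε * (phi f k / k))))) := by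
        rw [ENNReal.ofReal_add hη.le (by positivity), ENNReal.ofReal_mul (p := 1 / η) (by positivity),
          ENNReal.ofReal_mul (p := (n : ℝ)) hn.le, ENNReal.ofReal_natCast]
    _ ≤ ENNReal.ofReal (2 * η) := by
        refine ENNReal.ofReal_le_ofReal ?_
        have h2 : (n : ℝ) * (k ^ 2 * ν ^ 2 * B ^ 2 * (ε * (phi f k / k)))
            = (n * k * phi f k * ν ^ 2) * (B ^ 2 * ε) := by
          field_simp
        have h3 : B ^ 2 * ε ≤ η ^ 2 := by
          rw [hε, mul_div_assoc', div_le_iff₀ (by positivity)]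
          nlinarith [sq_nonneg η]
        rw [h2, hr, one_mul, two_mul, one_div, inv_mul_eq_div]
        have : B ^ 2 * ε / η ≤ η := by
          rw [div_le_iff₀ hη, ← sq]; exact h3
        linarith

/-- No centring is needed: the prefactor is of order `κν² = 1/(nφ)`, so it is enough that the mean
of `|φ_f(κ x'θ) - φ_f(κ)|` is `o(φ)`. The bound on the mean square, `o(φ/κ)`, gives this since `κφ`
tends to infinity. -/
theorem InFLAN.tendsto_radial (hf : InFLAN (m + 2) κ (fun n => ‖τ n‖) f) (hθ : ‖θ‖ = 1)
    (hκ : Tendsto κ atTop atTop) {B : ℝ} (hB : ∀ n, ‖τ n‖ ≤ B) :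
    Tendsto (fun n : ℕ => (n : ℝ≥0∞) * ∫⁻ y, ENNReal.ofReal
        (1 / 2 * κ n * rate f κ n ^ 2 * ‖τ n‖ ^ 2 *
          |phi f (κ n * ⟪(y : E (m + 2)), θ⟫) - phi f (κ n)|)
        ∂(rot (m + 2) θ (κ n) f)) atTop (𝓝 0) := by
  have hF := hf.inF
  have hφm := hF.measurable_phi
  have hB0 : 0 ≤ B := (norm_nonneg _).trans (hB 0)
  rw [ENNReal.tendsto_nhds_zero]
  intro δ hδ
  obtain ⟨η, hη, hηδ⟩ : ∃ η : ℝ, 0 < η ∧ ENNReal.ofReal (B ^ 2 * η) ≤ δ := by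
    rcases eq_or_ne δ ∞ with rfl | hδt
    · exact ⟨1, one_pos, le_top⟩
    · have hδr : 0 < δ.toReal := ENNReal.toReal_pos hδ.ne' hδt
      refine ⟨δ.toReal / (B ^ 2 + 1), by positivity, ENNReal.ofReal_le_of_le_toReal ?_⟩
      rw [mul_div_assoc', div_le_iff₀ (by positivity)]
      nlinarith
  filter_upwards [hF.eventually_pos hκ,
    hκ.eventually (hf.score_isSmallO θ hθ (η ^ 2) (by positivity)),
    (hF.tendsto_mul_phi.comp hκ).eventually_ge_atTop 1] with n hpos hsc hl
  obtain ⟨hn, hk, hφ, hν⟩ := hpos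
  have hl' : 1 ≤ κ n * phi f (κ n) := hl
  have hr := rate_sq hn hk hφ
  have hQ := hF.isProbabilityMeasure_rot θ hθ hk
  set k := κ n
  set ν := rate f κ n
  refine le_trans ?_ hηδ
  have h1 : ∫⁻ y, ENNReal.ofReal (1 / 2 * k * ν ^ 2 * ‖τ n‖ ^ 2 *
          |phi f (k * ⟪(y : E (m + 2)), θ⟫) - phi f k|) ∂(rot (m + 2) θ k f) ≤
      ENNReal.ofReal (1 / 2 * k * ν ^ 2 * B ^ 2 * (η * phi f k)) +
      ENNReal.ofReal (1 / 2 * k * ν ^ 2 * B ^ 2 * (η * phi f k)⁻¹ * (η ^ 2 * (phi f k / k))) := by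
    rw [ENNReal.ofReal_mul (p := 1 / 2 * k * ν ^ 2 * B ^ 2 * (η * phi f k)⁻¹) (by positivity)]
    refine le_trans ?_ (add_le_add_right (mul_le_mul_right hsc _) _)
    rw [← lintegral_const_mul' _ _ ENNReal.ofReal_ne_top]
    have h2 : ENNReal.ofReal (1 / 2 * k * ν ^ 2 * B ^ 2 * (η * phi f k))
        = ∫⁻ _ : Sph (m + 2), ENNReal.ofReal (1 / 2 * k * ν ^ 2 * B ^ 2 * (η * phi f k))
          ∂(rot (m + 2) θ k f) := by
      rw [lintegral_const, measure_univ, mul_one]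
    rw [h2, ← lintegral_add_left measurable_const]
    refine lintegral_mono fun y => ?_
    rw [← ENNReal.ofReal_mul (by positivity), ← ENNReal.ofReal_add (by positivity) (by positivity)]
    refine ENNReal.ofReal_le_ofReal ?_
    generalize phi f (k * ⟪(y : E (m + 2)), θ⟫) - phi f k = d
    have hc : 0 < η * phi f k := by positivity
    -- The threshold `ηφ` makes the constant part contribute `½B²η` in total, and the square part
    -- `½B²η/(κφ)`.
    have h3 : |d| ≤ η * phi f k + (η * phi f k)⁻¹ * d ^ 2 := by
      rw [← sq_abs d, inv_mul_eq_div, ← sub_le_iff_le_add', le_div_iff₀ hc]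
      nlinarith [sq_nonneg (|d| - η * phi f k), abs_nonneg d]
    calc 1 / 2 * k * ν ^ 2 * ‖τ n‖ ^ 2 * |d| ≤ 1 / 2 * k * ν ^ 2 * B ^ 2 *
          (η * phi f k + (η * phi f k)⁻¹ * d ^ 2) := by
          gcongr
          exact hB n
      _ = _ := by ring
  refine (mul_le_mul_right h1 _).trans ?_
  rw [← ENNReal.ofReal_add (by positivity) (by positivity), ← ENNReal.ofReal_natCast,
    ← ENNReal.ofReal_mul hn.le]
  refine ENNReal.ofReal_le_ofReal ?_
  have h4 : (n : ℝ) * (1 / 2 * k * ν ^ 2 * B ^ 2 * (η * phi f k) +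
      1 / 2 * k * ν ^ 2 * B ^ 2 * (η * phi f k)⁻¹ * (η ^ 2 * (phi f k / k)))
      = (n * k * phi f k * ν ^ 2) * (1 / 2 * B ^ 2 * η * (1 + (k * phi f k)⁻¹)) := by
    field_simp
  rw [h4, hr, one_mul]
  have h5 : (k * phi f k)⁻¹ ≤ 1 := inv_le_one_of_one_le₀ hl'
  have h6 : 0 ≤ B ^ 2 * η := by positivity
  nlinarith

theorem InF.tendsto_one_sub (hf : InF f) (hθ : ‖θ‖ = 1) (hκ : Tendsto κ atTop atTop) :
    Tendsto (fun n => ∫ y, (1 - ⟪(y : E (m + 2)), θ⟫) ∂(rot (m + 2) θ (κ n) f))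
      atTop (𝓝 0) := by
  have h1 := (hf.tendsto_moment θ hθ (a := 1) (b := 0) zero_le_one le_rfl).comp hκ
  have hl := hf.tendsto_mul_phi.comp hκ
  have h2 := h1.mul (tendsto_inv_atTop_zero.comp hl)
  rw [mul_zero] at h2
  refine h2.congr' ?_
  filter_upwards [hl.eventually_gt_atTop 0] with n hn
  have hn' : 0 < κ n * phi f (κ n) := hn
  simp only [Function.comp, Real.rpow_one, Real.rpow_zero, mul_one]
  rw [mul_comm, ← mul_assoc, inv_mul_cancel₀ hn'.ne', one_mul]

theorem InF.tendsto_rate (hf : InF f) (hκ : Tendsto κ atTop atTop) :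
    Tendsto (rate f κ) atTop (𝓝 0) := by
  have h1 : Tendsto (fun n : ℕ => (n : ℝ) * κ n * phi f (κ n)) atTop atTop := by
    simp only [mul_assoc]
    exact tendsto_natCast_atTop_atTop.atTop_mul_atTop₀ (hf.tendsto_mul_phi.comp hκ)
  have h2 := tendsto_inv_atTop_zero.comp (tendsto_sqrt_atTop.comp h1)
  refine h2.congr fun n => ?_
  simp [rate]

theorem InFLAN.tendsto_deterministic (hf : InFLAN (m + 2) κ (fun n => ‖τ n‖) f) (hθ : ‖θ‖ = 1)
    (hκ : Tendsto κ atTop atTop) {B : ℝ} (hB : ∀ n, ‖τ n‖ ≤ B) :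
    Tendsto (fun n : ℕ => (n : ℝ≥0∞) * ∫⁻ y, ENNReal.ofReal
        (1 / 2 * ‖τ n‖ ^ 2 * (1 - ⟪(y : E (m + 2)), θ⟫) / n) ∂(rot (m + 2) θ (κ n) f)
        + ENNReal.ofReal (1 / 8 * rate f κ n ^ 2 * ‖τ n‖ ^ 4)) atTop (𝓝 0) := by
  have hF := hf.inF
  have hB0 : 0 ≤ B := (norm_nonneg _).trans (hB 0)
  have h1 := ((hF.tendsto_one_sub hθ hκ).const_mul (1 / 2 * B ^ 2)).add
    (((hF.tendsto_rate hκ).pow 2).const_mul (1 / 8 * B ^ 4))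
  have h2 := ENNReal.tendsto_ofReal h1
  simp only [mul_zero, ne_eq, OfNat.ofNat_ne_zero, not_false_eq_true, zero_pow, add_zero,
    ENNReal.ofReal_zero] at h2
  refine tendsto_of_tendsto_of_tendsto_of_le_of_le' tendsto_const_nhds h2
    (Eventually.of_forall fun n => zero_le) ?_
  filter_upwards [hF.eventually_pos hκ] with n hpos
  obtain ⟨hn, hk, hφ, hν⟩ := hpos
  have hQ := hF.isProbabilityMeasure_rot θ hθ hk
  have hnn : ∀ y : Sph (m + 2), 0 ≤ 1 - ⟪(y : E (m + 2)), θ⟫ := fun y => by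
    linarith [(abs_le.1 (abs_inner_le_one θ hθ y)).2]
  have hint : Integrable (fun y : Sph (m + 2) => 1 - ⟪(y : E (m + 2)), θ⟫)
      (rot (m + 2) θ (κ n) f) := by
    refine integrable_of_bounded (by fun_prop) 2 fun y => ?_
    have := abs_le.1 (abs_inner_le_one θ hθ y)
    rw [abs_le]
    constructor <;> linarith
  have hIn : 0 ≤ ∫ y, (1 - ⟪(y : E (m + 2)), θ⟫) ∂(rot (m + 2) θ (κ n) f) :=
    integral_nonneg hnn
  rw [ENNReal.ofReal_add (by positivity) (by positivity)]
  refine add_le_add ?_ (ENNReal.ofReal_le_ofReal ?_)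
  · have h3 : ∀ y : Sph (m + 2), ENNReal.ofReal
        (1 / 2 * ‖τ n‖ ^ 2 * (1 - ⟪(y : E (m + 2)), θ⟫) / n) =
        ENNReal.ofReal (1 / 2 * ‖τ n‖ ^ 2 / n) * ENNReal.ofReal (1 - ⟪(y : E (m + 2)), θ⟫) := by
      intro y
      rw [← ENNReal.ofReal_mul (by positivity)]
      congr 1
      ring
    simp only [h3]
    rw [lintegral_const_mul' _ _ ENNReal.ofReal_ne_top,
      ← ofReal_integral_eq_lintegral_ofReal hint (Eventually.of_forall hnn),
      ← ENNReal.ofReal_mul (by positivity), ← ENNReal.ofReal_natCast, ← ENNReal.ofReal_mul hn.le]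
    refine ENNReal.ofReal_le_ofReal ?_
    rw [← mul_assoc]
    refine mul_le_mul_of_nonneg_right ?_ hIn
    rw [mul_div_cancel₀ _ hn.ne']
    gcongr
    exact hB n
  · calc 1 / 8 * rate f κ n ^ 2 * ‖τ n‖ ^ 4 ≤ 1 / 8 * rate f κ n ^ 2 * B ^ 4 := by
          gcongr; exact hB n
      _ = _ := by ring

/-- The local asymptotic quadraticity of the log-likelihood ratios. -/
theorem InFLAN.isLittleOP (hf : InFLAN (m + 2) κ (fun n => ‖τ n‖) f) (hθ : ‖θ‖ = 1)
    (hκpos : ∀ n, 0 < κ n) (hκ : Tendsto κ atTop atTop) {B : ℝ} (hB : ∀ n, ‖τ n‖ ≤ B)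
    (hθn : ∀ n, ‖θ + rate f κ n • τ n‖ = 1) :
    IsLittleOP (fun n => sampleLaw (m + 2) n θ (κ n) f)
      (fun n x =>
        logLR (sampleLaw (m + 2) n (θ + rate f κ n • τ n) (κ n) f)
            (sampleLaw (m + 2) n θ (κ n) f) x
          - ((⟪τ n, centralSeq θ (rate f κ n) x⟫
              - 1 / 2 * ⟪τ n, Matrix.toEuclideanCLM (𝕜 := ℝ) (infoMatrix θ) (τ n)⟫ : ℝ)
              : EReal)) := by
  have hF := hf.inF
  have hφm := hF.measurable_phi
  have hQ : ∀ n, IsProbabilityMeasure (rot (m + 2) θ (κ n) f) := fun n =>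
    hF.isProbabilityMeasure_rot θ hθ (hκpos n)
  set WA : ∀ n, Sph (m + 2) → ℝ≥0∞ := fun n y => logError f (κ n * ⟪(y : E (m + 2)), θ⟫)
    (κ n * (rate f κ n * ⟪(y : E (m + 2)), τ n⟫)) with hWA
  set WB : ∀ n, (Fin n → Sph (m + 2)) → ℝ≥0∞ := fun n x => ENNReal.ofReal
    |∑ i, κ n * rate f κ n * ⟪(x i : E (m + 2)), τ n - ⟪τ n, θ⟫ • θ⟫ *
          (phi f (κ n * ⟪(x i : E (m + 2)), θ⟫) - phi f (κ n))| with hWB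
  set WC : ∀ n, Sph (m + 2) → ℝ≥0∞ := fun n y => ENNReal.ofReal
        (1 / 2 * κ n * rate f κ n ^ 2 * ‖τ n‖ ^ 2 *
          |phi f (κ n * ⟪(y : E (m + 2)), θ⟫) - phi f (κ n)|) with hWC
  set WD : ∀ n : ℕ, Sph (m + 2) → ℝ≥0∞ := fun n y => ENNReal.ofReal
        (1 / 2 * ‖τ n‖ ^ 2 * (1 - ⟪(y : E (m + 2)), θ⟫) / n) with hWD
  have hmA : ∀ n, Measurable (WA n) := fun n => hF.measurable_logError.comp
      (g := fun z : ℝ × ℝ => logError f z.1 z.2)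
      (f := fun y : Sph (m + 2) => (κ n * ⟪(y : E (m + 2)), θ⟫,
        κ n * (rate f κ n * ⟪(y : E (m + 2)), τ n⟫))) (by fun_prop)
  have hmB : ∀ n, Measurable (WB n) := fun n => by simp only [hWB]; fun_prop
  have hmC : ∀ n, Measurable (WC n) := fun n => by simp only [hWC]; fun_prop
  have hmD : ∀ n, Measurable (WD n) := fun n => by simp only [hWD]; fun_prop
  have hsum : ∀ (W : ∀ n, Sph (m + 2) → ℝ≥0∞), (∀ n, Measurable (W n)) →
      ∀ n, Measurable fun x : Fin n → Sph (m + 2) => ∑ i, W n (x i) := fun W hW n =>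
    Finset.measurable_sum _ fun i _ => (hW n).comp (measurable_pi_apply i)
  refine isLittleOP_of_lintegral (W := fun n x => (∑ i, WA n (x i)) + (WB n x +
    ((∑ i, WC n (x i)) + ((∑ i, WD n (x i))
      + ENNReal.ofReal (1 / 8 * rate f κ n ^ 2 * ‖τ n‖ ^ 4))))) ?_ ?_ ?_
  · exact fun n => (hsum WA hmA n).add ((hmB n).add ((hsum WC hmC n).add
      ((hsum WD hmD n).add measurable_const)))
  · filter_upwards [hF.eventually_pos hκ] with n hpos
    obtain ⟨hn, hk, hφ, hν⟩ := hpos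
    filter_upwards [hF.logLR_ae (n := n) hθ (hθn n) hk] with x hx
    obtain ⟨hx0, hxL⟩ := hx
    by_cases hfin : ∀ i, 0 < f (κ n * ⟪(x i : E (m + 2)), θ + rate f κ n • τ n⟫)
    · rw [hxL hfin, ← EReal.coe_sub, EReal.abs_def]
      have hle := abs_logLikelihood_expansion_le hn.ne' hθ hk hν (rate_sq hn hk hφ)
        (inner_of_norm_add_smul hν.ne' hθ (hθn n)) x
        (fun i => Real.log (f (κ n * ⟪(x i : E (m + 2)), θ + rate f κ n • τ n⟫))
            - Real.log (f (κ n * ⟪(x i : E (m + 2)), θ⟫)))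
        (fun i => phi f (κ n * ⟪(x i : E (m + 2)), θ⟫))
      refine (ENNReal.ofReal_le_ofReal hle).trans ?_
      have hDnn : ∀ i, 0 ≤ 1 / 2 * ‖τ n‖ ^ 2 * (1 - ⟪(x i : E (m + 2)), θ⟫) / n := fun i => by
        have := (abs_le.1 (abs_inner_le_one θ hθ (x i))).2
        exact div_nonneg (mul_nonneg (by positivity) (by linarith)) hn.le
      refine ENNReal.ofReal_add_le.trans ?_
      simp only [← add_assoc]
      refine add_le_add_left (ENNReal.ofReal_add_le.trans (add_le_add
        (ENNReal.ofReal_add_le.trans (add_le_add (ENNReal.ofReal_add_le.trans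
          (add_le_add ?_ le_rfl)) ?_)) ?_)) _
      · rw [ENNReal.ofReal_sum_of_nonneg fun i _ => abs_nonneg _]
        refine Finset.sum_le_sum fun i _ => ?_
        have h1 : κ n * ⟪(x i : E (m + 2)), θ⟫ + κ n * (rate f κ n * ⟪(x i : E (m + 2)), τ n⟫)
            = κ n * ⟪(x i : E (m + 2)), θ + rate f κ n • τ n⟫ := by
          rw [inner_add_right, inner_smul_right]; ring
        simp only [hWA, logError]
        rw [if_neg (hx0 i).ne', h1, if_neg (hfin i).ne']
      · rw [ENNReal.ofReal_sum_of_nonneg fun i _ => by positivity]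
      · rw [ENNReal.ofReal_sum_of_nonneg fun i _ => hDnn i]
    -- Here some `f(κ x_i'θ_n)` vanishes. The linearisation error of that observation is `∞` by
    -- definition, so the bound is trivial.
    · push Not at hfin
      obtain ⟨i, hi⟩ := hfin
      have h1 : κ n * ⟪(x i : E (m + 2)), θ⟫ + κ n * (rate f κ n * ⟪(x i : E (m + 2)), τ n⟫)
          = κ n * ⟪(x i : E (m + 2)), θ + rate f κ n • τ n⟫ := by
        rw [inner_add_right, inner_smul_right]; ring
      have h2 : WA n (x i) = ∞ := by
        simp only [hWA, logError]
        rw [if_neg (hx0 i).ne', h1, if_pos (le_antisymm hi (hF.nonneg _))]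
      have h3 : ∑ i, WA n (x i) = ∞ := ENNReal.sum_eq_top.2 ⟨i, Finset.mem_univ i, h2⟩
      rw [h3, top_add]
      exact le_top
  · have hA := hf.tendsto_logError θ hθ hκ hθn
    have hBt := hf.tendsto_tangential hθ hκ hB
    have hC := hf.tendsto_radial hθ hκ hB
    have hD := hf.tendsto_deterministic hθ hκ hB
    have h := hA.add (hBt.add (hC.add hD))
    simp only [add_zero] at h
    refine h.congr fun n => ?_
    rw [lintegral_add_left (hsum WA hmA n), lintegral_add_left (hmB n),
      lintegral_add_left (hsum WC hmC n), lintegral_add_right _ measurable_const]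
    simp only [sampleLaw]
    rw [lintegral_pi_sum (hmA n), lintegral_pi_sum (hmC n), lintegral_pi_sum (hmD n),
      lintegral_const, measure_univ, mul_one]

end Remainders

/-! ### Asymptotic normality of the central sequence -/

section CentralLimit

variable {m : ℕ} {κ : ℕ → ℝ} {θ : E (m + 2)}

/-- Taylor's bound for `|y| ≤ 1`; for `|y| ≥ 1` the triangle inequality gives `2 + |y| + y²/2 ≤
4|y|³`. The constant is not sharp. -/
theorem norm_exp_mul_I_sub_le (y : ℝ) :
    ‖Complex.exp (y * Complex.I) - (1 + y * Complex.I - (y : ℂ) ^ 2 / 2)‖ ≤ 4 * |y| ^ 3 := by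
  have hI : (y * Complex.I) ^ 2 = -(y : ℂ) ^ 2 := by rw [mul_pow, Complex.I_sq]; ring
  rcases le_total |y| 1 with hy | hy
  · have hy' : ‖(y * Complex.I : ℂ)‖ ≤ 1 := by simpa using hy
    have h := Complex.exp_bound hy' (n := 3) (by norm_num)
    have h1 : ∑ j ∈ Finset.range 3, (y * Complex.I : ℂ) ^ j / (j.factorial : ℂ)
        = 1 + y * Complex.I - (y : ℂ) ^ 2 / 2 := by
      rw [Finset.sum_range_succ, Finset.sum_range_succ, Finset.sum_range_one, hI]
      simp [Nat.factorial]
      ring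
    rw [h1] at h
    refine h.trans ?_
    have h2 : ‖(y * Complex.I : ℂ)‖ = |y| := by simp
    rw [h2]
    have h3 : 0 ≤ |y| ^ 3 := by positivity
    norm_num [Nat.factorial]
    nlinarith
  · have h1 : ‖Complex.exp (y * Complex.I)‖ = 1 := Complex.norm_exp_ofReal_mul_I y
    have h2 : ‖(1 + y * Complex.I - (y : ℂ) ^ 2 / 2)‖ ≤ 1 + |y| + |y| ^ 2 / 2 := by
      refine (norm_sub_le _ _).trans (add_le_add ((norm_add_le _ _).trans ?_) ?_)
      · simp
      · simp
    refine (norm_sub_le _ _).trans ?_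
    rw [h1]
    nlinarith [mul_le_mul hy hy zero_le_one (by positivity), pow_le_pow_right₀ hy (show 1 ≤ 3 by norm_num),
      pow_le_pow_right₀ hy (show 2 ≤ 3 by norm_num), pow_le_pow_right₀ hy (show 0 ≤ 3 by norm_num)]

/-- The case `a = b = 1` of the moment asymptotics: with `q = (p-1)/2` the limit is `2Γ(q+1)/Γ(q) =
2q`. This cancels the `p - 1` of the tangential second moments, so the limiting covariance has no
extra constant. -/
theorem InF.tendsto_mul_integral_one_sub_sq (hf : InF f) (hθ : ‖θ‖ = 1) :
    Tendsto (fun k => k * phi f k * ∫ y, (1 - ⟪(y : E (m + 2)), θ⟫ ^ 2) ∂(rot (m + 2) θ k f))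
      atTop (𝓝 (((m + 2 : ℕ) : ℝ) - 1)) := by
  have h := hf.tendsto_moment θ hθ (a := 1) (b := 1) zero_le_one zero_le_one
  have hq : (0 : ℝ) < (((m + 2 : ℕ) : ℝ) - 1) / 2 := by push_cast; linarith [(Nat.cast_nonneg m : (0:ℝ) ≤ m)]
  rw [Real.Gamma_add_one hq.ne', mul_div_assoc, mul_div_cancel_right₀ _ (Real.Gamma_pos_of_pos hq).ne',
    Real.rpow_one, mul_div_cancel₀ _ (two_ne_zero)] at h
  refine h.congr fun k => ?_
  simp only [Real.rpow_one]
  congr 2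
  ext y
  ring

theorem InF.tendsto_rpow_mul_integral_cube (hf : InF f) (hθ : ‖θ‖ = 1) : ∃ C : ℝ,
    Tendsto (fun k => (k * phi f k) ^ (3 / 2 : ℝ) *
      ∫ y, (1 - ⟪(y : E (m + 2)), θ⟫ ^ 2) ^ (3 / 2 : ℝ) ∂(rot (m + 2) θ k f)) atTop (𝓝 C) := by
  refine ⟨_, (hf.tendsto_moment θ hθ (a := 3 / 2) (b := 3 / 2) (by norm_num)
    (by norm_num)).congr fun k => ?_⟩
  congr 2
  ext y
  have := abs_le.1 (abs_inner_le_one θ hθ y)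
  rw [← Real.mul_rpow (by linarith) (by linarith)]
  congr 1
  ring

/-- Third-order expansion of the characteristic function: the first moment vanishes by reflection,
the second is explicit by symmetry, and `|y's|³ ≤ ‖s‖³ (1 - (y'θ)²)^{3/2}` bounds the error. -/
theorem InF.norm_integral_exp_sub_le (hf : InF f) (hθ : ‖θ‖ = 1) {k : ℝ} (hk : 0 < k) {a : ℝ}
    (ha : 0 ≤ a) {s : E (m + 2)} (hs : ⟪s, θ⟫ = 0) :
    ‖(∫ y, Complex.exp ((a * ⟪(y : E (m + 2)), s⟫ : ℝ) * Complex.I) ∂(rot (m + 2) θ k f))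
      - (1 - (a ^ 2 / 2 * (‖s‖ ^ 2 / (((m + 2 : ℕ) : ℝ) - 1) *
        ∫ y, (1 - ⟪(y : E (m + 2)), θ⟫ ^ 2) ∂(rot (m + 2) θ k f)) : ℝ))‖
    ≤ 4 * a ^ 3 * ‖s‖ ^ 3 *
      ∫ y, (1 - ⟪(y : E (m + 2)), θ⟫ ^ 2) ^ (3 / 2 : ℝ) ∂(rot (m + 2) θ k f) := by
  have hP := hf.isProbabilityMeasure_rot θ hθ hk
  have h2 := hf.integral_rot_sq θ hθ hk hs
  set P := rot (m + 2) θ k f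
  have hm : Measurable fun y : Sph (m + 2) => ⟪(y : E (m + 2)), s⟫ := by fun_prop
  have hbd : ∀ y : Sph (m + 2), |⟪(y : E (m + 2)), s⟫| ≤ ‖s‖ := fun y => by
    refine (abs_real_inner_le_norm _ _).trans ?_
    rw [norm_eq_of_mem_sphere y, one_mul]
  have h1 : ∫ y, ⟪(y : E (m + 2)), s⟫ ∂P = 0 := by
    have := hf.integral_rot_odd θ k hs (fun _ => 1)
    simpa using this
  have i1 : Integrable (fun y : Sph (m + 2) => ⟪(y : E (m + 2)), s⟫) P :=
    integrable_of_bounded hm _ hbd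
  have i2 : Integrable (fun y : Sph (m + 2) => ⟪(y : E (m + 2)), s⟫ ^ 2) P := by
    refine integrable_of_bounded (by fun_prop) (‖s‖ ^ 2) fun y => ?_
    rw [abs_pow]
    exact pow_le_pow_left₀ (abs_nonneg _) (hbd y) 2
  have i3 : Integrable (fun y : Sph (m + 2) =>
      Complex.exp ((a * ⟪(y : E (m + 2)), s⟫ : ℝ) * Complex.I)) P := by
    refine Integrable.of_bound (C := 1) ?_ ?_
    · exact Measurable.aestronglyMeasurable (by fun_prop)
    · filter_upwards with y
      rw [Complex.norm_exp_ofReal_mul_I]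
  have i4 : Integrable (fun y : Sph (m + 2) => (1 : ℂ)
      + ((a * ⟪(y : E (m + 2)), s⟫ : ℝ) : ℂ) * Complex.I) P :=
    (integrable_const _).add ((i1.const_mul a).ofReal.mul_const _)
  have i5 : Integrable (fun y : Sph (m + 2) =>
      (((a * ⟪(y : E (m + 2)), s⟫ : ℝ) : ℂ) ^ 2) / 2) P := by
    have : Integrable (fun y : Sph (m + 2) =>
        ((a ^ 2 / 2 * ⟪(y : E (m + 2)), s⟫ ^ 2 : ℝ) : ℂ)) P := (i2.const_mul (a ^ 2 / 2)).ofReal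
    refine this.congr (Eventually.of_forall fun y => ?_)
    push_cast
    ring
  have h3 : ∫ y, ((1 : ℂ) + ((a * ⟪(y : E (m + 2)), s⟫ : ℝ) : ℂ) * Complex.I
      - (((a * ⟪(y : E (m + 2)), s⟫ : ℝ) : ℂ) ^ 2) / 2) ∂P
      = 1 - ((a ^ 2 / 2 * (‖s‖ ^ 2 / (((m + 2 : ℕ) : ℝ) - 1) *
        ∫ y, (1 - ⟪(y : E (m + 2)), θ⟫ ^ 2) ∂P) : ℝ) : ℂ) := by
    rw [integral_sub i4 i5, integral_add (integrable_const _)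
      ((i1.const_mul a).ofReal.mul_const _), integral_mul_const, integral_complex_ofReal,
      integral_const_mul, h1, ← h2]
    have h4 : ∫ y : Sph (m + 2), (((a * ⟪(y : E (m + 2)), s⟫ : ℝ) : ℂ) ^ 2) / 2 ∂P
        = ((a ^ 2 / 2 * ∫ y : Sph (m + 2), ⟪(y : E (m + 2)), s⟫ ^ 2 ∂P : ℝ) : ℂ) := by
      rw [← integral_const_mul, ← integral_complex_ofReal]
      refine integral_congr_ae (Eventually.of_forall fun y => ?_)
      push_cast
      ring
    rw [h4]
    simp
  have i6 : Integrable (fun y : Sph (m + 2) => (1 : ℂ)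
      + ((a * ⟪(y : E (m + 2)), s⟫ : ℝ) : ℂ) * Complex.I
      - (((a * ⟪(y : E (m + 2)), s⟫ : ℝ) : ℂ) ^ 2) / 2) P := i4.sub i5
  rw [← h3, ← integral_sub i3 i6, ← integral_const_mul]
  refine norm_integral_le_of_norm_le (Integrable.const_mul ?_ _) (Eventually.of_forall fun y => ?_)
  · refine integrable_of_bounded (by fun_prop) 1 fun y => ?_
    have h5 := abs_inner_le_one θ hθ y
    have h6 : ⟪(y : E (m + 2)), θ⟫ ^ 2 ≤ 1 := by rw [← sq_abs]; exact pow_le_one₀ (abs_nonneg _) h5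
    rw [abs_of_nonneg (Real.rpow_nonneg (by linarith) _)]
    exact Real.rpow_le_one (by linarith) (by nlinarith [sq_nonneg ⟪(y : E (m + 2)), θ⟫]) (by norm_num)
  · refine (norm_exp_mul_I_sub_le _).trans ?_
    rw [abs_mul, abs_of_nonneg ha, mul_pow, mul_assoc, mul_assoc]
    gcongr
    have h5 := inner_sq_le θ hθ hs y
    have h7 : 0 ≤ 1 - ⟪(y : E (m + 2)), θ⟫ ^ 2 := by
      have h5 := abs_inner_le_one θ hθ y
      have h6 : ⟪(y : E (m + 2)), θ⟫ ^ 2 ≤ 1 := by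
        rw [← sq_abs]; exact pow_le_one₀ (abs_nonneg _) h5
      linarith
    have h8 : ∀ b : ℝ, 0 ≤ b → b ^ 3 = (b ^ 2) ^ (3 / 2 : ℝ) := fun b hb => by
      rw [← Real.rpow_natCast, ← Real.rpow_natCast, ← Real.rpow_mul hb]; norm_num
    rw [h8 _ (abs_nonneg _), h8 _ (norm_nonneg _), sq_abs, ← Real.mul_rpow (by positivity) h7]
    exact Real.rpow_le_rpow (by positivity) h5 (by norm_num)

/-- Uses `(1 + z_n/n)^n → e^z` when `z_n → z`. With `a = ν⁻¹n⁻¹` one has `n a² = κφ`, which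
normalises the second moment, while `n a³ = (κφ)^{3/2} n^{-1/2}` leaves a cubic error of order
`n^{-1/2}`. -/
theorem InF.tendsto_integral_exp_pow (hf : InF f) (hθ : ‖θ‖ = 1) (hκ : Tendsto κ atTop atTop)
    {s : E (m + 2)} (hs : ⟪s, θ⟫ = 0) :
    Tendsto (fun n : ℕ => (∫ y, Complex.exp ((((rate f κ n)⁻¹ * (n : ℝ)⁻¹) *
        ⟪(y : E (m + 2)), s⟫ : ℝ) * Complex.I) ∂(rot (m + 2) θ (κ n) f)) ^ n)
      atTop (𝓝 (Complex.exp ((-(‖s‖ ^ 2 / 2) : ℝ) : ℂ))) := by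
  have key : Tendsto (fun n : ℕ => (n : ℂ) * ((∫ y, Complex.exp ((((rate f κ n)⁻¹ * (n : ℝ)⁻¹) *
        ⟪(y : E (m + 2)), s⟫ : ℝ) * Complex.I) ∂(rot (m + 2) θ (κ n) f)) - 1))
      atTop (𝓝 ((-(‖s‖ ^ 2 / 2) : ℝ) : ℂ)) := by
    obtain ⟨C, hC⟩ := hf.tendsto_rpow_mul_integral_cube (m := m) hθ
    have h1 := (hf.tendsto_mul_integral_one_sub_sq (m := m) hθ).comp hκ
    have hq : (0 : ℝ) < ((m + 2 : ℕ) : ℝ) - 1 := by push_cast; linarith [(Nat.cast_nonneg m : (0:ℝ) ≤ m)]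
    have h2 := h1.const_mul (-(‖s‖ ^ 2 / (((m + 2 : ℕ) : ℝ) - 1) / 2))
    have h3 : -(‖s‖ ^ 2 / (((m + 2 : ℕ) : ℝ) - 1) / 2) * (((m + 2 : ℕ) : ℝ) - 1)
        = -(‖s‖ ^ 2 / 2) := by field_simp
    rw [h3] at h2
    have h4 := (Complex.continuous_ofReal.tendsto _).comp h2
    have h5 := ((hC.comp hκ).const_mul (4 * ‖s‖ ^ 3)).mul
      (tendsto_inv_atTop_zero.comp (tendsto_sqrt_atTop.comp tendsto_natCast_atTop_atTop))
    rw [mul_zero] at h5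
    refine (tendsto_iff_of_dist ?_).1 h4
    refine squeeze_zero' (Eventually.of_forall fun _ => dist_nonneg) ?_ h5
    filter_upwards [hf.eventually_pos hκ] with n hpos
    obtain ⟨hn, hk, hφ, hν⟩ := hpos
    have hr := rate_sq hn hk hφ
    have hb := hf.norm_integral_exp_sub_le hθ hk (a := (rate f κ n)⁻¹ * (n : ℝ)⁻¹)
      (by positivity) hs
    simp only [Function.comp]
    set ν := rate f κ n
    set l := κ n * phi f (κ n) with hl
    have hl0 : 0 < l := by positivity
    set a := ν⁻¹ * (n : ℝ)⁻¹ with ha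
    have ha0 : 0 < a := by positivity
    have ha2 : n * a ^ 2 = l := by
      have : n * l * ν ^ 2 = 1 := by rw [hl, ← mul_assoc]; exact hr
      rw [ha]
      field_simp
      linarith
    have ha1 : a = √l * (√(n : ℝ))⁻¹ := by
      rw [← Real.sqrt_inv, ← Real.sqrt_mul hl0.le, eq_comm, Real.sqrt_eq_iff_eq_sq (by positivity) ha0.le]
      rw [← ha2]
      field_simp
    have hl32 : l ^ (3 / 2 : ℝ) = l * √l := by
      rw [show (3 / 2 : ℝ) = 1 + 1 / 2 by norm_num, Real.rpow_add hl0, Real.rpow_one,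
        Real.sqrt_eq_rpow]
    have hna3 : n * a ^ 3 = l ^ (3 / 2 : ℝ) * (√(n : ℝ))⁻¹ := by
      rw [hl32, mul_assoc, ← ha1, ← ha2]; ring
    rw [dist_comm, dist_eq_norm]
    have h6 : ∀ z : ℂ, ∀ b c: ℝ, n * b = c → (n : ℂ) * (z - 1) - ((-c : ℝ) : ℂ)
        = n * (z - (1 - (b : ℝ))) := by
      intro z b c hbc
      rw [← hbc]
      push_cast
      ring
    have h7 : -(‖s‖ ^ 2 / (((m + 2 : ℕ) : ℝ) - 1) / 2) *
        (l * ∫ y, (1 - ⟪(y : E (m + 2)), θ⟫ ^ 2) ∂(rot (m + 2) θ (κ n) f))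
        = -(‖s‖ ^ 2 / (((m + 2 : ℕ) : ℝ) - 1) / 2 *
        (l * ∫ y, (1 - ⟪(y : E (m + 2)), θ⟫ ^ 2) ∂(rot (m + 2) θ (κ n) f))) := by ring
    rw [h7, h6 _ (a ^ 2 / 2 * (‖s‖ ^ 2 / (((m + 2 : ℕ) : ℝ) - 1) *
        ∫ y, (1 - ⟪(y : E (m + 2)), θ⟫ ^ 2) ∂(rot (m + 2) θ (κ n) f))) _ (by rw [← ha2]; ring),
      norm_mul, Complex.norm_natCast]
    refine (mul_le_mul_of_nonneg_left hb hn.le).trans_eq ?_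
    have h8 : ∀ J : ℝ, n * (4 * a ^ 3 * ‖s‖ ^ 3 * J) = n * a ^ 3 * (4 * ‖s‖ ^ 3 * J) := fun J => by
      ring
    rw [h8, hna3]
    ring
  have := Complex.tendsto_one_add_pow_exp_of_tendsto key
  simpa using this

theorem centralSeq_eq {p n : ℕ} (θ : E p) (ν : ℝ) (x : Fin n → Sph p) :
    centralSeq θ ν x = ν⁻¹ • (sampleMean x - ⟪θ, sampleMean x⟫ • θ) := by
  rw [centralSeq, infoMatrix_toEuclideanCLM]

/-- The projection is self-adjoint, so it can be moved onto `t`; only tangential directions then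
enter the characteristic function. -/
theorem inner_centralSeq {p n : ℕ} (θ : E p) (ν : ℝ) (x : Fin n → Sph p) (t : E p) :
    ⟪centralSeq θ ν x, t⟫ = ∑ i, ν⁻¹ * (n : ℝ)⁻¹ * ⟪(x i : E p), t - ⟪t, θ⟫ • θ⟫ := by
  have h : ∀ u : E p, ⟪u - ⟪θ, u⟫ • θ, t⟫ = ⟪u, t - ⟪t, θ⟫ • θ⟫ := fun u => by
    rw [inner_sub_left, inner_sub_right, inner_smul_left, inner_smul_right, real_inner_comm u θ,
      real_inner_comm θ t]
    simp
    ring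
  rw [centralSeq_eq, inner_smul_left, h, sampleMean, inner_smul_left, sum_inner, ← Finset.mul_sum]
  simp [mul_assoc]

theorem measurable_centralSeq {p n : ℕ} (θ : E p) (ν : ℝ) :
    Measurable fun x : Fin n → Sph p => centralSeq θ ν x := by
  have h : Measurable fun x : Fin n → Sph p => (sampleMean x : E p) := by
    unfold sampleMean
    fun_prop
  simp only [centralSeq_eq]
  fun_prop

theorem dotProduct_infoMatrix {p : ℕ} {θ : E p} (hθ : ‖θ‖ = 1) (t : E p) :
    t.ofLp ⬝ᵥ (infoMatrix θ).mulVec t.ofLp = ‖t - ⟪t, θ⟫ • θ‖ ^ 2 := by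
  have h : t.ofLp ⬝ᵥ (infoMatrix θ).mulVec t.ofLp
      = ⟪t, Matrix.toEuclideanCLM (𝕜 := ℝ) (infoMatrix θ) t⟫ := by
    rw [EuclideanSpace.inner_eq_star_dotProduct, Matrix.ofLp_toEuclideanCLM, star_trivial,
      dotProduct_comm]
  rw [h, inner_infoMatrix, norm_sub_sq_real, real_inner_self_eq_norm_sq, inner_smul_right,
    norm_smul, hθ, mul_one, Real.norm_eq_abs, sq_abs, real_inner_comm]
  ring

theorem posSemidef_infoMatrix {p : ℕ} {θ : E p} (hθ : ‖θ‖ = 1) : (infoMatrix θ).PosSemidef := by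
  refine Matrix.PosSemidef.of_dotProduct_mulVec_nonneg ?_ fun x => ?_
  · ext i j
    simp [infoMatrix, Matrix.vecMulVec_apply, Matrix.one_apply, eq_comm, mul_comm]
  · rw [star_trivial]
    have h := dotProduct_infoMatrix hθ (WithLp.toLp 2 x)
    rw [show x ⬝ᵥ (infoMatrix θ).mulVec x = _ from h]
    positivity

theorem charFun_map_centralSeq {p n : ℕ} (θ : E p) (ν : ℝ) {k : ℝ}
    [IsProbabilityMeasure (rot p θ k f)] (t : E p) :
    charFun ((sampleLaw p n θ k f).map fun x => centralSeq θ ν x) t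
      = (∫ y, Complex.exp ((ν⁻¹ * (n : ℝ)⁻¹ * ⟪(y : E p), t - ⟪t, θ⟫ • θ⟫ : ℝ) * Complex.I)
        ∂(rot p θ k f)) ^ n := by
  rw [charFun_apply, integral_map (measurable_centralSeq θ ν).aemeasurable
    (Measurable.aestronglyMeasurable (by fun_prop))]
  simp only [inner_centralSeq, Complex.ofReal_sum, Finset.sum_mul, Complex.exp_sum, sampleLaw]
  rw [integral_fintype_prod_eq_prod (fun (_ : Fin n) (y : Sph p) =>
    Complex.exp ((ν⁻¹ * (n : ℝ)⁻¹ * ⟪(y : E p), t - ⟪t, θ⟫ • θ⟫ : ℝ) * Complex.I))]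
  simp

/-- Lévy's continuity theorem: at `t`, the limit is `exp(-½‖s‖²)` with `s` the tangential part of
`t`, and `‖s‖² = t'Γt`. -/
theorem InF.tendstoInDistribution_centralSeq (hf : InF f) (hθ : ‖θ‖ = 1) (hκpos : ∀ n, 0 < κ n)
    (hκ : Tendsto κ atTop atTop) [∀ n, IsProbabilityMeasure (sampleLaw (m + 2) n θ (κ n) f)] :
    TendstoInDistribution
      (fun n (x : Fin n → Sph (m + 2)) => centralSeq θ (rate f κ n) x) atTop
      (id : E (m + 2) → E (m + 2)) (fun n => sampleLaw (m + 2) n θ (κ n) f)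
      (multivariateGaussian 0 (infoMatrix θ)) where
  forall_aemeasurable n := (measurable_centralSeq θ _).aemeasurable
  tendsto := by
    refine ProbabilityMeasure.tendsto_iff_tendsto_charFun.2 fun t => ?_
    have hr := fun n => hf.isProbabilityMeasure_rot θ hθ (hκpos n)
    have hs : ⟪t - ⟪t, θ⟫ • θ, θ⟫ = 0 := inner_sub_inner_smul hθ t
    have h := hf.tendsto_integral_exp_pow hθ hκ hs
    simp only [ProbabilityMeasure.coe_mk, charFun_map_centralSeq, Measure.map_id]
    rw [charFun_multivariateGaussian (posSemidef_infoMatrix hθ), dotProduct_infoMatrix hθ]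
    convert h using 2
    simp

end CentralLimit

end HighConc

theorem theorem7 (p : ℕ) (hp : 2 ≤ p) (θ : HighConc.E p) (hθ : ‖θ‖ = 1)
    (f : ℝ → ℝ) (κ : ℕ → ℝ) (hκpos : ∀ n, 0 < κ n) (hκ : Tendsto κ atTop atTop)
    (τ : ℕ → HighConc.E p) (hτ : ∃ B : ℝ, ∀ n, ‖τ n‖ ≤ B)
    (hθn : ∀ n, ‖θ + HighConc.rate f κ n • τ n‖ = 1)
    (hf : HighConc.InFLAN p κ (fun n => ‖τ n‖) f) :
    HighConc.IsLittleOP (fun n => HighConc.sampleLaw p n θ (κ n) f)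
      (fun n x =>
        HighConc.logLR
            (HighConc.sampleLaw p n (θ + HighConc.rate f κ n • τ n) (κ n) f)
            (HighConc.sampleLaw p n θ (κ n) f) x
          - ((⟪τ n, HighConc.centralSeq θ (HighConc.rate f κ n) x⟫
              - 1 / 2 * ⟪τ n, Matrix.toEuclideanCLM (𝕜 := ℝ) (HighConc.infoMatrix θ) (τ n)⟫ : ℝ)
              : EReal))
    ∧ ∃ _ : ∀ n, IsProbabilityMeasure (HighConc.sampleLaw p n θ (κ n) f),
        TendstoInDistribution
          (fun n (x : Fin n → HighConc.Sph p) => HighConc.centralSeq θ (HighConc.rate f κ n) x)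
          atTop (id : HighConc.E p → HighConc.E p)
          (fun n => HighConc.sampleLaw p n θ (κ n) f)
          (multivariateGaussian 0 (HighConc.infoMatrix θ)) := by
  obtain ⟨m, rfl⟩ : ∃ m, p = m + 2 := ⟨p - 2, by omega⟩
  obtain ⟨B, hB⟩ := hτ
  have hP : ∀ n, IsProbabilityMeasure (HighConc.sampleLaw (m + 2) n θ (κ n) f) := fun n => by
    have := hf.inF.isProbabilityMeasure_rot θ hθ (hκpos n)
    unfold HighConc.sampleLaw
    infer_instance
  exact ⟨hf.isLittleOP hθ hκpos hκ hB hθn, hP,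
    hf.inF.tendstoInDistribution_centralSeq hθ hκpos hκ⟩
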